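/- Regard $\mathbb{H}^2$ as a right quaternionic vector space of column vectors with inner product $\langle v,w\rangle=\sum_j\overline{v_j}\,w_j$, on which the unitary group $U_2(\mathbb{H})$ acts from the left; a line is a subspace $v\mathbb{H}$, $v\ne0$. Let $Q_8=\{\pm1,\pm i,\pm j,\pm k\}$ and let $$P_1=\Bigl\langle \begin{pmatrix} i&0\\0&1\end{pmatrix},\ \tfrac12\begin{pmatrix}1+j&-1+j\\-1+j&1+j\end{pmatrix}\Bigr\rangle,\quad P_2=\Bigl\langle P_1,\begin{pmatrix} j&0\\0&1\end{pmatrix}\Bigr\rangle,\quad P_3=\Bigl\langle \begin{pmatrix} i&0\\0&1\end{pmatrix},\begin{pmatrix} j&0\\0&1\end{pmatrix},\tfrac1{\sqrt2}\begin{pmatrix}1&1\\1&-1\end{pmatrix}\Bigr\rangle ,$$ which are subgroups of $U_2(\mathbb{H})$ of orders $320$, $1920$, $3840$. A subgroup is reducible if it has an invariant subspace other than $0$ and $\mathbb{H}^2$, and a maximal reducible subgroup of $G$ is a maximal element of the set of reducible subgroups of $G$. A line is fixed by $H$ if every element of $H$ maps it onto itself. The angles of a set of lines are the numbers $|\langle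 v,w\rangle|^2$, where $v,w$ are unit vectors spanning different lines of the set. A set of $n$ lines, spanned by unit vectors $v_1,\dots,v_n$, is a spherical $3$-design if $\sum_{a,b}|\langle v_a,v_b\rangle|^{6}=\frac15 n^2$ (that is, a spherical $(3,3)$-design for $\mathbb{H}^2$). A root line of a group is the line spanned by a root of a reflection in the group. Let $M$ be the set of the lines of the five mutually unbiased bases $\{(1,0),(0,1)\}$ and $\{\frac1{\sqrt2}(1,q),\frac1{\sqrt2}(1,-q)\}$, $q\in\{1,i,j,k\}$, and let $W,W',A,B$ be the sets of lines spanned by the following vectors: - $W$: $(1+\sqrt5,\ q(1+i+j+k))$ and $(q(1+i+j+k),\ 1+\sqrt5)$, $q\in Q_8$; - $W'$: $(1+\sqrt5,\ q(-1+i+j+k))$ and $(q(-1+i+j+k),\ 1+\sqrt5)$, $q\in Q_8$; - $A$: $(\sqrt2,\ i^m\alpha)$, $(1+\sqrt2,\ i^mj)$, $(i^mj,\ 1+\sqrt2)$, $\alpha\in\{1+i,i+j,i-j\}$, $0\le m\le3$; - $B$: $(\sqrt2,\ i^m\alpha)$, $(1+\sqrt2,\ i^m)$, $(i^m,\ 1+\sqrt2)$,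 $\alpha\in\{1+j,1-j,j-k\}$, $0\le m\le3$. Put $e=(1,0)$, $w=(1+\sqrt5,1+i+j+k)$, $w'=(-1+i+j+k,1+\sqrt5)$, $a=(\sqrt2,1+i)$, $b=(\sqrt2,1+j)$, $c=(\sqrt3,1+i+j)$, $d=(3,1+i+j)$, and let $C$ and $D$ be the $P_3$-orbits of the lines of $c$ and $d$. Then the following hold. 1. The maximal reducible subgroups of $P_1$ form exactly four conjugacy classes, represented by $$H_{32}=\Bigl\langle \begin{pmatrix} i&0\\0&1\end{pmatrix},\begin{pmatrix} i&0\\0&i\end{pmatrix},\begin{pmatrix} j&0\\0&j\end{pmatrix}\Bigr\rangle,\quad H_{20}=\Bigl\langle \begin{pmatrix} j&0\\0&k\end{pmatrix},\tfrac12\begin{pmatrix} i-j&i-j\\ i-j&-i+j\end{pmatrix}\Bigr\rangle,$$ $$H_{16}=\Bigl\langle \begin{pmatrix} j&0\\0&k\end{pmatrix},\begin{pmatrix} 0&j\\j&0\end{pmatrix}\Bigr\rangle,\quad H_{16}'=\Bigl\langle \begin{pmatrix} j&0\\0&j\end{pmatrix},\tfrac12\begin{pmatrix} i-k&1-j\\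 1+j&-i-k\end{pmatrix}\Bigr\rangle,$$ of orders $32,20,16,16$. The lines that they fix are exactly those spanned by, respectively, $(1,0),(0,1)$; $w,w'$; $a,(-1+i,\sqrt2)$; $b,(-1+j,\sqrt2)$. The $P_1$-orbits of the lines fixed by maximal reducible subgroups of $P_1$ are exactly $M,W,W',A,B$. 2. The lines of $M$ are root lines of $P_3$, there are exactly $40$ root lines of $P_3$ that are not in $M$, and $A$, $B$ partition the set of these. 3. The maximal reducible subgroups of $P_2$ form exactly four conjugacy classes, represented by the stabilisers in $P_2$ of the lines of $e,w,a,c$; the $P_2$-orbits of the lines that maximal reducible subgroups of $P_2$ fix are exactly $M$, $W$, $W'$, $A\cup B$, $C$. The maximal reducible subgroups of $P_3$ form exactly five conjugacy classes, represented by the stabilisers in $P_3$ of the lines of $e,w,a,c,d$; the $P_3$-orbits of the lines that maximal reducible subgroups of $P_3$ fix are exactly $M$, $W\cup W'$, $A\cup B$, $C$, $D$. Every maximal reducible subgroup of $P_1$, $P_2$ or $P_3$ fixes only finitely many lines. 4. In each row of the following table, for each listed group $G$, the stabiliser in $G$ of the line of the fiducial vector has the listed order, and the $G$-orbit of this line is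 the listed set, which has the listed number of lines and exactly the listed angles and is a spherical $3$-design. The stabiliser is a maximal reducible subgroup of $G$ if and only if $G$ is marked by $\dagger$. | $G$ | order of stabiliser | fiducial | angles | lines | orbit | |---|---|---|---|---|---| | $P_1^\dagger,P_2^\dagger,P_3^\dagger$ | $32,192,384$ | $e$ | $0,\frac12$ | $10$ | $M$ | | $P_1^\dagger,P_2^\dagger$ | $20,120$ | $w$ | $\frac15,\frac35$ | $16$ | $W$ | | $P_1^\dagger,P_2^\dagger$ | $20,120$ | $w'$ | $\frac15,\frac35$ | $16$ | $W'$ | | $P_3^\dagger$ | $120$ | $w$ | $0,\frac15,\frac25,\frac35,\frac45$ | $32$ | $W\cup W'$ | | $P_1^\dagger$ | $16$ | $a$ | $0,\frac14,\frac12,\frac34$ | $20$ | $A$ | | $P_1^\dagger$ | $16$ | $b$ | $0,\frac14,\frac12,\frac34$ | $20$ | $B$ | | $P_2^\dagger,P_3^\dagger$ | $48,96$ | $a$ | $0,\frac14,\frac12,\frac34$ | $40$ | $A\cup B$ | | $P_1$ | $8$ | $c$ | $0,\frac16,\frac13,\frac12,\frac23,\frac56$ | $40$ | the $P_1$-orbit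 | | $P_2^\dagger,P_3^\dagger$ | $24,48$ | $c$ | $0,\frac16,\frac13,\frac12,\frac23,\frac56$ | $80$ | $C$ | | $P_1,P_2,P_3^\dagger$ | $4,24,48$ | $d$ | $0,\frac18,\frac28,\dots,\frac78$ | $80$ | $D$ | -/

import Mathlib

open Quaternion Matrix

namespace QuatP

/-- Column vectors in the right quaternionic space `ℍᵈ`. -/
abbrev Vec (d : ℕ) : Type := Fin d → ℍ[ℝ]

/-- The `2 × 2` matrices over the quaternions, acting on columns from the left. -/
abbrev Mat2 : Type := Matrix (Fin 2) (Fin 2) ℍ[ℝ]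

/-- The unitary group `U₂(ℍ)`; the star of a matrix is its conjugate transpose. -/
abbrev U2 : Type := unitary Mat2

/-- The quaternion units. -/
def qi : ℍ[ℝ] := ⟨0, 1, 0, 0⟩
def qj : ℍ[ℝ] := ⟨0, 0, 1, 0⟩
def qk : ℍ[ℝ] := ⟨0, 0, 0, 1⟩

/-- The quaternion group. -/
def Q8 : Set ℍ[ℝ] := {1, -1, qi, -qi, qj, -qj, qk, -qk}

/-- A real number as a quaternion. -/
noncomputable def ofR (x : ℝ) : ℍ[ℝ] := (x : ℍ[ℝ])

/-- The inner product `⟨v, w⟩ = ∑ conj(vⱼ) wⱼ` of `ℍᵈ`. -/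
noncomputable def ip {d : ℕ} (v w : Vec d) : ℍ[ℝ] := star v ⬝ᵥ w

/-- The squared norm of a vector of `ℍᵈ`. -/
noncomputable def sqNorm {d : ℕ} (v : Vec d) : ℝ := ∑ a, normSq (v a)

/-! ### Lines, and the action of the unitary group on subspaces -/

/-- (Right) subspaces of `ℍ²`. -/
abbrev Subsp : Type := Submodule (ℍ[ℝ])ᵐᵒᵖ (Vec 2)

/-- The span `v ℍ` of a vector; it is a line when `v ≠ 0`. -/
noncomputable def lineOf (v : Vec 2) : Subsp := Submodule.span (ℍ[ℝ])ᵐᵒᵖ {v}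

def IsLine (L : Subsp) : Prop := ∃ v : Vec 2, v ≠ 0 ∧ L = lineOf v

/-- The right linear map `v ↦ g v` given by a matrix. -/
noncomputable def mulMap (g : Mat2) : Vec 2 →ₗ[(ℍ[ℝ])ᵐᵒᵖ] Vec 2 where
  toFun v := g *ᵥ v
  map_add' v w := Matrix.mulVec_add g v w
  map_smul' c v := Matrix.mulVec_smul g c v

/-- The image `g W` of a subspace. -/
noncomputable def act (g : U2) (W : Subsp) : Subsp := W.map (mulMap (g : Mat2))

theorem act_one (W : Subsp) : act 1 W = W := by
  have h : mulMap ((1 : U2) : Mat2) = LinearMap.id := by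
    refine LinearMap.ext fun v => ?_
    change ((1 : U2) : Mat2) *ᵥ v = v
    rw [OneMemClass.coe_one, Matrix.one_mulVec]
  rw [act, h, Submodule.map_id]

theorem act_mul (g h : U2) (W : Subsp) : act (g * h) W = act g (act h W) := by
  have e : mulMap ((g * h : U2) : Mat2) = (mulMap (g : Mat2)).comp (mulMap (h : Mat2)) := by
    refine LinearMap.ext fun v => ?_
    change ((g * h : U2) : Mat2) *ᵥ v = (g : Mat2) *ᵥ ((h : Mat2) *ᵥ v)
    rw [Matrix.mulVec_mulVec]
    rfl
  rw [act, e, Submodule.map_comp]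
  rfl

/-- The stabiliser in `G` of a subspace (as a set, not pointwise). -/
noncomputable def lineStab (G : Subgroup U2) (L : Subsp) : Subgroup U2 where
  carrier := {g | g ∈ G ∧ act g L = L}
  one_mem' := ⟨G.one_mem, act_one L⟩
  mul_mem' := by
    rintro a b ⟨ha, ha'⟩ ⟨hb, hb'⟩
    exact ⟨G.mul_mem ha hb, by rw [act_mul, hb', ha']⟩
  inv_mem' := by
    rintro a ⟨ha, ha'⟩
    refine ⟨G.inv_mem ha, ?_⟩
    calc act a⁻¹ L = act a⁻¹ (act a L) := by rw [ha']
      _ = L := by rw [← act_mul, inv_mul_cancel, act_one]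

/-- The lines that every element of `H` maps to themselves. -/
def fixedLines (H : Subgroup U2) : Set Subsp :=
  {L | IsLine L ∧ ∀ g ∈ H, act g L = L}

/-- The `G`-orbit of a line. -/
def orbit (G : Subgroup U2) (L : Subsp) : Set Subsp := {M | ∃ g ∈ G, M = act g L}

/-- `H` is reducible: it has an invariant subspace other than `0` and `ℍ²`. -/
def IsReducible (H : Subgroup U2) : Prop :=
  ∃ W : Subsp, W ≠ ⊥ ∧ W ≠ ⊤ ∧ ∀ g ∈ H, act g W ≤ W

/-- `H` is maximal among the reducible subgroups of `G`. -/
def IsMaxReducible (G H : Subgroup U2) : Prop :=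
  Maximal (fun K : Subgroup U2 => K ≤ G ∧ IsReducible K) H

/-- `H'` is conjugate to `H` by an element of `G`. -/
def AreConjIn (G H H' : Subgroup U2) : Prop :=
  ∃ g ∈ G, H' = H.map (MulAut.conj g).toMonoidHom

/-- `H 0, …, H (n-1)` represent the `G`-conjugacy classes of maximal reducible subgroups of `G`,
each class exactly once. -/
structure RepresentsMaxReducible (G : Subgroup U2) {n : ℕ} (H : Fin n → Subgroup U2) : Prop where
  isMax : ∀ a, IsMaxReducible G (H a)
  complete : ∀ K, IsMaxReducible G K → ∃ a, AreConjIn G (H a) K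
  distinct : ∀ a b, AreConjIn G (H a) (H b) → a = b

/-- The `G`-orbits of the lines fixed by the maximal reducible subgroups of `G`. -/
def maxReducibleOrbits (G : Subgroup U2) : Set (Set Subsp) :=
  {S | ∃ H, IsMaxReducible G H ∧ ∃ L ∈ fixedLines H, S = orbit G L}

/-! ### Angles, designs, mutually unbiased bases, reflections -/

/-- The angles `|⟨v, w⟩|²` between different lines of `S` given by unit vectors. -/
def angleSet (S : Set Subsp) : Set ℝ :=
  {x | ∃ v w : Vec 2, sqNorm v = 1 ∧ sqNorm w = 1 ∧ lineOf v ∈ S ∧ lineOf w ∈ S ∧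
    lineOf v ≠ lineOf w ∧ x = normSq (ip v w)}

/-- The constant `c_t(ℍᵈ) = ∏_{j<t} (2 + j) / (2d + j)`. -/
noncomputable def designConst (t d : ℕ) : ℝ :=
  ∏ a ∈ Finset.range t, ((2 + a : ℝ) / (2 * d + a))

/-- The vectors `v₁, …, vₙ` form a spherical `(t, t)`-design for `ℍᵈ`. -/
def IsDesign {d n : ℕ} (t : ℕ) (v : Fin n → Vec d) : Prop :=
  ∑ a, ∑ b, normSq (ip (v a) (v b)) ^ t = designConst t d * (∑ a, sqNorm (v a) ^ t) ^ 2

/-- A set of lines, given by one unit vector for each line, is a spherical `(t, t)`-design. -/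
def IsLineDesign (t : ℕ) (S : Set Subsp) : Prop :=
  ∃ (n : ℕ) (v : Fin n → Vec 2), (∀ a, sqNorm (v a) = 1) ∧
    Function.Injective (fun a => lineOf (v a)) ∧ Set.range (fun a => lineOf (v a)) = S ∧
    IsDesign t v

/-- The families `B 0, …, B (m-1)` are mutually unbiased orthonormal bases of `ℍᵈ`. -/
def IsMUB {m d : ℕ} (B : Fin m → Fin d → Vec d) : Prop :=
  (∀ r a b, ip (B r a) (B r b) = if a = b then 1 else 0) ∧
  (∀ r s, r ≠ s → ∀ a b, normSq (ip (B r a) (B s b)) = 1 / (d : ℝ))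

/-- `g` is a reflection with root vector `a`: `g x = x` on the orthogonal complement of `a`, and
`g a = a ξ` for a unit scalar `ξ ≠ 1`. -/
def IsReflectionWithRoot (g : U2) (a : Vec 2) : Prop :=
  a ≠ 0 ∧ IsOfFinOrder g ∧ (∀ x, ip a x = 0 → (g : Mat2) *ᵥ x = x) ∧
    ∃ ξ : ℍ[ℝ], normSq ξ = 1 ∧ ξ ≠ 1 ∧ (g : Mat2) *ᵥ a = fun r => a r * ξ

/-- The root lines of the reflections in `G`. -/
def rootLines (G : Subgroup U2) : Set Subsp :=
  {L | ∃ g ∈ G, ∃ a, IsReflectionWithRoot g a ∧ L = lineOf a}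

/-! ### The groups -/

/-- The subgroup of `U₂(ℍ)` generated by the given unitary matrices. -/
noncomputable def genBy (S : Set Mat2) : Subgroup U2 := Subgroup.closure {g : U2 | (g : Mat2) ∈ S}

noncomputable def P1 : Subgroup U2 :=
  genBy {!![qi, 0; 0, 1], (1 / 2 : ℝ) • !![1 + qj, -1 + qj; -1 + qj, 1 + qj]}

noncomputable def P2 : Subgroup U2 :=
  genBy {!![qi, 0; 0, 1], !![qj, 0; 0, 1], (1 / 2 : ℝ) • !![1 + qj, -1 + qj; -1 + qj, 1 + qj]}

noncomputable def P3 : Subgroup U2 :=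
  genBy {!![qi, 0; 0, 1], !![qj, 0; 0, 1], (1 / √2 : ℝ) • !![1, 1; 1, -1]}

/-- Four reducible subgroups of `P1`. -/
noncomputable def H32 : Subgroup U2 :=
  genBy {!![qi, 0; 0, 1], !![qi, 0; 0, qi], !![qj, 0; 0, qj]}

noncomputable def H20 : Subgroup U2 :=
  genBy {!![qj, 0; 0, qk], (1 / 2 : ℝ) • !![qi - qj, qi - qj; qi - qj, -qi + qj]}

noncomputable def H16a : Subgroup U2 :=
  genBy {!![qj, 0; 0, qk], !![0, qj; qj, 0]}

noncomputable def H16b : Subgroup U2 :=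
  genBy {!![qj, 0; 0, qj], (1 / 2 : ℝ) • !![qi - qk, 1 - qj; 1 + qj, -qi - qk]}

/-! ### Fiducial vectors and line systems -/

noncomputable def vE : Vec 2 := ![1, 0]
noncomputable def vW : Vec 2 := ![ofR (1 + √5), 1 + qi + qj + qk]
noncomputable def vW' : Vec 2 := ![-1 + qi + qj + qk, ofR (1 + √5)]
noncomputable def vA : Vec 2 := ![ofR √2, 1 + qi]
noncomputable def vB : Vec 2 := ![ofR √2, 1 + qj]
noncomputable def vC : Vec 2 := ![ofR √3, 1 + qi + qj]
noncomputable def vD : Vec 2 := ![3, 1 + qi + qj]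

/-- The five quaternionic mutually unbiased bases. -/
noncomputable def mub : Fin 5 → Fin 2 → Vec 2 :=
  ![![![1, 0], ![0, 1]],
    ![(1 / √2 : ℝ) • ![1, 1], (1 / √2 : ℝ) • ![1, -1]],
    ![(1 / √2 : ℝ) • ![1, qi], (1 / √2 : ℝ) • ![1, -qi]],
    ![(1 / √2 : ℝ) • ![1, qj], (1 / √2 : ℝ) • ![1, -qj]],
    ![(1 / √2 : ℝ) • ![1, qk], (1 / √2 : ℝ) • ![1, -qk]]]

noncomputable def mubLines : Set Subsp := {L | ∃ r a, L = lineOf (mub r a)}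

noncomputable def linesW : Set Subsp :=
  {L | ∃ q ∈ Q8, L = lineOf ![ofR (1 + √5), q * (1 + qi + qj + qk)] ∨
    L = lineOf ![q * (1 + qi + qj + qk), ofR (1 + √5)]}

noncomputable def linesW' : Set Subsp :=
  {L | ∃ q ∈ Q8, L = lineOf ![ofR (1 + √5), q * (-1 + qi + qj + qk)] ∨
    L = lineOf ![q * (-1 + qi + qj + qk), ofR (1 + √5)]}

noncomputable def linesA : Set Subsp :=
  {L | ∃ m : Fin 4, (∃ α ∈ ({1 + qi, qi + qj, qi - qj} : Set ℍ[ℝ]),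
      L = lineOf ![ofR √2, qi ^ (m : ℕ) * α]) ∨
    L = lineOf ![ofR (1 + √2), qi ^ (m : ℕ) * qj] ∨
    L = lineOf ![qi ^ (m : ℕ) * qj, ofR (1 + √2)]}

noncomputable def linesB : Set Subsp :=
  {L | ∃ m : Fin 4, (∃ α ∈ ({1 + qj, 1 - qj, qj - qk} : Set ℍ[ℝ]),
      L = lineOf ![ofR √2, qi ^ (m : ℕ) * α]) ∨
    L = lineOf ![ofR (1 + √2), qi ^ (m : ℕ)] ∨
    L = lineOf ![qi ^ (m : ℕ), ofR (1 + √2)]}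

/-- The data of a row: the stabiliser in `G` of the line of `f` has order `h`, and the `G`-orbit
of this line is the set `S`, which consists of `n` lines, has angle set `A` and is a spherical
`(3, 3)`-design. -/
structure Row (G : Subgroup U2) (h : ℕ) (f : Vec 2) (A : Set ℝ) (n : ℕ) (S : Set Subsp) :
    Prop where
  card_stab : Nat.card (lineStab G (lineOf f)) = h
  orbit_eq : orbit G (lineOf f) = S
  card_lines : S.ncard = n
  angles : angleSet S = A
  design : IsLineDesign 3 S

/-- A row for which the stabiliser of the fiducial line is a maximal reducible subgroup. -/
def MaxRow (G : Subgroup U2) (h : ℕ) (f : Vec 2) (A : Set ℝ) (n : ℕ) (S : Set Subsp) : Prop :=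
  Row G h f A n S ∧ IsMaxReducible G (lineStab G (lineOf f))

/-- A row for which the stabiliser of the fiducial line is not a maximal reducible subgroup. -/
def NonMaxRow (G : Subgroup U2) (h : ℕ) (f : Vec 2) (A : Set ℝ) (n : ℕ) (S : Set Subsp) : Prop :=
  Row G h f A n S ∧ ¬ IsMaxReducible G (lineStab G (lineOf f))

end QuatP

open QuatP

/-! The Hopf map, which sends `v` to the trace-free part of `2 v v*`, identifies the lines of `ℍ²`
with the rays from the origin in `ℝ⁵` (`lineOf_eq_iff`, `exists_hopf`). The squared modulus of an
inner product is an affine function of the dot product of the Hopf images (`normSq_ip`), so unitary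
matrices act on `ℝ⁵` by isometries, and only `1` and `-1` act trivially on it
(`Induces.eq_one_or_neg_one`). All generators that occur act as signed permutations of the five
coordinates. The groups `P1`, `P2`, `P3` turn out to be the full preimages (`Covers`) of the signed
permutations of determinant one whose underlying permutation lies in the dihedral group of a
pentagon, in `A₅` and in `S₅`. The orders are therefore twice 16 times 10, 60 and 120.

A subgroup is reducible exactly when it fixes a line, hence when its image fixes a nonzero `x` in
`ℝ⁵`. The decisive reduction is `exists_signs`: keeping only the signs of the entries of `x` of
largest absolute value gives a vector with entries in `{-1, 0, 1}` that is fixed by everything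
fixing `x`. So every reducible subgroup lies in the stabiliser of one of 242 vectors, and the
classification is finite. If the stabiliser of `t` fixes only the multiples of `t` (`Pins`), it is
maximal reducible and its fixed lines are the rays of `t` and `-t`. If it also fixes another sign
vector `u` (`Dominates`), it lies in the stabiliser of `u`. `IsRepresentative` packages the
verification that each stabiliser is dominated by a pinned one and that the pinned representatives
are inequivalent up to sign.

The orbits are described by the number of nonzero entries, the product of the entries and adjacency
in the pentagon. By transitivity, angles and the design identity need only the dot products of one
vector with its orbit (`angleSet_rays`, `isLineDesign_rays`).

For the root lines, a reflection with scalar `ξ` and unit axis `x` acts on `ℝ⁵` with symmetric part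
`c + (1 - c) x xᵀ`, where `c` is the real part of `ξ` (`reflection_quadratic`). A signed permutation
matrix has integral entries, which forces `x` to be proportional to a sign vector with one or two
nonzero entries (`exists_axis`). Conversely, one reflection of each kind and transitivity of `P3`
give all these lines. -/

namespace QuatP

/-! ### The Hopf map -/

/-- The Hopf map `ℍ² → ℝ⁵`: a vector `v` is mapped to the coordinates of the trace-free part of
`2 v v*`. -/
noncomputable def hopf (v : Vec 2) : Fin 5 → ℝ :=
  ![normSq (v 0) - normSq (v 1), 2 * (v 0 * star (v 1)).re, 2 * (v 0 * star (v 1)).imI,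
    2 * (v 0 * star (v 1)).imJ, 2 * (v 0 * star (v 1)).imK]

theorem sqNorm_two (v : Vec 2) : sqNorm v = normSq (v 0) + normSq (v 1) := by
  simp [sqNorm, Fin.sum_univ_two]

theorem sqNorm_pos {v : Vec 2} (hv : v ≠ 0) : 0 < sqNorm v := by
  rw [sqNorm_two]
  by_contra h
  have h0 := normSq_nonneg (a := v 0)
  have h1 := normSq_nonneg (a := v 1)
  refine hv (funext fun i => ?_)
  have h2 : normSq (v 0) = 0 := by linarith
  have h3 : normSq (v 1) = 0 := by linarith
  fin_cases i
  · exact normSq_eq_zero.1 h2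
  · exact normSq_eq_zero.1 h3

/-- The matrix `v v*` has eigenvalues `|v|²` and `0`, so the trace-free part of `2 v v*` has
eigenvalues `|v|²` and `-|v|²`. In particular unit vectors go to the unit sphere of `ℝ⁵`. -/
theorem sum_hopf_sq (v : Vec 2) : ∑ i, hopf v i ^ 2 = sqNorm v ^ 2 := by
  simp [Fin.sum_univ_five, hopf, sqNorm_two, normSq_def']
  ring

/-- The left side is the real trace of `v v* w w*`; splitting both factors into scalar and
trace-free parts leaves only the two diagonal contributions. This translates angles of lines into
dot products in `ℝ⁵`. -/
theorem normSq_ip (v w : Vec 2) :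
    normSq (ip v w) = (sqNorm v * sqNorm w + hopf v ⬝ᵥ hopf w) / 2 := by
  simp [dotProduct, Fin.sum_univ_five, hopf, sqNorm_two, normSq_def', ip, Fin.sum_univ_two]
  ring

theorem hopf_ne_zero {v : Vec 2} (hv : v ≠ 0) : hopf v ≠ 0 := by
  intro h
  have h1 := sum_hopf_sq v
  have h2 := sqNorm_pos hv
  simp [h] at h1
  nlinarith

theorem hopf_smul (v : Vec 2) (c : (ℍ[ℝ])ᵐᵒᵖ) : hopf (c • v) = normSq c.unop • hopf v := by
  funext i
  fin_cases i <;> simp [hopf, normSq_def'] <;> ring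

theorem lineOf_smul (v : Vec 2) {c : (ℍ[ℝ])ᵐᵒᵖ} (hc : c ≠ 0) : lineOf (c • v) = lineOf v :=
  Submodule.span_singleton_smul_eq (IsUnit.mk0 c hc) v

theorem mem_lineOf {v w : Vec 2} : w ∈ lineOf v ↔ ∃ c : (ℍ[ℝ])ᵐᵒᵖ, c • v = w :=
  Submodule.mem_span_singleton

theorem sqNorm_of_hopf {v w : Vec 2} {c : ℝ} (hc : 0 < c) (h : hopf v = c • hopf w) :
    sqNorm v = c * sqNorm w := by
  have h1 := sum_hopf_sq v
  have h2 := sum_hopf_sq w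
  have h3 : sqNorm v ^ 2 = (c * sqNorm w) ^ 2 := by
    rw [← h1, mul_pow, ← h2, Finset.mul_sum]
    refine Finset.sum_congr rfl fun i _ => ?_
    rw [h]; simp [mul_pow]
  have p : ∀ u : Vec 2, 0 ≤ sqNorm u := fun u => by
    rw [sqNorm_two]; exact add_nonneg normSq_nonneg normSq_nonneg
  exact (pow_left_inj₀ (p v) (mul_nonneg hc.le (p w)) two_ne_zero).1 h3

/-- Equality of norms and Hopf images up to `c` means `v v* = c w w*`. Applying both sides to `v`
gives `|v|² v = c w ⟨w, v⟩` with `|v|² = c |w|²`, so `v` is the projection of itself to the line of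
`w`. -/
theorem mem_lineOf_of_hopf {v w : Vec 2} (hw : w ≠ 0) {c : ℝ} (hc : 0 < c)
    (h : hopf v = c • hopf w) : v ∈ lineOf w := by
  have hn := sqNorm_of_hopf hc h
  have hs := (sqNorm_pos hw).ne'
  have key : sqNorm w • v = MulOpposite.op (ip w v) • w := by
    have e := fun i => congrFun h i
    have e0 := e 0
    have e1 := e 1
    have e2 := e 2
    have e3 := e 3
    have e4 := e 4
    rw [sqNorm_two, sqNorm_two] at hn
    simp only [hopf, Pi.smul_apply, smul_eq_mul, Matrix.cons_val] at e0 e1 e2 e3 e4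
    have hX : v 0 * star (v 1) = c • (w 0 * star (w 1)) := by
      ext <;> simp only [Quaternion.re_smul, Quaternion.imI_smul, Quaternion.imJ_smul,
        Quaternion.imK_smul, smul_eq_mul] <;> linarith
    have hX' : v 1 * star (v 0) = c • (w 1 * star (w 0)) := by
      have := congrArg star hX
      simpa using this
    have hp : normSq (v 0) = c * normSq (w 0) := by linarith
    have hq : normSq (v 1) = c * normSq (w 1) := by linarith
    have hc' : c • (sqNorm w • v) = c • (MulOpposite.op (ip w v) • w) := by
      funext i
      fin_cases i
      · have : c • (w 0 * (star (w 1) * v 1)) = normSq (v 1) • v 0 := by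
          rw [← mul_assoc, ← smul_mul_assoc, ← hX, mul_assoc, star_mul_self]
          rw [← Quaternion.coe_mul_eq_smul, Quaternion.coe_commutes]
        simp [ip, sqNorm_two, add_smul, smul_add, this, hq]
        rw [← mul_assoc, self_mul_star, Quaternion.coe_mul_eq_smul]
        simp [smul_smul]
      · have : c • (w 1 * (star (w 0) * v 0)) = normSq (v 0) • v 1 := by
          rw [← mul_assoc, ← smul_mul_assoc, ← hX', mul_assoc, star_mul_self]
          rw [← Quaternion.coe_mul_eq_smul, Quaternion.coe_commutes]
        simp [ip, sqNorm_two, add_smul, smul_add, this, hp]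
        rw [← mul_assoc, self_mul_star, Quaternion.coe_mul_eq_smul]
        simp [smul_smul]
    exact smul_right_injective _ hc.ne' hc'
  refine mem_lineOf.2 ⟨MulOpposite.op ((sqNorm w)⁻¹ • ip w v), ?_⟩
  rw [MulOpposite.op_smul, smul_assoc, ← key, smul_smul, inv_mul_cancel₀ hs, one_smul]

theorem lineOf_eq_iff {v w : Vec 2} (hv : v ≠ 0) (hw : w ≠ 0) :
    lineOf v = lineOf w ↔ ∃ c : ℝ, 0 < c ∧ hopf v = c • hopf w := by
  constructor
  · intro h
    obtain ⟨c, rfl⟩ := mem_lineOf.1 (h ▸ Submodule.mem_span_singleton_self v : v ∈ lineOf w)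
    refine ⟨normSq c.unop, ?_, hopf_smul w c⟩
    refine lt_of_le_of_ne normSq_nonneg fun h0 => hv ?_
    rw [show c = 0 from MulOpposite.unop_injective (normSq_eq_zero.1 h0.symm), zero_smul]
  · rintro ⟨c, hc, h⟩
    obtain ⟨d, rfl⟩ := mem_lineOf.1 (mem_lineOf_of_hopf hw hc h)
    exact lineOf_smul w (by rintro rfl; exact hv (zero_smul _ _))

/-- With `r = |x|` and `q` the quaternion formed from the last four coordinates, the vector `(r +
x₀, conj q)` has Hopf image `2 (r + x₀) x`, because `|q|² = r² - x₀²`. This fails only when `r + x₀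
= 0`, where `x` is a negative multiple of the first basis vector and `(0, 1)` serves. -/
theorem exists_hopf {x : Fin 5 → ℝ} (hx : x ≠ 0) :
    ∃ v : Vec 2, v ≠ 0 ∧ ∃ c : ℝ, 0 < c ∧ hopf v = c • x := by
  set r := √(∑ i, x i ^ 2) with hr
  have hpos : 0 < ∑ i, x i ^ 2 := by
    obtain ⟨i, hi⟩ := Function.ne_iff.1 hx
    exact Finset.sum_pos' (fun i _ => sq_nonneg _) ⟨i, Finset.mem_univ i, by
      have : x i ≠ 0 := hi
      positivity⟩
  have hr0 : 0 < r := Real.sqrt_pos.2 hpos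
  have hr2 : r ^ 2 = ∑ i, x i ^ 2 := Real.sq_sqrt hpos.le
  rw [Fin.sum_univ_five] at hr2
  by_cases h : r + x 0 = 0
  · have h0 : x 0 = -r := by linarith
    have hz : x 1 ^ 2 + x 2 ^ 2 + x 3 ^ 2 + x 4 ^ 2 = 0 := by rw [h0] at hr2; linarith
    have h1 : x 1 = 0 := by nlinarith [sq_nonneg (x 1), sq_nonneg (x 2), sq_nonneg (x 3), sq_nonneg (x 4)]
    have h2 : x 2 = 0 := by nlinarith [sq_nonneg (x 1), sq_nonneg (x 2), sq_nonneg (x 3), sq_nonneg (x 4)]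
    have h3 : x 3 = 0 := by nlinarith [sq_nonneg (x 1), sq_nonneg (x 2), sq_nonneg (x 3), sq_nonneg (x 4)]
    have h4 : x 4 = 0 := by nlinarith [sq_nonneg (x 1), sq_nonneg (x 2), sq_nonneg (x 3), sq_nonneg (x 4)]
    refine ⟨![0, 1], fun h => by simpa using congrFun h 1, r⁻¹, inv_pos.2 hr0, ?_⟩
    funext i
    fin_cases i <;> simp [hopf, h0, h1, h2, h3, h4, hr0.ne']
  · have hle : -x 0 ≤ r := by
      refine Real.le_sqrt_of_sq_le ?_
      rw [Fin.sum_univ_five]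
      nlinarith [sq_nonneg (x 1), sq_nonneg (x 2), sq_nonneg (x 3), sq_nonneg (x 4)]
    have hp : 0 < r + x 0 := lt_of_le_of_ne (by linarith) (Ne.symm h)
    obtain ⟨y, y1, y2, y3, y4⟩ : ∃ y : ℍ[ℝ], y.re = x 1 ∧ y.imI = -x 2 ∧ y.imJ = -x 3 ∧
        y.imK = -x 4 := ⟨⟨x 1, -x 2, -x 3, -x 4⟩, rfl, rfl, rfl, rfl⟩
    refine ⟨![((r + x 0 : ℝ) : ℍ[ℝ]), y], fun h' => ?_, 2 * (r + x 0),
      by positivity, ?_⟩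
    · have := congrArg QuaternionAlgebra.re (congrFun h' 0)
      exact h (by simpa using this)
    · funext i
      fin_cases i <;> simp [hopf, normSq_def', y1, y2, y3, y4]
      · linear_combination hr2
      all_goals ring

/-- The line whose vectors are mapped by the Hopf map to the nonnegative multiples of `x`. -/
noncomputable def ray (x : Fin 5 → ℝ) : Subsp :=
  -- The value `⊥` at the origin is a mere default and is not a line; the statements about `ray`
  -- exclude this case.
  open Classical in if hx : x ≠ 0 then lineOf (exists_hopf hx).choose else ⊥

theorem lineOf_eq_ray {v : Vec 2} {x : Fin 5 → ℝ} (hx : x ≠ 0) {c : ℝ} (hc : 0 < c)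
    (h : hopf v = c • x) : lineOf v = ray x := by
  have hs := (exists_hopf hx).choose_spec
  obtain ⟨h0, d, hd, hd'⟩ := hs
  rw [ray, dif_pos hx]
  have hv : v ≠ 0 := by
    rintro rfl
    have hz : hopf 0 = 0 := by funext i; fin_cases i <;> simp [hopf]
    rw [hz] at h
    exact (smul_ne_zero hc.ne' hx) h.symm
  refine (lineOf_eq_iff hv h0).2 ⟨c / d, by positivity, ?_⟩
  rw [hd', h, smul_smul, div_mul_cancel₀ _ hd.ne']

theorem lineOf_eq_ray_hopf {v : Vec 2} (hv : v ≠ 0) : lineOf v = ray (hopf v) :=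
  lineOf_eq_ray (hopf_ne_zero hv) one_pos (one_smul _ _).symm

theorem isLine_ray {x : Fin 5 → ℝ} (hx : x ≠ 0) : IsLine (ray x) := by
  obtain ⟨v, hv, c, hc, h⟩ := exists_hopf hx
  exact ⟨v, hv, (lineOf_eq_ray hx hc h).symm⟩

theorem isLine_iff {L : Subsp} : IsLine L ↔ ∃ x, x ≠ 0 ∧ L = ray x := by
  constructor
  · rintro ⟨v, hv, rfl⟩
    exact ⟨_, hopf_ne_zero hv, lineOf_eq_ray_hopf hv⟩
  · rintro ⟨x, hx, rfl⟩
    exact isLine_ray hx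

theorem ray_eq_iff {x y : Fin 5 → ℝ} (hx : x ≠ 0) (hy : y ≠ 0) :
    ray x = ray y ↔ ∃ c : ℝ, 0 < c ∧ x = c • y := by
  obtain ⟨v, hv, c, hc, h⟩ := exists_hopf hx
  obtain ⟨w, hw, d, hd, h'⟩ := exists_hopf hy
  rw [← lineOf_eq_ray hx hc h, ← lineOf_eq_ray hy hd h', lineOf_eq_iff hv hw]
  constructor
  · rintro ⟨e, he, h''⟩
    refine ⟨e * d / c, by positivity, ?_⟩
    rw [h, h'] at h''
    have := congrArg (fun z => c⁻¹ • z) h''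
    simp only [smul_smul, inv_mul_cancel₀ hc.ne', one_smul] at this
    rw [this]; congr 1; field_simp
  · rintro ⟨e, he, rfl⟩
    refine ⟨c * e / d, by positivity, ?_⟩
    rw [h, h', smul_smul, smul_smul, div_mul_cancel₀ _ hd.ne']

/-! ### The action of unitary matrices on vectors and lines -/

theorem act_lineOf (g : U2) (v : Vec 2) : act g (lineOf v) = lineOf ((g : Mat2) *ᵥ v) := by
  rw [act, lineOf, Submodule.map_span, Set.image_singleton]; rfl

theorem mulVec_injective (g : U2) : Function.Injective fun v : Vec 2 => (g : Mat2) *ᵥ v := by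
  intro v w h
  have := congrArg (fun u => star (g : Mat2) *ᵥ u) h
  simpa only [Matrix.mulVec_mulVec, Unitary.coe_star_mul_self, Matrix.one_mulVec] using this

theorem mulVec_ne_zero (g : U2) {v : Vec 2} (hv : v ≠ 0) : (g : Mat2) *ᵥ v ≠ 0 := fun h =>
  hv (mulVec_injective g (by simpa using h))

theorem ip_mulVec (g : U2) (v w : Vec 2) : ip ((g : Mat2) *ᵥ v) ((g : Mat2) *ᵥ w) = ip v w := by
  rw [ip, ip, Matrix.star_mulVec, ← Matrix.dotProduct_mulVec, Matrix.mulVec_mulVec,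
    ← Matrix.star_eq_conjTranspose, Unitary.coe_star_mul_self, Matrix.one_mulVec]

theorem normSq_ip_self (v : Vec 2) : normSq (ip v v) = sqNorm v ^ 2 := by
  rw [normSq_ip, ← sum_hopf_sq, dotProduct]
  have := sum_hopf_sq v
  simp only [pow_two] at this ⊢
  rw [this]; ring

theorem sqNorm_nonneg (v : Vec 2) : 0 ≤ sqNorm v := by
  rw [sqNorm_two]; exact add_nonneg normSq_nonneg normSq_nonneg

theorem sqNorm_mulVec (g : U2) (v : Vec 2) : sqNorm ((g : Mat2) *ᵥ v) = sqNorm v := by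
  have h := normSq_ip_self ((g : Mat2) *ᵥ v)
  rw [ip_mulVec, normSq_ip_self] at h
  exact ((pow_left_inj₀ (sqNorm_nonneg _) (sqNorm_nonneg _) two_ne_zero).1 h).symm

noncomputable instance : MulAction U2 Subsp where
  smul := act
  one_smul := act_one
  mul_smul := act_mul

/-! ### Reducibility -/

theorem lineOf_ne_bot {v : Vec 2} (hv : v ≠ 0) : lineOf v ≠ ⊥ := by
  simpa [lineOf] using hv

theorem lineOf_ne_top (v : Vec 2) : lineOf v ≠ ⊤ := by
  intro h
  have hv : v ≠ 0 := by
    rintro rfl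
    have : (![1, 0] : Vec 2) ∈ lineOf 0 := h ▸ Submodule.mem_top
    obtain ⟨c, hc⟩ := mem_lineOf.1 this
    simpa using congrFun hc 0
  obtain ⟨c, hc⟩ := mem_lineOf.1 (h ▸ Submodule.mem_top : (![1, 0] : Vec 2) ∈ lineOf v)
  obtain ⟨d, hd⟩ := mem_lineOf.1 (h ▸ Submodule.mem_top : (![0, 1] : Vec 2) ∈ lineOf v)
  have e1 := congrFun hc 1
  have e0 := congrFun hc 0
  have f0 := congrFun hd 0
  have f1 := congrFun hd 1
  simp at e0 e1 f0 f1
  rcases e1 with e1 | e1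
  · simp [e1] at f1
  · simp [e1] at e0

/-- A dimension count by hand: if `W` contained `v` and some `w` off its line, eliminating a
coordinate in which `v` is nonzero would produce `u` supported on the other coordinate, and `v`, `u`
span everything. -/
theorem exists_lineOf_eq {W : Subsp} (h0 : W ≠ ⊥) (h1 : W ≠ ⊤) : ∃ v, v ≠ 0 ∧ W = lineOf v := by
  obtain ⟨v, hv, hv0⟩ := W.ne_bot_iff.1 h0
  refine ⟨v, hv0, le_antisymm (fun w hw => ?_) ((Submodule.span_singleton_le_iff_mem _ _).2 hv)⟩
  by_contra hn
  refine h1 ((Submodule.eq_top_iff').2 fun x => ?_)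
  have aux : ∀ i j : Fin 2, i ≠ j → v i ≠ 0 → x ∈ W := by
    intro i j hij hi
    have hall : ∀ k, k = i ∨ k = j  := by
      clear hi; revert i j; decide
    set u : Vec 2 := w - MulOpposite.op ((v i)⁻¹ * w i) • v with hu
    have hui : u i = 0 := by simp [hu, hi]
    have huW : u ∈ W := W.sub_mem hw (W.smul_mem _ hv)
    have huj : u j ≠ 0 := by
      intro h
      refine hn (mem_lineOf.2 ⟨MulOpposite.op ((v i)⁻¹ * w i), ?_⟩)
      refine (sub_eq_zero.1 (funext fun k => ?_)).symm
      rcases hall k with rfl | rfl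
      · exact hui
      · exact h
    set y : Vec 2 := x - MulOpposite.op ((v i)⁻¹ * x i) • v with hy
    have hyi : y i = 0 := by simp [hy, hi]
    have hyu : y = MulOpposite.op ((u j)⁻¹ * y j) • u := by
      funext k
      rcases hall k with rfl | rfl
      · simp [hyi, hui]
      · simp [huj]
    have : y ∈ W := hyu ▸ W.smul_mem _ huW
    have h2 := W.add_mem this (W.smul_mem (MulOpposite.op ((v i)⁻¹ * x i)) hv)
    simpa [hy] using h2
  by_cases hi : v 0 = 0
  · by_cases hj : v 1 = 0
    · exact absurd (funext fun k => by fin_cases k <;> assumption) hv0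
    · exact aux 1 0 (by decide) hj
  · exact aux 0 1 (by decide) hi

theorem act_eq_of_le {g : U2} {L : Subsp} (hL : IsLine L) (h : act g L ≤ L) : act g L = L := by
  obtain ⟨v, hv, rfl⟩ := hL
  rw [act_lineOf] at h ⊢
  obtain ⟨c, hc⟩ := mem_lineOf.1 (h (Submodule.mem_span_singleton_self _))
  rw [← hc]
  refine lineOf_smul v ?_
  rintro rfl
  exact mulVec_ne_zero g hv (by rw [← hc, zero_smul])

/-- In dimension two a nontrivial invariant subspace is a line, and an invertible map that sends a
line into itself maps it onto itself. -/
theorem isReducible_iff {H : Subgroup U2} : IsReducible H ↔ (fixedLines H).Nonempty := by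
  constructor
  · rintro ⟨W, h0, h1, h⟩
    obtain ⟨v, hv, rfl⟩ := exists_lineOf_eq h0 h1
    exact ⟨_, ⟨v, hv, rfl⟩, fun g hg => act_eq_of_le ⟨v, hv, rfl⟩ (h g hg)⟩
  · rintro ⟨L, ⟨v, hv, rfl⟩, h⟩
    exact ⟨_, lineOf_ne_bot hv, lineOf_ne_top v, fun g hg => (h g hg).le⟩

/-! ### Coordinates of the quaternion units -/

@[simp] theorem re_qi : qi.re = 0 := rfl
@[simp] theorem imI_qi : qi.imI = 1 := rfl
@[simp] theorem imJ_qi : qi.imJ = 0 := rfl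
@[simp] theorem imK_qi : qi.imK = 0 := rfl
@[simp] theorem re_qj : qj.re = 0 := rfl
@[simp] theorem imI_qj : qj.imI = 0 := rfl
@[simp] theorem imJ_qj : qj.imJ = 1 := rfl
@[simp] theorem imK_qj : qj.imK = 0 := rfl
@[simp] theorem re_qk : qk.re = 0 := rfl
@[simp] theorem imI_qk : qk.imI = 0 := rfl
@[simp] theorem imJ_qk : qk.imJ = 0 := rfl
@[simp] theorem imK_qk : qk.imK = 1 := rfl

/-! ### Signed permutations of five coordinates -/

/-- A signed permutation `e_j ↦ sgn (perm j) e_(perm j)`. -/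
@[ext]
structure SignedPerm where
  perm : Equiv.Perm (Fin 5)
  sgn : Fin 5 → ℤˣ

namespace SignedPerm

instance : DecidableEq SignedPerm := fun s t =>
  decidable_of_iff ((∀ i, s.perm i = t.perm i) ∧ ∀ i, s.sgn i = t.sgn i)
    ⟨fun h => SignedPerm.ext (Equiv.ext h.1) (funext h.2), by rintro rfl; simp⟩

instance : Mul SignedPerm := ⟨fun s t => ⟨s.perm * t.perm, fun i => s.sgn i * t.sgn (s.perm.symm i)⟩⟩
instance : One SignedPerm := ⟨⟨1, fun _ => 1⟩⟩
instance : Inv SignedPerm := ⟨fun s => ⟨s.perm⁻¹, fun i => s.sgn (s.perm i)⟩⟩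

@[simp] theorem mul_perm (s t : SignedPerm) : (s * t).perm = s.perm * t.perm := rfl
@[simp] theorem mul_sgn (s t : SignedPerm) (i : Fin 5) :
    (s * t).sgn i = s.sgn i * t.sgn (s.perm.symm i) := rfl
@[simp] theorem one_perm : (1 : SignedPerm).perm = 1 := rfl
@[simp] theorem one_sgn (i : Fin 5) : (1 : SignedPerm).sgn i = 1 := rfl
@[simp] theorem inv_perm (s : SignedPerm) : s⁻¹.perm = s.perm⁻¹ := rfl
@[simp] theorem inv_sgn (s : SignedPerm) (i : Fin 5) : s⁻¹.sgn i = s.sgn (s.perm i) := rfl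

instance : Group SignedPerm where
  mul_assoc s t u := SignedPerm.ext (mul_assoc _ _ _) (funext fun i => by
    simp only [mul_sgn, mul_perm, mul_assoc]; rfl)
  one_mul s := SignedPerm.ext (one_mul _) (funext fun i => by simp [Equiv.Perm.one_def])
  mul_one s := SignedPerm.ext (mul_one _) (funext fun i => by simp)
  inv_mul_cancel s := SignedPerm.ext (inv_mul_cancel _) (funext fun i => by
    have : s.perm⁻¹.symm i = s.perm i := rfl
    simp [this, Int.units_mul_self])

/-- The action of a signed permutation on vectors. -/
def app {R : Type*} [Neg R] (s : SignedPerm) (x : Fin 5 → R) : Fin 5 → R := fun i =>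
  if s.sgn i = 1 then x (s.perm.symm i) else -x (s.perm.symm i)

theorem one_app {R : Type*} [Neg R] (x : Fin 5 → R) : (1 : SignedPerm).app x = x := rfl

theorem mul_app {R : Type*} [InvolutiveNeg R] (s t : SignedPerm) (x : Fin 5 → R) :
    (s * t).app x = s.app (t.app x) := by
  funext i
  have hp : (s.perm * t.perm).symm i = t.perm.symm (s.perm.symm i) := rfl
  rcases Int.units_eq_one_or (s.sgn i) with h | h <;>
    rcases Int.units_eq_one_or (t.sgn (s.perm.symm i)) with h' | h' <;>
    simp [app, h, h', hp]

theorem inv_app_app {R : Type*} [InvolutiveNeg R] (s : SignedPerm) (x : Fin 5 → R) :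
    s⁻¹.app (s.app x) = x := by
  rw [← mul_app, inv_mul_cancel, one_app]

theorem app_inv_app {R : Type*} [InvolutiveNeg R] (s : SignedPerm) (x : Fin 5 → R) :
    s.app (s⁻¹.app x) = x := by
  rw [← mul_app, mul_inv_cancel, one_app]

theorem app_injective {R : Type*} [InvolutiveNeg R] (s : SignedPerm) :
    Function.Injective (s.app : (Fin 5 → R) → Fin 5 → R) :=
  Function.LeftInverse.injective s.inv_app_app

theorem app_neg {R : Type*} [InvolutiveNeg R] (s : SignedPerm) (x : Fin 5 → R) :
    s.app (-x) = -s.app x := by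
  funext i
  simp only [app, Pi.neg_apply]
  split_ifs <;> rfl

theorem app_real (s : SignedPerm) (x : Fin 5 → ℝ) (i : Fin 5) :
    s.app x i = ((s.sgn i : ℤ) : ℝ) * x (s.perm.symm i) := by
  rcases Int.units_eq_one_or (s.sgn i) with h | h <;> simp [app, h]

theorem app_smul (s : SignedPerm) (c : ℝ) (x : Fin 5 → ℝ) : s.app (c • x) = c • s.app x := by
  funext i
  simp only [app_real, Pi.smul_apply, smul_eq_mul]; ring

theorem dotProduct_app (s : SignedPerm) (x y : Fin 5 → ℝ) : s.app x ⬝ᵥ s.app y = x ⬝ᵥ y := by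
  simp only [dotProduct, app_real]
  rw [← Equiv.sum_comp s.perm]
  refine Finset.sum_congr rfl fun i _ => ?_
  rw [Equiv.symm_apply_apply]
  rcases Int.units_eq_one_or (s.sgn (s.perm i)) with h | h <;> simp [h]

theorem app_ne_zero (s : SignedPerm) {x : Fin 5 → ℝ} (hx : x ≠ 0) : s.app x ≠ 0 := fun h =>
  hx (s.app_injective (h.trans (by funext i; simp [app_real])))

/-- Basis vectors suffice as tests. The hypothesis is limited to nonzero vectors because these are
the ones known to have multiples in the image of the Hopf map. -/
theorem ext_of_app {s t : SignedPerm} (h : ∀ x : Fin 5 → ℝ, x ≠ 0 → s.app x = t.app x) : s = t := by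
  have hp : ∀ i, t.perm.symm i = s.perm.symm i ∧ s.sgn i = t.sgn i := by
    intro i
    have := congrFun (h (Pi.single (s.perm.symm i) 1) (by simp)) i
    rw [app_real, app_real] at this
    by_cases hi : t.perm.symm i = s.perm.symm i
    · refine ⟨hi, ?_⟩
      rw [hi] at this
      simp at this
      exact Units.ext (by exact_mod_cast this)
    · simp [hi] at this
  refine SignedPerm.ext ?_ (funext fun i => (hp i).2)
  have : t.perm.symm = s.perm.symm := Equiv.ext fun i => (hp i).1
  simpa using (congrArg Equiv.symm this).symm

end SignedPerm

/-- Vectors with entries in `{-1, 0, 1}`, as real vectors. -/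
def toReal (t : Fin 5 → SignType) : Fin 5 → ℝ := fun i => (t i : ℝ)

/-- The action uses nothing but negation, so it makes sense on sign vectors too. This compatibility
lets decidable computations over `SignType` stand for statements about real vectors. -/
theorem app_toReal (s : SignedPerm) (t : Fin 5 → SignType) : s.app (toReal t) = toReal (s.app t) := by
  funext i
  simp only [SignedPerm.app, toReal]
  split_ifs <;> simp

theorem toReal_neg (t : Fin 5 → SignType) : toReal (-t) = -toReal t := by
  funext i; simp [toReal]

theorem toReal_ne_zero {t : Fin 5 → SignType} (ht : t ≠ 0) : toReal t ≠ 0 := by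
  intro h
  refine ht (funext fun i => ?_)
  have := congrFun h i
  simp only [toReal, Pi.zero_apply] at this
  cases hi : t i <;> simp_all

theorem sign_toReal (t : Fin 5 → SignType) (i : Fin 5) : SignType.sign (toReal t i) = t i := by
  simp only [toReal]; cases t i <;> simp

/-! ### Unitary matrices that act as signed permutations -/

/-- The matrix `g` induces the signed permutation `s` under the Hopf map. -/
def Induces (g : Mat2) (s : SignedPerm) : Prop := ∀ v : Vec 2, hopf (g *ᵥ v) = s.app (hopf v)

theorem Induces.mul {g h : Mat2} {s t : SignedPerm} (hg : Induces g s) (hh : Induces h t) :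
    Induces (g * h) (s * t) := fun v => by
  rw [← Matrix.mulVec_mulVec, hg, hh, SignedPerm.mul_app]

theorem induces_one : Induces 1 1 := fun v => by rw [Matrix.one_mulVec, SignedPerm.one_app]

theorem Induces.inv {g : U2} {s : SignedPerm} (hg : Induces g s) :
    Induces ((g⁻¹ : U2) : Mat2) s⁻¹ := fun v => by
  have h := hg (((g⁻¹ : U2) : Mat2) *ᵥ v)
  rw [Matrix.mulVec_mulVec, ← Submonoid.coe_mul, mul_inv_cancel, OneMemClass.coe_one,
    Matrix.one_mulVec] at h
  rw [h, SignedPerm.inv_app_app]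

theorem Induces.unique {g : Mat2} {s t : SignedPerm} (h : Induces g s) (h' : Induces g t) :
    s = t := by
  refine SignedPerm.ext_of_app fun x hx => ?_
  obtain ⟨v, -, c, hc, hv⟩ := exists_hopf hx
  have := (h v).symm.trans (h' v)
  rw [hv, SignedPerm.app_smul, SignedPerm.app_smul] at this
  exact smul_right_injective _ hc.ne' this

theorem Induces.act_ray {g : U2} {s : SignedPerm} (h : Induces g s) {x : Fin 5 → ℝ} (hx : x ≠ 0) :
    act g (ray x) = ray (s.app x) := by
  obtain ⟨v, -, c, hc, hv⟩ := exists_hopf hx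
  rw [← lineOf_eq_ray hx hc hv, act_lineOf]
  exact lineOf_eq_ray (s.app_ne_zero hx) hc (by rw [h, hv, SignedPerm.app_smul])

/-- A signed permutation preserves length, so the positive factor by which it could stretch a fixed
ray is one. -/
theorem ray_app_eq_iff (s : SignedPerm) {x : Fin 5 → ℝ} (hx : x ≠ 0) :
    ray (s.app x) = ray x ↔ s.app x = x := by
  refine ⟨fun h => ?_, fun h => by rw [h]⟩
  obtain ⟨c, hc, e⟩ := (ray_eq_iff (s.app_ne_zero hx) hx).1 h
  have h1 : x ⬝ᵥ x = c ^ 2 * (x ⬝ᵥ x) := by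
    conv_lhs => rw [← s.dotProduct_app, e]
    simp [pow_two, mul_assoc]
  have h2 : x ⬝ᵥ x ≠ 0 := fun h => hx (dotProduct_self_eq_zero.1 h)
  have h3 : c ^ 2 = 1 := by
    have : (c ^ 2 - 1) * (x ⬝ᵥ x) = 0 := by linarith
    rcases mul_eq_zero.1 this with h | h
    · linarith
    · exact absurd h h2
  have : c = 1 := by nlinarith
  rw [e, this, one_smul]

theorem Induces.act_ray_eq_iff {g : U2} {s : SignedPerm} (h : Induces g s) {x : Fin 5 → ℝ}
    (hx : x ≠ 0) : act g (ray x) = ray x ↔ s.app x = x := by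
  rw [h.act_ray hx, ray_app_eq_iff s hx]

theorem ray_toReal_injective {t u : Fin 5 → SignType} (ht : t ≠ 0) (hu : u ≠ 0)
    (h : ray (toReal t) = ray (toReal u)) : t = u := by
  obtain ⟨c, hc, e⟩ := (ray_eq_iff (toReal_ne_zero ht) (toReal_ne_zero hu)).1 h
  funext i
  rw [← sign_toReal t, ← sign_toReal u, e, Pi.smul_apply, smul_eq_mul, sign_mul, sign_pos hc,
    one_mul]

/-- A unitary matrix that induces the identity is a real scalar. -/
theorem Induces.eq_one_or_neg_one {g : U2} (h : Induces (g : Mat2) 1) : g = 1 ∨ g = -1 := by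
  have e := fun v i => congrFun (h v) i
  simp only [SignedPerm.one_app] at e
  have hn : ∀ v : Vec 2, sqNorm ((g : Mat2) *ᵥ v) = sqNorm v := sqNorm_mulVec g
  set m : Mat2 := (g : Mat2) with hm
  -- The two coordinate lines are fixed, which makes the matrix diagonal.
  have n0 := hn ![1, 0]
  have n1 := hn ![0, 1]
  have a0 := e ![1, 0] 0
  have a1 := e ![0, 1] 0
  simp [hopf, sqNorm_two, Matrix.mulVec, dotProduct, Fin.sum_univ_two] at n0 n1 a0 a1
  have m10 : m 1 0 = 0 := normSq_eq_zero.1 (by linarith)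
  have m01 : m 0 1 = 0 := normSq_eq_zero.1 (by linarith)
  have m00 : normSq (m 0 0) = 1 := by rw [m10] at n0; simpa using n0
  have m11 : normSq (m 1 1) = 1 := by rw [m01] at n1; simpa using n1
  -- Fixing the line of `(1, 1)` makes the two diagonal entries equal; the lines of `(1, i)` and
  -- `(1, j)` then force the common entry to commute with `i` and `j`, hence to be real.
  have b1 := e ![1, 1] 1
  have b2 := e ![1, 1] 2
  have b3 := e ![1, 1] 3
  have b4 := e ![1, 1] 4
  simp [hopf, Matrix.mulVec, dotProduct, Fin.sum_univ_two, m10, m01] at b1 b2 b3 b4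
  have hd : m 0 0 * star (m 1 1) = 1 := by
    ext <;> simp <;> linarith
  have h11 : m 1 1 = m 0 0 := by
    have := congrArg (· * m 1 1) hd
    simp only [mul_assoc, star_mul_self, m11, one_mul] at this
    simpa using this.symm
  have c := e ![1, qi] 2
  have d := e ![1, qj] 3
  simp [hopf, Matrix.mulVec, dotProduct, Fin.sum_univ_two, m10, m01, h11] at c d
  rw [normSq_def'] at m00
  have hJK : (m 0 0).imJ ^ 2 + (m 0 0).imK ^ 2 = 0 := by linarith
  have hIK : (m 0 0).imI ^ 2 + (m 0 0).imK ^ 2 = 0 := by linarith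
  have q1 : (m 0 0).imJ = 0 := pow_eq_zero_iff two_ne_zero |>.1 (by
    linarith [sq_nonneg (m 0 0).imJ, sq_nonneg (m 0 0).imK])
  have q2 : (m 0 0).imK = 0 := pow_eq_zero_iff two_ne_zero |>.1 (by
    linarith [sq_nonneg (m 0 0).imJ, sq_nonneg (m 0 0).imK])
  have q3 : (m 0 0).imI = 0 := pow_eq_zero_iff two_ne_zero |>.1 (by
    linarith [sq_nonneg (m 0 0).imI, sq_nonneg (m 0 0).imK])
  have q4 : (m 0 0).re = 1 ∨ (m 0 0).re = -1 := by
    rw [q1, q2, q3] at m00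
    have : ((m 0 0).re - 1) * ((m 0 0).re + 1) = 0 := by linarith
    rcases mul_eq_zero.1 this with h | h
    · left; linarith
    · right; linarith
  refine q4.imp (fun h => ?_) (fun h => ?_)
  · have h00 : m 0 0 = 1 := by ext <;> simp [h, q1, q2, q3]
    refine Subtype.ext ?_
    change m = 1
    ext1 i j
    fin_cases i <;> fin_cases j <;> simp [m10, m01, h11, h00]
  · have h00 : m 0 0 = -1 := by ext <;> simp [h, q1, q2, q3]
    refine Subtype.ext ?_
    change m = -1
    ext1 i j
    fin_cases i <;> fin_cases j <;> simp [m10, m01, h11, h00]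

/-! ### Groups of signed permutations -/

namespace SignedPerm

/-- The underlying permutation. -/
def permHom : SignedPerm →* Equiv.Perm (Fin 5) where
  toFun := perm
  map_one' := rfl
  map_mul' _ _ := rfl

/-- The determinant of the sign matrix of a signed permutation. -/
def signProd : SignedPerm →* ℤˣ where
  toFun s := ∏ i, s.sgn i
  map_one' := by simp
  map_mul' s t := by
    simp only [mul_sgn, Finset.prod_mul_distrib]
    rw [Equiv.prod_comp s.perm.symm t.sgn]

/-- The signed permutations of determinant one with underlying permutation in `D`. -/
def rotations (D : Subgroup (Equiv.Perm (Fin 5))) : Subgroup SignedPerm :=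
  D.comap permHom ⊓ signProd.eqLocus (Equiv.Perm.sign.comp permHom)

theorem mem_rotations {D : Subgroup (Equiv.Perm (Fin 5))} {s : SignedPerm} :
    s ∈ rotations D ↔ s.perm ∈ D ∧ ∏ i, s.sgn i = Equiv.Perm.sign s.perm := Iff.rfl

theorem rotations_mono {D D' : Subgroup (Equiv.Perm (Fin 5))} (h : D ≤ D') :
    rotations D ≤ rotations D' := fun _ hs => ⟨h hs.1, hs.2⟩

theorem card_sign_vectors (u : ℤˣ) : Nat.card {e : Fin 5 → ℤˣ // ∏ i, e i = u} = 16 := by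
  rw [Nat.card_eq_fintype_card]
  revert u
  decide +kernel

instance : Finite SignedPerm :=
  Finite.of_injective (fun s => (s.perm, s.sgn)) fun _ _ h =>
    SignedPerm.ext (congrArg Prod.fst h) (congrArg Prod.snd h)

theorem card_rotations (D : Subgroup (Equiv.Perm (Fin 5))) :
    Nat.card (rotations D) = Nat.card D * 16 := by
  have e : rotations D ≃ Σ σ : D, {e : Fin 5 → ℤˣ // ∏ i, e i = Equiv.Perm.sign σ.1} :=
    { toFun := fun s => ⟨⟨s.1.perm, s.2.1⟩, ⟨s.1.sgn, s.2.2⟩⟩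
      invFun := fun x => ⟨⟨x.1.1, x.2.1⟩, ⟨x.1.2, x.2.2⟩⟩
      left_inv := fun _ => rfl
      right_inv := fun _ => rfl }
  have : Fintype D := Fintype.ofFinite D
  rw [Nat.card_congr e, Nat.card_sigma]
  rw [Finset.sum_congr rfl fun x _ => card_sign_vectors _]
  simp [Nat.card_eq_fintype_card]

/-- The sign change of all coordinates but the `m`-th. -/
def flip (m : Fin 5) : SignedPerm := ⟨1, fun i => if i = m then 1 else -1⟩

/-- The even sign changes form an elementary abelian group of order 16; four of the five flips are
already a basis. -/
theorem exists_flip (e : Fin 5 → ℤˣ) (he : ∏ i, e i = 1) : ∃ a b c d : Fin 2,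
    (⟨1, e⟩ : SignedPerm) =
      flip 0 ^ (a : ℕ) * flip 1 ^ (b : ℕ) * flip 2 ^ (c : ℕ) * flip 3 ^ (d : ℕ) := by
  revert e
  decide +kernel

/-- Among signed permutations of determinant one, the kernel of the passage to permutations consists
of the even sign changes. A group containing these and reaching all of `D` contains everything over
`D`. -/
theorem rotations_le {D : Subgroup (Equiv.Perm (Fin 5))} {K : Subgroup SignedPerm}
    (h0 : flip 0 ∈ K) (h1 : flip 1 ∈ K) (h2 : flip 2 ∈ K) (h3 : flip 3 ∈ K)
    (hK : K ≤ rotations ⊤) (hD : D ≤ K.map permHom) : rotations D ≤ K := by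
  intro s hs
  obtain ⟨t, ht, hst⟩ := hD hs.1
  have hu : (s * t⁻¹).perm = 1 := by
    change s.perm * t.perm⁻¹ = 1
    rw [show t.perm = s.perm from hst, mul_inv_cancel]
  have hp : ∏ i, (s * t⁻¹).sgn i = 1 := by
    have h : signProd (s * t⁻¹) = Equiv.Perm.sign (s * t⁻¹).perm :=
      (mul_mem (rotations_mono le_top hs) (inv_mem (hK ht))).2
    rw [hu, map_one] at h
    exact h
  obtain ⟨a, b, c, d, h⟩ := exists_flip _ hp
  have : s * t⁻¹ = ⟨1, (s * t⁻¹).sgn⟩ := SignedPerm.ext hu rfl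
  rw [h] at this
  have hm : s * t⁻¹ ∈ K := this ▸ mul_mem (mul_mem (mul_mem (pow_mem h0 _) (pow_mem h1 _))
    (pow_mem h2 _)) (pow_mem h3 _)
  simpa using mul_mem hm ht

/-! ### The signed permutations induced by the generators -/

def spI : SignedPerm :=
  ⟨⟨![0, 2, 1, 4, 3], ![0, 2, 1, 4, 3], by decide, by decide⟩, ![1, -1, 1, -1, 1]⟩
def spJ : SignedPerm :=
  ⟨⟨![0, 3, 4, 1, 2], ![0, 3, 4, 1, 2], by decide, by decide⟩, ![1, -1, 1, 1, -1]⟩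
def spH : SignedPerm :=
  ⟨⟨![3, 1, 4, 0, 2], ![3, 1, 4, 0, 2], by decide, by decide⟩, ![1, 1, 1, -1, -1]⟩
def spR : SignedPerm :=
  ⟨⟨![1, 0, 2, 3, 4], ![1, 0, 2, 3, 4], by decide, by decide⟩, ![1, 1, -1, -1, -1]⟩
def spII : SignedPerm :=
  ⟨⟨![0, 1, 2, 3, 4], ![0, 1, 2, 3, 4], by decide, by decide⟩, ![1, 1, 1, -1, -1]⟩
def spJJ : SignedPerm :=
  ⟨⟨![0, 1, 2, 3, 4], ![0, 1, 2, 3, 4], by decide, by decide⟩, ![1, 1, -1, 1, -1]⟩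
def spJK : SignedPerm :=
  ⟨⟨![0, 2, 1, 4, 3], ![0, 2, 1, 4, 3], by decide, by decide⟩, ![1, -1, -1, 1, 1]⟩
def spF : SignedPerm :=
  ⟨⟨![1, 0, 3, 2, 4], ![1, 0, 3, 2, 4], by decide, by decide⟩, ![1, 1, 1, 1, 1]⟩
def spS : SignedPerm :=
  ⟨⟨![0, 1, 2, 3, 4], ![0, 1, 2, 3, 4], by decide, by decide⟩, ![-1, 1, 1, -1, 1]⟩
def spT : SignedPerm :=
  ⟨⟨![4, 3, 2, 1, 0], ![4, 3, 2, 1, 0], by decide, by decide⟩, ![1, -1, -1, -1, -1]⟩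

/-- The symmetry group of the pentagon with successive vertices `0, 3, 2, 1, 4`. -/
def pentagon : Subgroup (Equiv.Perm (Fin 5)) where
  carrier := {σ | ∀ i j, j = spH.perm (spI.perm i) → (σ j = spH.perm (spI.perm (σ i)) ∨
    σ i = spH.perm (spI.perm (σ j)))}
  one_mem' := fun i j h => Or.inl h
  mul_mem' := by
    intro σ τ hσ hτ i j h
    rcases hτ i j h with h | h
    · exact hσ _ _ h
    · exact (hσ _ _ h).symm
  inv_mem' := by
    change ∀ σ : Equiv.Perm (Fin 5), (∀ i j, j = spH.perm (spI.perm i) →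
      (σ j = spH.perm (spI.perm (σ i)) ∨ σ i = spH.perm (spI.perm (σ j)))) →
      ∀ i j, j = spH.perm (spI.perm i) →
      (σ⁻¹ j = spH.perm (spI.perm (σ⁻¹ i)) ∨ σ⁻¹ i = spH.perm (spI.perm (σ⁻¹ j)))
    decide +kernel

instance : DecidablePred (· ∈ pentagon) := fun σ =>
  inferInstanceAs (Decidable (∀ i j, j = spH.perm (spI.perm i) →
    (σ j = spH.perm (spI.perm (σ i)) ∨ σ i = spH.perm (spI.perm (σ j)))))

theorem card_pentagon : Nat.card pentagon = 10 := by
  rw [Nat.card_eq_fintype_card]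
  decide +kernel

theorem exists_pentagon (σ : Equiv.Perm (Fin 5)) (hσ : σ ∈ pentagon) :
    ∃ (a : Fin 5) (b : Fin 2), σ = (spH.perm * spI.perm) ^ (a : ℕ) * spI.perm ^ (b : ℕ) := by
  revert σ
  decide +kernel

/-- Rotations of the pentagon are five-cycles or trivial, and its reflections are products of two
transpositions. -/
theorem alternating_pentagon (σ : Equiv.Perm (Fin 5)) (hσ : σ ∈ pentagon) :
    σ ∈ alternatingGroup (Fin 5) := by
  rw [Equiv.Perm.mem_alternatingGroup]
  revert σ
  decide +kernel

end SignedPerm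

open SignedPerm

/-! ### The generators as unitary matrices -/

noncomputable def matI : Mat2 := !![qi, 0; 0, 1]
noncomputable def matJ : Mat2 := !![qj, 0; 0, 1]
noncomputable def matH : Mat2 := (1 / 2 : ℝ) • !![1 + qj, -1 + qj; -1 + qj, 1 + qj]
noncomputable def matR : Mat2 := (1 / √2 : ℝ) • !![1, 1; 1, -1]
noncomputable def matII : Mat2 := !![qi, 0; 0, qi]
noncomputable def matJJ : Mat2 := !![qj, 0; 0, qj]
noncomputable def matJK : Mat2 := !![qj, 0; 0, qk]
noncomputable def matF : Mat2 := (1 / 2 : ℝ) • !![qi - qj, qi - qj; qi - qj, -qi + qj]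
noncomputable def matS : Mat2 := !![0, qj; qj, 0]
noncomputable def matT : Mat2 := (1 / 2 : ℝ) • !![qi - qk, 1 - qj; 1 + qj, -qi - qk]

theorem matI_mem : matI ∈ unitary Mat2 := by
  constructor
  all_goals
    ext1 i j
    fin_cases i <;> fin_cases j <;> simp [matI, Matrix.mul_apply, Fin.sum_univ_two] <;>
      ext <;> simp

theorem induces_matI : Induces matI spI := fun v => by
  funext i
  rw [SignedPerm.app_real]
  fin_cases i <;> simp [matI, spI, hopf, Matrix.mulVec, dotProduct, Fin.sum_univ_two,
    normSq_def'] <;> ring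

theorem matJ_mem : matJ ∈ unitary Mat2 := by
  constructor
  all_goals
    ext1 i j
    fin_cases i <;> fin_cases j <;> simp [matJ, Matrix.mul_apply, Fin.sum_univ_two] <;>
      ext <;> simp

theorem induces_matJ : Induces matJ spJ := fun v => by
  funext i
  rw [SignedPerm.app_real]
  fin_cases i <;> simp [matJ, spJ, hopf, Matrix.mulVec, dotProduct, Fin.sum_univ_two,
    normSq_def'] <;> ring

theorem matH_mem : matH ∈ unitary Mat2 := by
  constructor
  all_goals
    ext1 i j
    fin_cases i <;> fin_cases j <;> simp [matH, Matrix.mul_apply, Fin.sum_univ_two] <;>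
      ext <;> simp <;> norm_num

theorem induces_matH : Induces matH spH := fun v => by
  funext i
  rw [SignedPerm.app_real]
  fin_cases i <;> simp [matH, spH, hopf, Matrix.mulVec, dotProduct, Fin.sum_univ_two,
    normSq_def'] <;> ring

theorem hopf_real_smul (r : ℝ) (v : Vec 2) : hopf (r • v) = r ^ 2 • hopf v := by
  funext i
  fin_cases i <;> simp [hopf, normSq_def'] <;> ring

theorem sqrt_two_inv_mul_self : (√2)⁻¹ * (√2)⁻¹ = (1 / 2 : ℝ) := by
  rw [← mul_inv, Real.mul_self_sqrt zero_le_two, one_div]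

theorem matR_mem : matR ∈ unitary Mat2 := by
  constructor
  all_goals
    ext1 i j
    fin_cases i <;> fin_cases j <;> simp [matR, Matrix.mul_apply, Fin.sum_univ_two] <;>
      ext <;> simp <;> linarith [sqrt_two_inv_mul_self]

theorem induces_matR : Induces matR spR := fun v => by
  have h : (1 / √2 : ℝ) ^ 2 = 1 / 2 := by rw [div_pow, Real.sq_sqrt zero_le_two, one_pow]
  funext i
  rw [SignedPerm.app_real, matR, Matrix.smul_mulVec, hopf_real_smul, h]
  fin_cases i <;> simp [spR, hopf, Matrix.mulVec, dotProduct, Fin.sum_univ_two,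
    normSq_def'] <;> ring

theorem matII_mem : matII ∈ unitary Mat2 := by
  constructor
  all_goals
    ext1 i j
    fin_cases i <;> fin_cases j <;> simp [matII, Matrix.mul_apply, Fin.sum_univ_two] <;>
      ext <;> simp

theorem induces_matII : Induces matII spII := fun v => by
  funext i
  rw [SignedPerm.app_real]
  fin_cases i <;> simp [matII, spII, hopf, Matrix.mulVec, dotProduct, Fin.sum_univ_two,
    normSq_def'] <;> ring

theorem matJJ_mem : matJJ ∈ unitary Mat2 := by
  constructor
  all_goals
    ext1 i j
    fin_cases i <;> fin_cases j <;> simp [matJJ, Matrix.mul_apply, Fin.sum_univ_two] <;>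
      ext <;> simp

theorem induces_matJJ : Induces matJJ spJJ := fun v => by
  funext i
  rw [SignedPerm.app_real]
  fin_cases i <;> simp [matJJ, spJJ, hopf, Matrix.mulVec, dotProduct, Fin.sum_univ_two,
    normSq_def'] <;> ring

theorem matJK_mem : matJK ∈ unitary Mat2 := by
  constructor
  all_goals
    ext1 i j
    fin_cases i <;> fin_cases j <;> simp [matJK, Matrix.mul_apply, Fin.sum_univ_two] <;>
      ext <;> simp

theorem induces_matJK : Induces matJK spJK := fun v => by
  funext i
  rw [SignedPerm.app_real]
  fin_cases i <;> simp [matJK, spJK, hopf, Matrix.mulVec, dotProduct, Fin.sum_univ_two,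
    normSq_def'] <;> ring

theorem matF_mem : matF ∈ unitary Mat2 := by
  constructor
  all_goals
    ext1 i j
    fin_cases i <;> fin_cases j <;> simp [matF, Matrix.mul_apply, Fin.sum_univ_two] <;>
      ext <;> simp <;> norm_num

theorem induces_matF : Induces matF spF := fun v => by
  funext i
  rw [SignedPerm.app_real]
  fin_cases i <;> simp [matF, spF, hopf, Matrix.mulVec, dotProduct, Fin.sum_univ_two,
    normSq_def'] <;> ring

theorem matS_mem : matS ∈ unitary Mat2 := by
  constructor
  all_goals
    ext1 i j
    fin_cases i <;> fin_cases j <;> simp [matS, Matrix.mul_apply, Fin.sum_univ_two] <;>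
      ext <;> simp

theorem induces_matS : Induces matS spS := fun v => by
  funext i
  rw [SignedPerm.app_real]
  fin_cases i <;> simp [matS, spS, hopf, Matrix.mulVec, dotProduct, Fin.sum_univ_two,
    normSq_def'] <;> ring

theorem matT_mem : matT ∈ unitary Mat2 := by
  constructor
  all_goals
    ext1 i j
    fin_cases i <;> fin_cases j <;> simp [matT, Matrix.mul_apply, Fin.sum_univ_two] <;>
      ext <;> simp <;> norm_num

theorem induces_matT : Induces matT spT := fun v => by
  funext i
  rw [SignedPerm.app_real]
  fin_cases i <;> simp [matT, spT, hopf, Matrix.mulVec, dotProduct, Fin.sum_univ_two,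
    normSq_def'] <;> ring

/-! ### Groups of unitary matrices and the signed permutations they induce -/

/-- The signed permutations induced by the elements of a group. -/
def image (G : Subgroup U2) : Subgroup SignedPerm where
  carrier := {s | ∃ g ∈ G, Induces (g : Mat2) s}
  one_mem' := ⟨1, G.one_mem, induces_one⟩
  mul_mem' := by
    rintro s t ⟨g, hg, hs⟩ ⟨h, hh, ht⟩
    exact ⟨g * h, G.mul_mem hg hh, hs.mul ht⟩
  inv_mem' := by
    rintro s ⟨g, hg, hs⟩
    exact ⟨g⁻¹, G.inv_mem hg, hs.inv⟩

theorem exists_induces {S : Set Mat2} {E : Subgroup SignedPerm}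
    (h : ∀ M ∈ S, ∃ s ∈ E, Induces M s) {g : U2} (hg : g ∈ genBy S) :
    ∃ s ∈ E, Induces (g : Mat2) s := by
  induction hg using Subgroup.closure_induction with
  | mem g hg => exact h _ hg
  | one => exact ⟨1, E.one_mem, induces_one⟩
  | mul g k _ _ hg hk =>
    obtain ⟨s, hs, hgs⟩ := hg
    obtain ⟨t, ht, hkt⟩ := hk
    exact ⟨s * t, E.mul_mem hs ht, hgs.mul hkt⟩
  | inv g _ hg =>
    obtain ⟨s, hs, hgs⟩ := hg
    exact ⟨s⁻¹, E.inv_mem hs, hgs.inv⟩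

theorem image_genBy_le {S : Set Mat2} {E : Subgroup SignedPerm}
    (h : ∀ M ∈ S, ∃ s ∈ E, Induces M s) : image (genBy S) ≤ E := by
  rintro s ⟨g, hg, hs⟩
  obtain ⟨t, ht, hgt⟩ := exists_induces h hg
  rwa [hs.unique hgt]

/-- `G` is the full preimage of the group `E` of signed permutations. -/
structure Covers (G : Subgroup U2) (E : Subgroup SignedPerm) : Prop where
  induces : ∀ g ∈ G, ∃ s ∈ E, Induces (g : Mat2) s
  lift : ∀ s ∈ E, ∃ g ∈ G, Induces (g : Mat2) s
  neg_one_mem : -1 ∈ G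

namespace Covers

variable {G G' : Subgroup U2} {E E' : Subgroup SignedPerm}

/-- Two unitary matrices inducing the same signed permutation differ by a sign, and `-1` lies in
`G`. This is what makes `G` determined by `E`. -/
theorem mem_iff (h : Covers G E) {g : U2} : g ∈ G ↔ ∃ s ∈ E, Induces (g : Mat2) s := by
  refine ⟨h.induces g, fun ⟨s, hs, hg⟩ => ?_⟩
  obtain ⟨k, hk, hks⟩ := h.lift s hs
  have h1 : Induces ((k⁻¹ * g : U2) : Mat2) 1 := by
    have := hks.inv.mul hg
    rwa [inv_mul_cancel] at this
  have h2 : k⁻¹ * g ∈ G := by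
    rcases h1.eq_one_or_neg_one with h | h'
    · rw [h]; exact G.one_mem
    · rw [h']; exact h.neg_one_mem
  simpa using G.mul_mem hk h2

theorem mono (h : Covers G E) (h' : Covers G' E') (hE : E ≤ E') : G ≤ G' := fun g hg => by
  obtain ⟨s, hs, hgs⟩ := h.induces g hg
  exact h'.mem_iff.2 ⟨s, hE hs, hgs⟩

theorem eq (h : Covers G E) (h' : Covers G' E) : G = G' :=
  le_antisymm (h.mono h' le_rfl) (h'.mono h le_rfl)

theorem of_genBy {S : Set Mat2} (h : ∀ M ∈ S, ∃ s ∈ E, Induces M s) (hE : E ≤ image (genBy S))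
    (h1 : -1 ∈ genBy S) : Covers (genBy S) E where
  induces _ hg := exists_induces h hg
  lift _ hs := hE hs
  neg_one_mem := h1

theorem induces_neg_one : Induces ((-1 : U2) : Mat2) 1 := fun v => by
  have : ((-1 : U2) : Mat2) *ᵥ v = (-1 : ℝ) • v := by
    change (-1 : Mat2) *ᵥ v = _
    rw [Matrix.neg_mulVec, Matrix.one_mulVec, neg_one_smul]
  rw [this, hopf_real_smul, SignedPerm.one_app]
  norm_num

theorem neg_one_ne_one : (-1 : U2) ≠ 1 := fun h => by
  have h1 := congrArg (fun g : U2 => ((g : Mat2) 0 0).re) h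
  have h2 : ((-1 : U2) : Mat2) 0 0 = -1 := by
    change (-1 : Mat2) 0 0 = -1
    simp
  simp only [h2] at h1
  norm_num at h1

/-- Sending a matrix to the signed permutation it induces is a homomorphism with image `E` and
kernel `{1, -1}`. -/
theorem card_eq (h : Covers G E) : Nat.card G = 2 * Nat.card E := by
  choose f hfE hf using fun g : G => h.induces g g.2
  let φ : G →* SignedPerm :=
    { toFun := f
      map_one' := (hf 1).unique induces_one
      map_mul' := fun a b => (hf (a * b)).unique ((hf a).mul (hf b)) }
  have hr : φ.range = E := by
    ext s
    constructor
    · rintro ⟨g, rfl⟩; exact hfE g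
    · intro hs
      obtain ⟨g, hg, hgs⟩ := h.lift s hs
      exact ⟨⟨g, hg⟩, (hf ⟨g, hg⟩).unique hgs⟩
  have hk : (φ.ker : Set G) = {1, ⟨-1, h.neg_one_mem⟩} := by
    ext g
    simp only [SetLike.mem_coe, MonoidHom.mem_ker, Set.mem_insert_iff, Set.mem_singleton_iff]
    constructor
    · intro hg
      have := hf g
      rw [show f g = 1 from hg] at this
      exact this.eq_one_or_neg_one.imp Subtype.ext Subtype.ext
    · rintro (rfl | rfl)
      · exact map_one φ
      · exact (hf _).unique induces_neg_one
  have hc : Nat.card φ.ker = 2 := by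
    rw [← SetLike.coe_sort_coe, hk, Nat.card_coe_set_eq, Set.ncard_pair]
    intro e
    exact neg_one_ne_one (congrArg Subtype.val e).symm
  rw [← Subgroup.card_mul_index φ.ker, Subgroup.index_ker, hr, hc]

theorem finite (h : Covers G E) : Finite G := by
  refine Nat.finite_of_card_ne_zero ?_
  rw [h.card_eq]
  exact mul_ne_zero two_ne_zero Nat.card_pos.ne'

end Covers

theorem mem_image_genBy {S : Set Mat2} {M : Mat2} (hM : M ∈ S) (hu : M ∈ unitary Mat2)
    {s : SignedPerm} (hs : Induces M s) : s ∈ image (genBy S) :=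
  ⟨⟨M, hu⟩, Subgroup.subset_closure hM, hs⟩

theorem mem_genBy {S : Set Mat2} {M : Mat2} (hM : M ∈ S) (hu : M ∈ unitary Mat2) :
    (⟨M, hu⟩ : U2) ∈ genBy S := Subgroup.subset_closure hM

/-! ### The three groups -/

instance {D : Subgroup (Equiv.Perm (Fin 5))} [DecidablePred (· ∈ D)] :
    DecidablePred (· ∈ rotations D) := fun _ => decidable_of_iff _ mem_rotations.symm

theorem matI_sq : matI * matI = !![-1, 0; 0, 1] := by
  ext1 i j
  fin_cases i <;> fin_cases j <;> simp [matI, Matrix.mul_apply, Fin.sum_univ_two]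
  ext <;> simp

theorem matH_sq : matH * matH = !![0, -1; -1, 0] := by
  ext1 i j
  fin_cases i <;> fin_cases j <;> simp [matH, Matrix.mul_apply, Fin.sum_univ_two] <;>
    ext <;> simp <;> norm_num

/-- The product of these two real reflections is a quarter turn, whose square is `-1`. -/
theorem neg_one_eq_of_sq {G : Subgroup U2} {g h : U2} (hg : g ∈ G) (hh : h ∈ G)
    (eg : (g : Mat2) = !![-1, 0; 0, 1]) (eh : (h : Mat2) = !![0, -1; -1, 0]) : -1 ∈ G := by
  have : (-1 : U2) = g * h * (g * h) := by
    refine Subtype.ext ?_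
    change (-1 : Mat2) = (g : Mat2) * h * (g * h)
    rw [eg, eh]
    ext1 i j
    fin_cases i <;> fin_cases j <;> simp [Matrix.mul_apply, Fin.sum_univ_two]
  rw [this]
  exact mul_mem (mul_mem hg hh) (mul_mem hg hh)

/-- The signed permutation over a generator of the rotation group of the pentagon. -/
def cyc : SignedPerm := spH * spI

/-- The square of `spI` is the flip at coordinate `0`, and conjugation by powers of the five-cycle
moves it to every coordinate. -/
theorem flip_mem {K : Subgroup SignedPerm} (hI : spI ∈ K) (hH : spH ∈ K) (m : Fin 5) :
    flip m ∈ K := by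
  have hc : cyc ∈ K := mul_mem hH hI
  obtain ⟨k, hk⟩ : ∃ k : Fin 5, flip m = cyc ^ (k : ℕ) * (spI * spI) * (cyc ^ (k : ℕ))⁻¹ := by
    revert m; decide +kernel
  rw [hk]
  exact mul_mem (mul_mem (pow_mem hc _) (mul_mem hI hI)) (inv_mem (pow_mem hc _))

theorem rotations_pentagon_le {K : Subgroup SignedPerm} (hI : spI ∈ K) (hH : spH ∈ K)
    (hK : K ≤ rotations ⊤) : rotations pentagon ≤ K := by
  refine rotations_le (flip_mem hI hH 0) (flip_mem hI hH 1) (flip_mem hI hH 2)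
    (flip_mem hI hH 3) hK fun σ hσ => ?_
  obtain ⟨a, b, rfl⟩ := exists_pentagon σ hσ
  exact ⟨cyc ^ (a : ℕ) * spI ^ (b : ℕ), mul_mem (pow_mem (mul_mem hH hI) _) (pow_mem hI _),
    by simp [permHom, map_mul, map_pow]; rfl⟩

theorem isPretransitive_of_forall {D : Subgroup (Equiv.Perm (Fin 5))}
    (h : ∀ x y : Fin 5, ∃ σ ∈ D, σ x = y) : MulAction.IsPreprimitive D (Fin 5) := by
  have : MulAction.IsPretransitive D (Fin 5) :=
    ⟨fun x y => by obtain ⟨σ, hσ, e⟩ := h x y; exact ⟨⟨σ, hσ⟩, e⟩⟩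
  exact MulAction.IsPreprimitive.of_prime_card (by rw [Nat.card_fin]; exact Nat.prime_five)

/-- Jordan's theorem: the permutation group is transitive of prime degree, hence primitive, and it
contains the three-cycle under `spH * spJ`. -/
theorem rotations_alternating_le {K : Subgroup SignedPerm} (hI : spI ∈ K) (hJ : spJ ∈ K)
    (hH : spH ∈ K) (hK : K ≤ rotations ⊤) : rotations (alternatingGroup (Fin 5)) ≤ K := by
  refine rotations_le (flip_mem hI hH 0) (flip_mem hI hH 1) (flip_mem hI hH 2)
    (flip_mem hI hH 3) hK ?_
  refine Equiv.Perm.alternatingGroup_le_of_isPreprimitive_of_isThreeCycle_mem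
    (isPretransitive_of_forall fun x y => ?_) (g := (spH * spJ).perm) ?_
    ⟨spH * spJ, mul_mem hH hJ, rfl⟩
  · obtain ⟨k, hk⟩ : ∃ k : Fin 5, (cyc ^ (k : ℕ)).perm x = y := by
      revert x y; decide +kernel
    exact ⟨_, ⟨_, pow_mem (mul_mem hH hI) _, rfl⟩, hk⟩
  · rw [← card_support_eq_three_iff]
    decide +kernel

/-- As for the alternating group, but `spR` lies over a transposition, and a primitive group with a
transposition is the full symmetric group. -/
theorem rotations_top_le {K : Subgroup SignedPerm} (hI : spI ∈ K) (hJ : spJ ∈ K)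
    (hR : spR ∈ K) (hK : K ≤ rotations ⊤) : rotations ⊤ ≤ K := by
  have h0 : flip 0 ∈ K := by
    rw [show flip 0 = spI * spI by decide +kernel]; exact mul_mem hI hI
  have h1 : flip 1 ∈ K := by
    rw [show flip 1 = spR * flip 0 * spR⁻¹ by decide +kernel]
    exact mul_mem (mul_mem hR h0) (inv_mem hR)
  have h2 : flip 2 ∈ K := by
    rw [show flip 2 = spI * flip 1 * spI⁻¹ by decide +kernel]
    exact mul_mem (mul_mem hI h1) (inv_mem hI)
  have h3 : flip 3 ∈ K := by
    rw [show flip 3 = spJ * flip 1 * spJ⁻¹ by decide +kernel]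
    exact mul_mem (mul_mem hJ h1) (inv_mem hJ)
  refine rotations_le h0 h1 h2 h3 hK (le_of_eq (Eq.symm ?_))
  refine Equiv.Perm.subgroup_eq_top_of_isPreprimitive_of_isSwap_mem
    (isPretransitive_of_forall fun x y => ?_) spR.perm ⟨0, 1, by decide, by decide⟩
    ⟨spR, hR, rfl⟩
  have hw : ∀ x : Fin 5, ∃ a b c : Fin 2,
      (spJ ^ (a : ℕ) * spI ^ (b : ℕ) * spR ^ (c : ℕ)).perm 0 = x := by decide +kernel
  have hm : ∀ a b c : ℕ, spJ ^ a * spI ^ b * spR ^ c ∈ K := fun a b c =>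
    mul_mem (mul_mem (pow_mem hJ _) (pow_mem hI _)) (pow_mem hR _)
  obtain ⟨a, b, c, rfl⟩ := hw x
  obtain ⟨a', b', c', rfl⟩ := hw y
  refine ⟨_, ⟨_, mul_mem (hm a' b' c') (inv_mem (hm a b c)), rfl⟩, ?_⟩
  change ((_ * _⁻¹ : Equiv.Perm (Fin 5)) _) = _
  rw [Equiv.Perm.mul_apply]
  exact congrArg _ (Equiv.symm_apply_apply _ _)

instance : DecidablePred (· ∈ (⊤ : Subgroup (Equiv.Perm (Fin 5)))) := fun _ => isTrue trivial

instance : DecidablePred (· ∈ alternatingGroup (Fin 5)) := fun _ =>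
  decidable_of_iff _ Equiv.Perm.mem_alternatingGroup.symm

theorem spI_mem : spI ∈ rotations pentagon := by decide +kernel
theorem spH_mem : spH ∈ rotations pentagon := by decide +kernel
theorem spJ_mem : spJ ∈ rotations (alternatingGroup (Fin 5)) := by decide +kernel
theorem spR_mem : spR ∈ rotations ⊤ := by decide +kernel

theorem pentagon_le_alternating : rotations pentagon ≤ rotations (alternatingGroup (Fin 5)) :=
  rotations_mono alternating_pentagon

theorem covers_P1 : Covers P1 (rotations pentagon) := by
  have hgen : ∀ M ∈ ({matI, matH} : Set Mat2), ∃ s ∈ rotations pentagon, Induces M s := by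
    rintro M (rfl | rfl)
    · exact ⟨_, spI_mem, induces_matI⟩
    · exact ⟨_, spH_mem, induces_matH⟩
  have hI : matI ∈ ({matI, matH} : Set Mat2) := by simp
  have hH : matH ∈ ({matI, matH} : Set Mat2) := by simp
  refine Covers.of_genBy hgen (rotations_pentagon_le (mem_image_genBy hI matI_mem induces_matI)
    (mem_image_genBy hH matH_mem induces_matH)
    ((image_genBy_le hgen).trans (rotations_mono le_top))) ?_
  have uI := mem_genBy hI matI_mem
  have uH := mem_genBy hH matH_mem
  exact neg_one_eq_of_sq (mul_mem uI uI) (mul_mem uH uH) matI_sq matH_sq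

theorem covers_P2 : Covers P2 (rotations (alternatingGroup (Fin 5))) := by
  have hgen : ∀ M ∈ ({matI, matJ, matH} : Set Mat2),
      ∃ s ∈ rotations (alternatingGroup (Fin 5)), Induces M s := by
    rintro M (rfl | rfl | rfl)
    · exact ⟨_, pentagon_le_alternating spI_mem, induces_matI⟩
    · exact ⟨_, spJ_mem, induces_matJ⟩
    · exact ⟨_, pentagon_le_alternating spH_mem, induces_matH⟩
  have hI : matI ∈ ({matI, matJ, matH} : Set Mat2) := by simp
  have hJ : matJ ∈ ({matI, matJ, matH} : Set Mat2) := by simp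
  have hH : matH ∈ ({matI, matJ, matH} : Set Mat2) := by simp
  refine Covers.of_genBy hgen (rotations_alternating_le
    (mem_image_genBy hI matI_mem induces_matI) (mem_image_genBy hJ matJ_mem induces_matJ)
    (mem_image_genBy hH matH_mem induces_matH)
    ((image_genBy_le hgen).trans (rotations_mono le_top))) ?_
  have uI := mem_genBy hI matI_mem
  have uH := mem_genBy hH matH_mem
  exact neg_one_eq_of_sq (mul_mem uI uI) (mul_mem uH uH) matI_sq matH_sq

theorem matR_conj : matR * (matI * matI) * matR = !![0, -1; -1, 0] := by
  rw [matI_sq]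
  ext1 i j
  fin_cases i <;> fin_cases j <;> simp [matR, Matrix.mul_apply, Fin.sum_univ_two] <;>
    ext <;> simp <;> linarith [sqrt_two_inv_mul_self]

theorem covers_P3 : Covers P3 (rotations ⊤) := by
  have hgen : ∀ M ∈ ({matI, matJ, matR} : Set Mat2), ∃ s ∈ rotations ⊤, Induces M s := by
    rintro M (rfl | rfl | rfl)
    · exact ⟨_, rotations_mono le_top spI_mem, induces_matI⟩
    · exact ⟨_, rotations_mono le_top spJ_mem, induces_matJ⟩
    · exact ⟨_, spR_mem, induces_matR⟩
  have hI : matI ∈ ({matI, matJ, matR} : Set Mat2) := by simp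
  have hJ : matJ ∈ ({matI, matJ, matR} : Set Mat2) := by simp
  have hR : matR ∈ ({matI, matJ, matR} : Set Mat2) := by simp
  refine Covers.of_genBy hgen (rotations_top_le
    (mem_image_genBy hI matI_mem induces_matI) (mem_image_genBy hJ matJ_mem induces_matJ)
    (mem_image_genBy hR matR_mem induces_matR)
    ((image_genBy_le hgen).trans (rotations_mono le_top))) ?_
  have uI := mem_genBy hI matI_mem
  have uR := mem_genBy hR matR_mem
  exact neg_one_eq_of_sq (mul_mem uI uI) (mul_mem (mul_mem uR (mul_mem uI uI)) uR) matI_sq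
    matR_conj

theorem card_P1 : Nat.card P1 = 320 := by
  rw [covers_P1.card_eq, card_rotations, card_pentagon]

theorem card_P2 : Nat.card P2 = 1920 := by
  rw [covers_P2.card_eq, card_rotations, nat_card_alternatingGroup, Nat.card_fin]
  rfl

theorem card_P3 : Nat.card P3 = 3840 := by
  rw [covers_P3.card_eq, card_rotations, Subgroup.card_top, Nat.card_perm, Nat.card_fin]
  rfl

/-! ### Orbits of signed permutations on vectors with entries in `{-1, 0, 1}` -/

/-- The number of nonzero entries. -/
def wt (t : Fin 5 → SignType) : ℕ := (Finset.univ.filter fun i => t i ≠ 0).card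

/-- The integral dot product. -/
def idot (t u : Fin 5 → SignType) : ℤ := ∑ i, (t i : ℤ) * (u i : ℤ)

theorem toReal_dotProduct (t u : Fin 5 → SignType) : toReal t ⬝ᵥ toReal u = (idot t u : ℝ) := by
  have h : ∀ a : SignType, ((a : ℤ) : ℝ) = (a : ℝ) := by rintro (_ | _ | _) <;> simp
  simp [toReal, dotProduct, idot, h]

theorem idot_app (s : SignedPerm) (t u : Fin 5 → SignType) :
    idot (s.app t) (s.app u) = idot t u := by
  have := s.dotProduct_app (toReal t) (toReal u)
  rw [app_toReal, app_toReal, toReal_dotProduct, toReal_dotProduct] at this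
  exact_mod_cast this

theorem idot_self (t : Fin 5 → SignType) : idot t t = wt t := by
  simp only [idot, wt, Finset.card_filter, Nat.cast_sum]
  refine Finset.sum_congr rfl fun i _ => ?_
  cases t i <;> rfl

theorem wt_app (s : SignedPerm) (t : Fin 5 → SignType) : wt (s.app t) = wt t := by
  have := idot_app s t t
  rw [idot_self, idot_self] at this
  exact_mod_cast this

theorem ne_zero_of_wt {t : Fin 5 → SignType} (h : wt t ≠ 0) : t ≠ 0 := by
  rintro rfl; exact h rfl

theorem prod_app (s : SignedPerm) (t : Fin 5 → SignType) :
    ∏ i, s.app t i = (if ∏ i, s.sgn i = 1 then 1 else -1) * ∏ i, t i := by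
  have h : ∀ i, s.app t i = (if s.sgn i = 1 then 1 else -1) * t (s.perm.symm i) := by
    intro i; simp only [app]; split_ifs <;> simp
  have h2 : ∀ e : Fin 5 → ℤˣ, (∏ i, if e i = 1 then (1 : SignType) else -1) =
      if ∏ i, e i = 1 then 1 else -1 := by decide +kernel
  simp only [h, Finset.prod_mul_distrib]
  rw [h2, Equiv.prod_comp s.perm.symm t]

/-- `O` is the orbit of `t` under the group `E`. -/
def IsOrbit (E : Subgroup SignedPerm) (t : Fin 5 → SignType) (O : Finset (Fin 5 → SignType)) :
    Prop := ∀ u, u ∈ O ↔ ∃ s ∈ E, s.app t = u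

/-- A general element of the group of rotations over the pentagon. -/
def word (k : Fin 5) (l a b c d : Fin 2) : SignedPerm :=
  flip 0 ^ (a : ℕ) * flip 1 ^ (b : ℕ) * flip 2 ^ (c : ℕ) * flip 3 ^ (d : ℕ) *
    (cyc ^ (k : ℕ) * spI ^ (l : ℕ))

theorem word_mem (k : Fin 5) (l a b c d : Fin 2) : word k l a b c d ∈ rotations pentagon :=
  have h := flip_mem spI_mem spH_mem
  mul_mem (mul_mem (mul_mem (mul_mem (pow_mem (h 0) _) (pow_mem (h 1) _)) (pow_mem (h 2) _))
    (pow_mem (h 3) _)) (mul_mem (pow_mem (mul_mem spH_mem spI_mem) _) (pow_mem spI_mem _))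

/-- A normal form, with 160 words for the 160 elements. It reduces every quantifier over this group
to a finite check. -/
theorem exists_word {s : SignedPerm} (hs : s ∈ rotations pentagon) :
    ∃ k l a b c d, s = word k l a b c d := by
  obtain ⟨k, l, hp⟩ := exists_pentagon s.perm hs.1
  set t := cyc ^ (k : ℕ) * spI ^ (l : ℕ) with ht
  have htm : t ∈ rotations pentagon :=
    mul_mem (pow_mem (mul_mem spH_mem spI_mem) _) (pow_mem spI_mem _)
  have hpt : t.perm = s.perm := by
    rw [hp]
    change permHom t = _
    simp [ht, map_mul, map_pow]; rfl
  have h1 : (s * t⁻¹).perm = 1 := by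
    change s.perm * t.perm⁻¹ = 1
    rw [hpt, mul_inv_cancel]
  have h2 := (mul_mem hs (inv_mem htm)).2
  have h3 : ∏ i, (s * t⁻¹).sgn i = 1 := by
    have h : signProd (s * t⁻¹) = Equiv.Perm.sign (s * t⁻¹).perm := h2
    rw [h1, map_one] at h
    exact h
  obtain ⟨a, b, c, d, h⟩ := exists_flip _ h3
  refine ⟨k, l, a, b, c, d, ?_⟩
  rw [word, ← h, ← ht, ← show s * t⁻¹ = ⟨1, (s * t⁻¹).sgn⟩ from SignedPerm.ext h1 rfl]
  simp

theorem isOrbit_pentagon {t : Fin 5 → SignType} {p : (Fin 5 → SignType) → Prop}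
    [DecidablePred p] (h : ∀ u, p u → ∃ k l a b c d, (word k l a b c d).app t = u)
    (h' : ∀ k l a b c d, p ((word k l a b c d).app t)) :
    IsOrbit (rotations pentagon) t (Finset.univ.filter p) := by
  refine fun u => ⟨fun hu => ?_, ?_⟩
  · obtain ⟨k, l, a, b, c, d, e⟩ := h u (Finset.mem_filter.1 hu).2
    exact ⟨_, word_mem k l a b c d, e⟩
  · rintro ⟨s, hs, rfl⟩
    obtain ⟨k, l, a, b, c, d, rfl⟩ := exists_word hs
    exact Finset.mem_filter.2 ⟨Finset.mem_univ _, h' k l a b c d⟩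

theorem IsOrbit.mono {E E' : Subgroup SignedPerm} {t : Fin 5 → SignType}
    {O : Finset (Fin 5 → SignType)} (h : IsOrbit E t O) (hE : E ≤ E')
    (h' : ∀ s ∈ E', s.app t ∈ O) : IsOrbit E' t O := by
  refine fun u => ⟨fun hu => ?_, ?_⟩
  · obtain ⟨s, hs, e⟩ := (h u).1 hu
    exact ⟨s, hE hs, e⟩
  · rintro ⟨s, hs, rfl⟩; exact h' s hs

/-- Two orbits of a subgroup that are joined by an element of the group form one orbit. -/
theorem IsOrbit.join {E E' : Subgroup SignedPerm} {t t' : Fin 5 → SignType}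
    {O O' O'' : Finset (Fin 5 → SignType)} (h : IsOrbit E t O) (h' : IsOrbit E t' O')
    (hE : E ≤ E') (hr : ∃ r ∈ E', r.app t = t') (hO : ∀ u ∈ O'', u ∈ O ∨ u ∈ O')
    (hc : ∀ s ∈ E', s.app t ∈ O'') : IsOrbit E' t O'' := by
  refine fun u => ⟨fun hu => ?_, ?_⟩
  · rcases hO u hu with hu | hu
    · obtain ⟨s, hs, e⟩ := (h u).1 hu
      exact ⟨s, hE hs, e⟩
    · obtain ⟨s, hs, rfl⟩ := (h' u).1 hu
      obtain ⟨r, hr, rfl⟩ := hr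
      exact ⟨s * r, mul_mem (hE hs) hr, mul_app _ _ _⟩
  · rintro ⟨s, hs, rfl⟩; exact hc s hs

theorem IsOrbit.self_mem {E : Subgroup SignedPerm} {t : Fin 5 → SignType}
    {O : Finset (Fin 5 → SignType)} (h : IsOrbit E t O) : t ∈ O :=
  (h t).2 ⟨1, E.one_mem, one_app t⟩

theorem IsOrbit.app_mem {E : Subgroup SignedPerm} {t : Fin 5 → SignType}
    {O : Finset (Fin 5 → SignType)} (h : IsOrbit E t O) {s : SignedPerm} (hs : s ∈ E)
    {u : Fin 5 → SignType} (hu : u ∈ O) : s.app u ∈ O := by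
  obtain ⟨r, hr, rfl⟩ := (h u).1 hu
  exact (h _).2 ⟨s * r, E.mul_mem hs hr, mul_app _ _ _⟩

theorem IsOrbit.app_mem_iff {E : Subgroup SignedPerm} {t : Fin 5 → SignType}
    {O : Finset (Fin 5 → SignType)} (h : IsOrbit E t O) {s : SignedPerm} (hs : s ∈ E)
    {u : Fin 5 → SignType} : s.app u ∈ O ↔ u ∈ O := by
  refine ⟨fun hu => ?_, h.app_mem hs⟩
  have := h.app_mem (inv_mem hs) hu
  rwa [inv_app_app] at this

theorem IsOrbit.wt_eq {E : Subgroup SignedPerm} {t : Fin 5 → SignType}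
    {O : Finset (Fin 5 → SignType)} (h : IsOrbit E t O) {u : Fin 5 → SignType} (hu : u ∈ O) :
    wt u = wt t := by
  obtain ⟨s, -, rfl⟩ := (h u).1 hu
  exact wt_app s t

/-- The vectors of weight `k`. -/
def ofWt (k : ℕ) : Finset (Fin 5 → SignType) := Finset.univ.filter fun u => wt u = k

/-- The invariants that separate the orbits under the pentagon group: the product of the entries in
weight five, adjacency of the two support points in weight two, adjacency of the two zeros in weight
three. -/
def orbW : Finset (Fin 5 → SignType) := Finset.univ.filter fun u => wt u = 5 ∧ ∏ i, u i = -1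
def orbW' : Finset (Fin 5 → SignType) := Finset.univ.filter fun u => wt u = 5 ∧ ∏ i, u i = 1
def orbA : Finset (Fin 5 → SignType) :=
  Finset.univ.filter fun u => wt u = 2 ∧ ∃ i, u i ≠ 0 ∧ u (cyc.perm i) ≠ 0
def orbB : Finset (Fin 5 → SignType) :=
  Finset.univ.filter fun u => wt u = 2 ∧ ∀ i, u i = 0 ∨ u (cyc.perm i) = 0
def orbC : Finset (Fin 5 → SignType) :=
  Finset.univ.filter fun u => wt u = 3 ∧ ∃ i, u i = 0 ∧ u (cyc.perm i) = 0
def orbC' : Finset (Fin 5 → SignType) :=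
  Finset.univ.filter fun u => wt u = 3 ∧ ∀ i, u i ≠ 0 ∨ u (cyc.perm i) ≠ 0

/-- These are the directions of the Hopf images of the fiducial vectors. Only `tC'` has no fiducial
vector; it represents the second orbit of weight three under the pentagon group. -/
def tE : Fin 5 → SignType := ![1, 0, 0, 0, 0]
def tW : Fin 5 → SignType := ![1, 1, -1, -1, -1]
def tW' : Fin 5 → SignType := ![-1, -1, 1, 1, 1]
def tA : Fin 5 → SignType := ![0, 1, -1, 0, 0]
def tB : Fin 5 → SignType := ![0, 1, 0, -1, 0]
def tC : Fin 5 → SignType := ![0, 1, -1, -1, 0]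
def tC' : Fin 5 → SignType := ![0, 0, 1, 1, 1]
def tD : Fin 5 → SignType := ![1, 1, -1, -1, 0]

theorem mem_ofWt {k : ℕ} {u : Fin 5 → SignType} : u ∈ ofWt k ↔ wt u = k := by simp [ofWt]

theorem mem_orbW {u : Fin 5 → SignType} : u ∈ orbW ↔ wt u = 5 ∧ ∏ i, u i = -1 := by simp [orbW]
theorem mem_orbW' {u : Fin 5 → SignType} : u ∈ orbW' ↔ wt u = 5 ∧ ∏ i, u i = 1 := by simp [orbW']
theorem mem_orbA {u : Fin 5 → SignType} :
    u ∈ orbA ↔ wt u = 2 ∧ ∃ i, u i ≠ 0 ∧ u (cyc.perm i) ≠ 0 := by simp [orbA]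
theorem mem_orbB {u : Fin 5 → SignType} :
    u ∈ orbB ↔ wt u = 2 ∧ ∀ i, u i = 0 ∨ u (cyc.perm i) = 0 := by simp [orbB]
theorem mem_orbC {u : Fin 5 → SignType} :
    u ∈ orbC ↔ wt u = 3 ∧ ∃ i, u i = 0 ∧ u (cyc.perm i) = 0 := by simp [orbC]
theorem mem_orbC' {u : Fin 5 → SignType} :
    u ∈ orbC' ↔ wt u = 3 ∧ ∀ i, u i ≠ 0 ∨ u (cyc.perm i) ≠ 0 := by simp [orbC']

theorem orbit_E_pentagon : IsOrbit (rotations pentagon) tE (ofWt 1) :=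
  isOrbit_pentagon (by decide +kernel) (by decide +kernel)
theorem orbit_W_pentagon : IsOrbit (rotations pentagon) tW orbW :=
  isOrbit_pentagon (by decide +kernel) (by decide +kernel)
theorem orbit_W'_pentagon : IsOrbit (rotations pentagon) tW' orbW' :=
  isOrbit_pentagon (by decide +kernel) (by decide +kernel)
theorem orbit_A_pentagon : IsOrbit (rotations pentagon) tA orbA :=
  isOrbit_pentagon (by decide +kernel) (by decide +kernel)
theorem orbit_B_pentagon : IsOrbit (rotations pentagon) tB orbB :=
  isOrbit_pentagon (by decide +kernel) (by decide +kernel)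
theorem orbit_C_pentagon : IsOrbit (rotations pentagon) tC orbC :=
  isOrbit_pentagon (by decide +kernel) (by decide +kernel)
theorem orbit_C'_pentagon : IsOrbit (rotations pentagon) tC' orbC' :=
  isOrbit_pentagon (by decide +kernel) (by decide +kernel)
-- The sign at the zero entry has no effect on the vector and can be chosen to correct the
-- determinant, so all sign patterns of weight four are already reached here.
theorem orbit_D_pentagon : IsOrbit (rotations pentagon) tD (ofWt 4) :=
  isOrbit_pentagon (by decide +kernel) (by decide +kernel)

theorem app_mem_ofWt (s : SignedPerm) (t : Fin 5 → SignType) : s.app t ∈ ofWt (wt t) :=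
  mem_ofWt.2 (wt_app s t)

/-- Determinant one over an even permutation means an even number of sign changes. This invariant
keeps the two halves of weight five apart in `P2`. -/
theorem prod_app_of_alternating {s : SignedPerm} (hs : s ∈ rotations (alternatingGroup (Fin 5)))
    (t : Fin 5 → SignType) : ∏ i, s.app t i = ∏ i, t i := by
  have h : Equiv.Perm.sign s.perm = 1 := Equiv.Perm.mem_alternatingGroup.1 hs.1
  rw [prod_app, (mem_rotations.1 hs).2, h, if_pos rfl, one_mul]

theorem orbit_E_alternating : IsOrbit (rotations (alternatingGroup (Fin 5))) tE (ofWt 1) :=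
  orbit_E_pentagon.mono pentagon_le_alternating fun s _ => app_mem_ofWt s tE
theorem orbit_W_alternating : IsOrbit (rotations (alternatingGroup (Fin 5))) tW orbW :=
  orbit_W_pentagon.mono pentagon_le_alternating fun s hs => Finset.mem_filter.2
    ⟨Finset.mem_univ _, wt_app s tW, (prod_app_of_alternating hs tW).trans (by decide)⟩
theorem orbit_W'_alternating : IsOrbit (rotations (alternatingGroup (Fin 5))) tW' orbW' :=
  orbit_W'_pentagon.mono pentagon_le_alternating fun s hs => Finset.mem_filter.2
    ⟨Finset.mem_univ _, wt_app s tW', (prod_app_of_alternating hs tW').trans (by decide)⟩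
-- The element `spJ` is no symmetry of the pentagon and fuses adjacent with non-adjacent supports.
theorem orbit_A_alternating : IsOrbit (rotations (alternatingGroup (Fin 5))) tA (ofWt 2) := by
  obtain ⟨k, l, a, b, c, d, m, e⟩ : ∃ k l a b c d, ∃ m : Fin 2,
      (word k l a b c d * spJ ^ (m : ℕ)).app tA = tB := by decide +kernel
  refine orbit_A_pentagon.join orbit_B_pentagon pentagon_le_alternating
    ⟨_, mul_mem (pentagon_le_alternating (word_mem k l a b c d)) (pow_mem spJ_mem _), e⟩
    (fun u hu => ?_) fun s _ => app_mem_ofWt s tA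
  revert u
  simp only [mem_ofWt, mem_orbA, mem_orbB]
  decide +kernel
theorem orbit_C_alternating : IsOrbit (rotations (alternatingGroup (Fin 5))) tC (ofWt 3) := by
  obtain ⟨k, l, a, b, c, d, m, e⟩ : ∃ k l a b c d, ∃ m : Fin 2,
      (word k l a b c d * spJ ^ (m : ℕ)).app tC = tC' := by decide +kernel
  refine orbit_C_pentagon.join orbit_C'_pentagon pentagon_le_alternating
    ⟨_, mul_mem (pentagon_le_alternating (word_mem k l a b c d)) (pow_mem spJ_mem _), e⟩
    (fun u hu => ?_) fun s _ => app_mem_ofWt s tC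
  revert u
  simp only [mem_ofWt, mem_orbC, mem_orbC']
  decide +kernel
theorem orbit_D_alternating : IsOrbit (rotations (alternatingGroup (Fin 5))) tD (ofWt 4) :=
  orbit_D_pentagon.mono pentagon_le_alternating fun s _ => app_mem_ofWt s tD

theorem orbit_E_top : IsOrbit (rotations ⊤) tE (ofWt 1) :=
  orbit_E_alternating.mono (rotations_mono le_top) fun s _ => app_mem_ofWt s tE
-- Over an odd permutation the number of sign changes is odd, so `spR` reverses the product of the
-- entries and exchanges the two halves.
theorem orbit_W_top : IsOrbit (rotations ⊤) tW (ofWt 5) := by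
  obtain ⟨k, l, a, b, c, d, m, e⟩ : ∃ k l a b c d, ∃ m : Fin 2,
      (word k l a b c d * spR ^ (m : ℕ)).app tW = tW' := by decide +kernel
  refine orbit_W_pentagon.join orbit_W'_pentagon (rotations_mono le_top)
    ⟨_, mul_mem (rotations_mono le_top (word_mem k l a b c d)) (pow_mem spR_mem _), e⟩
    (fun u hu => ?_) fun s _ => app_mem_ofWt s tW
  revert u
  simp only [mem_ofWt, mem_orbW, mem_orbW']
  decide +kernel
theorem orbit_A_top : IsOrbit (rotations ⊤) tA (ofWt 2) :=
  orbit_A_alternating.mono (rotations_mono le_top) fun s _ => app_mem_ofWt s tA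
theorem orbit_C_top : IsOrbit (rotations ⊤) tC (ofWt 3) :=
  orbit_C_alternating.mono (rotations_mono le_top) fun s _ => app_mem_ofWt s tC
theorem orbit_D_top : IsOrbit (rotations ⊤) tD (ofWt 4) :=
  orbit_D_alternating.mono (rotations_mono le_top) fun s _ => app_mem_ofWt s tD

/-! ### Orbits of lines -/

/-- The lines that correspond to a set of vectors with entries in `{-1, 0, 1}`. -/
noncomputable def rays (O : Finset (Fin 5 → SignType)) : Set Subsp :=
  (fun u => ray (toReal u)) '' (O : Set (Fin 5 → SignType))

theorem ncard_rays {O : Finset (Fin 5 → SignType)} (hO : ∀ u ∈ O, u ≠ 0) :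
    (rays O).ncard = O.card := by
  rw [rays, Set.InjOn.ncard_image, Set.ncard_coe_finset]
  exact fun u hu v hv h => ray_toReal_injective (hO u hu) (hO v hv) h

theorem rays_union (O O' : Finset (Fin 5 → SignType)) : rays (O ∪ O') = rays O ∪ rays O' := by
  rw [rays, Finset.coe_union, Set.image_union]; rfl

theorem Induces.act_ray_toReal {g : U2} {s : SignedPerm} (h : Induces g s) {t : Fin 5 → SignType}
    (ht : t ≠ 0) : act g (ray (toReal t)) = ray (toReal (s.app t)) := by
  rw [h.act_ray (toReal_ne_zero ht), app_toReal]

theorem Covers.orbit_eq {G : Subgroup U2} {E : Subgroup SignedPerm} (h : Covers G E)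
    {t : Fin 5 → SignType} (ht : t ≠ 0) {O : Finset (Fin 5 → SignType)} (hO : IsOrbit E t O) :
    orbit G (ray (toReal t)) = rays O := by
  ext L
  constructor
  · rintro ⟨g, hg, rfl⟩
    obtain ⟨s, hs, hgs⟩ := h.induces g hg
    exact ⟨s.app t, (hO _).2 ⟨s, hs, rfl⟩, (hgs.act_ray_toReal ht).symm⟩
  · rintro ⟨u, hu, rfl⟩
    obtain ⟨s, hs, rfl⟩ := (hO u).1 hu
    obtain ⟨g, hg, hgs⟩ := h.lift s hs
    exact ⟨g, hg, (hgs.act_ray_toReal ht).symm⟩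

/-- The orbit-stabiliser theorem, transported from the abstract action to the definitions used here.
-/
theorem card_lineStab (G : Subgroup U2) (L : Subsp) :
    Nat.card (lineStab G L) * (orbit G L).ncard = Nat.card G := by
  have h1 : lineStab G L = (MulAction.stabilizer G L).map G.subtype := by
    ext g
    constructor
    · rintro ⟨hg, h⟩; exact ⟨⟨g, hg⟩, h, rfl⟩
    · rintro ⟨g, h, rfl⟩; exact ⟨g.2, h⟩
  have h2 : orbit G L = MulAction.orbit G L := by
    ext M
    constructor
    · rintro ⟨g, hg, rfl⟩; exact ⟨⟨g, hg⟩, rfl⟩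
    · rintro ⟨g, rfl⟩; exact ⟨g, g.2, rfl⟩
  rw [h1, h2, ← MulAction.index_stabilizer, ← (MulAction.stabilizer G L).card_mul_index]
  congr 1
  exact (Nat.card_congr
    ((MulAction.stabilizer G L).equivMapOfInjective _ G.subtype_injective).toEquiv).symm

/-! ### Angles and designs -/

theorem exists_unit {x : Fin 5 → ℝ} (hx : x ≠ 0) :
    ∃ v : Vec 2, sqNorm v = 1 ∧ lineOf v = ray x := by
  obtain ⟨v, hv, c, hc, h⟩ := exists_hopf hx
  have hp := sqNorm_pos hv
  have hn : (1 / √(sqNorm v)) ^ 2 = 1 / sqNorm v := by rw [div_pow, Real.sq_sqrt hp.le, one_pow]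
  refine ⟨(1 / √(sqNorm v)) • v, ?_, lineOf_eq_ray hx (c := c / sqNorm v) (by positivity) ?_⟩
  · have : ∀ r : ℝ, sqNorm (r • v) = r ^ 2 * sqNorm v := fun r => by
      simp [sqNorm_two, normSq_smul]; ring
    rw [this, hn, one_div_mul_cancel hp.ne']
  · rw [hopf_real_smul, hn, h, smul_smul]; congr 1; ring

theorem hopf_of_lineOf_eq_ray {v : Vec 2} (hv : sqNorm v = 1) {x : Fin 5 → ℝ} (hx : x ≠ 0)
    (h : lineOf v = ray x) : ∃ c : ℝ, 0 < c ∧ hopf v = c • x ∧ c ^ 2 * (x ⬝ᵥ x) = 1 := by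
  have hv0 : v ≠ 0 := by
    rintro rfl; simp [sqNorm_two] at hv
  obtain ⟨c, hc, e⟩ := (ray_eq_iff (hopf_ne_zero hv0) hx).1 ((lineOf_eq_ray_hopf hv0).symm.trans h)
  refine ⟨c, hc, e, ?_⟩
  have := sum_hopf_sq v
  rw [hv, e] at this
  simp only [Pi.smul_apply, smul_eq_mul, mul_pow, ← Finset.mul_sum] at this
  simpa [dotProduct, pow_two] using this

/-- The Hopf images of the unit vectors are `t / √m` and `u / √m`, with the same scale because the
weights agree. -/
theorem normSq_ip_of_ray {m : ℕ} (hm : m ≠ 0) {t u : Fin 5 → SignType} (ht : wt t = m)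
    (hu : wt u = m) {v w : Vec 2} (hv : sqNorm v = 1) (hw : sqNorm w = 1)
    (hvt : lineOf v = ray (toReal t)) (hwu : lineOf w = ray (toReal u)) :
    normSq (ip v w) = (m + idot t u : ℝ) / (2 * m) := by
  have ht0 := toReal_ne_zero (ne_zero_of_wt (ht.trans_ne hm))
  have hu0 := toReal_ne_zero (ne_zero_of_wt (hu.trans_ne hm))
  obtain ⟨c, hc, e, hc2⟩ := hopf_of_lineOf_eq_ray hv ht0 hvt
  obtain ⟨d, hd, e', hd2⟩ := hopf_of_lineOf_eq_ray hw hu0 hwu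
  rw [toReal_dotProduct, idot_self, ht] at hc2
  rw [toReal_dotProduct, idot_self, hu] at hd2
  have hm' : (m : ℝ) ≠ 0 := by exact_mod_cast hm
  push_cast at hc2 hd2
  have hcd : c = d := by
    have : c ^ 2 = d ^ 2 := mul_right_cancel₀ hm' (hc2.trans hd2.symm)
    exact (pow_left_inj₀ hc.le hd.le two_ne_zero).1 this
  subst hcd
  rw [normSq_ip, hv, hw, e, e', smul_dotProduct, dotProduct_smul, toReal_dotProduct, smul_eq_mul,
    smul_eq_mul]
  field_simp
  linear_combination (idot t u : ℝ) * hc2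

/-- By transitivity one of the two lines can be moved to the base point `t`. -/
theorem angleSet_rays {E : Subgroup SignedPerm} {t : Fin 5 → SignType}
    {O : Finset (Fin 5 → SignType)} (hO : IsOrbit E t O) {m : ℕ} (hm : m ≠ 0) (ht : wt t = m) :
    angleSet (rays O) = {x | ∃ d ∈ (O.erase t).image (idot t), x = (m + d : ℝ) / (2 * m)} := by
  have hwt : ∀ u ∈ O, wt u = m := fun u hu => (hO.wt_eq hu).trans ht
  have h0 : ∀ u ∈ O, u ≠ 0 := fun u hu => ne_zero_of_wt ((hwt u hu).trans_ne hm)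
  ext x
  constructor
  · rintro ⟨v, w, hv, hw, ⟨u, hu, huv⟩, ⟨r, hr, hrw⟩, hne, rfl⟩
    obtain ⟨s, hs, rfl⟩ := (hO u).1 hu
    obtain ⟨r, rfl⟩ : ∃ r', s.app r' = r := ⟨_, app_inv_app s r⟩
    have hr' := (hO.app_mem_iff hs).1 hr
    refine ⟨idot t r, Finset.mem_image_of_mem _ (Finset.mem_erase.2 ⟨?_, hr'⟩), ?_⟩
    · rintro rfl; exact hne (huv.symm.trans hrw)
    · rw [normSq_ip_of_ray hm (hwt _ hu) (hwt _ hr) hv hw huv.symm hrw.symm, idot_app]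
  · rintro ⟨d, hd, rfl⟩
    obtain ⟨u, hu, rfl⟩ := Finset.mem_image.1 hd
    obtain ⟨hut, hu⟩ := Finset.mem_erase.1 hu
    obtain ⟨v, hv, hvt⟩ := exists_unit (toReal_ne_zero (h0 t hO.self_mem))
    obtain ⟨w, hw, hwu⟩ := exists_unit (toReal_ne_zero (h0 u hu))
    refine ⟨v, w, hv, hw, ⟨t, hO.self_mem, hvt.symm⟩, ⟨u, hu, hwu.symm⟩, fun h => hut ?_, ?_⟩
    · rw [hvt, hwu] at h
      exact (ray_toReal_injective (h0 t hO.self_mem) (h0 u hu) h).symm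
    · rw [normSq_ip_of_ray hm ht (hwt u hu) hv hw hvt hwu]

/-- The inner sum over an orbit does not depend on the base point, so the double sum is the
cardinality times one row. The hypothesis `hd` says over the integers that this row sums to a fifth
of the cardinality: `8 m³` clears the denominators `(2 m)³`. -/
theorem isLineDesign_rays {E : Subgroup SignedPerm} {t : Fin 5 → SignType}
    {O : Finset (Fin 5 → SignType)} (hO : IsOrbit E t O) {m : ℕ} (hm : m ≠ 0) (ht : wt t = m)
    (hd : 5 * ∑ u ∈ O, ((m : ℤ) + idot t u) ^ 3 = 8 * m ^ 3 * O.card) :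
    IsLineDesign 3 (rays O) := by
  have hwt : ∀ u ∈ O, wt u = m := fun u hu => (hO.wt_eq hu).trans ht
  have h0 : ∀ u ∈ O, u ≠ 0 := fun u hu => ne_zero_of_wt ((hwt u hu).trans_ne hm)
  choose v hv hvr using fun u : O => exists_unit (toReal_ne_zero (h0 u u.2))
  set e := O.equivFin.symm
  refine ⟨O.card, fun a => v (e a), fun a => hv _, fun a b hab => ?_, ?_, ?_⟩
  · simp only [hvr] at hab
    exact e.injective (Subtype.ext (ray_toReal_injective (h0 _ (e a).2) (h0 _ (e b).2) hab))
  · ext L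
    simp only [Set.mem_range, hvr, rays, Set.mem_image, Finset.mem_coe]
    constructor
    · rintro ⟨a, rfl⟩; exact ⟨e a, (e a).2, rfl⟩
    · rintro ⟨u, hu, rfl⟩; exact ⟨e.symm ⟨u, hu⟩, by simp⟩
  · have hm' : (m : ℝ) ≠ 0 := by exact_mod_cast hm
    have key : ∀ u ∈ O, ∑ r ∈ O, ((m + idot u r : ℝ) / (2 * m)) ^ 3 = (O.card : ℝ) / 5 := by
      intro u hu
      obtain ⟨s, hs, rfl⟩ := (hO u).1 hu
      have hsum : ∑ r ∈ O, ((m : ℤ) + idot (s.app t) r) ^ 3 = ∑ r ∈ O, ((m : ℤ) + idot t r) ^ 3 := by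
        symm
        refine Finset.sum_bij (fun r _ => s.app r) (fun r hr => hO.app_mem hs hr)
          (fun _ _ _ _ h => s.app_injective h) (fun r hr => ?_) (fun r _ => by rw [idot_app])
        exact ⟨s⁻¹.app r, hO.app_mem (inv_mem hs) hr, app_inv_app s r⟩
      rw [← hsum] at hd
      have hd' : 5 * ∑ r ∈ O, ((m : ℝ) + idot (s.app t) r) ^ 3 = 8 * m ^ 3 * O.card := by
        exact_mod_cast hd
      simp only [div_pow, ← Finset.sum_div]
      rw [div_eq_div_iff (by positivity) (by norm_num)]
      linear_combination hd'
    have hpair : ∀ a b, normSq (ip (v (e a)) (v (e b))) =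
        (m + idot (e a).1 (e b).1 : ℝ) / (2 * m) := fun a b =>
      normSq_ip_of_ray hm (hwt _ (e a).2) (hwt _ (e b).2) (hv _) (hv _) (hvr _) (hvr _)
    have hin : ∀ a, ∑ b, normSq (ip (v (e a)) (v (e b))) ^ 3 = (O.card : ℝ) / 5 := by
      intro a
      simp only [hpair]
      rw [← key _ (e a).2, Equiv.sum_comp e
        (fun r => ((m + idot (e a).1 r.1 : ℝ) / (2 * m)) ^ 3)]
      exact Finset.sum_coe_sort O (fun r => ((m + idot (e a).1 r : ℝ) / (2 * m)) ^ 3)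
    simp only [IsDesign, hin, hv]
    simp [designConst, Finset.prod_range_succ]
    ring

theorem row_of_orbit {G : Subgroup U2} {E : Subgroup SignedPerm} (hG : Covers G E)
    {t : Fin 5 → SignType} {O : Finset (Fin 5 → SignType)} (hO : IsOrbit E t O) {m : ℕ}
    (hm : m ≠ 0) (ht : wt t = m) {f : Vec 2} (hf : lineOf f = ray (toReal t)) {h n : ℕ}
    (hn : O.card = n) (hc : Nat.card G = h * n)
    (hd : 5 * ∑ u ∈ O, ((m : ℤ) + idot t u) ^ 3 = 8 * m ^ 3 * O.card) {D : Finset ℤ}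
    (hD : (O.erase t).image (idot t) = D) {A : Set ℝ}
    (hA : {x : ℝ | ∃ d ∈ D, x = (m + d : ℝ) / (2 * m)} = A) : Row G h f A n (rays O) := by
  have ht0 := ne_zero_of_wt (ht.trans_ne hm)
  have h0 : ∀ u ∈ O, u ≠ 0 := fun u hu => ne_zero_of_wt (((hO.wt_eq hu).trans ht).trans_ne hm)
  have ho : orbit G (lineOf f) = rays O := by rw [hf, hG.orbit_eq ht0 hO]
  have hcard : (rays O).ncard = n := by rw [ncard_rays h0, hn]
  refine ⟨?_, ho, hcard, ?_, isLineDesign_rays hO hm ht hd⟩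
  · have := card_lineStab G (lineOf f)
    rw [ho, hcard, hc] at this
    refine Nat.eq_of_mul_eq_mul_right ?_ this
    rw [← hn]
    exact Finset.card_pos.2 ⟨t, hO.self_mem⟩
  · rw [angleSet_rays hO hm ht, hD, hA]

/-! ### The explicit line systems -/

/-- The Hopf image of `(r, u)` is `(r² - |u|², 2 r conj u)`, so it equals `2 r t` exactly when `conj
u` is the tail of `t` and `r` solves the quadratic equation `h0`. This is the origin of the entries
`1 + √5`, `1 + √2`, `√2`, `√3` and `3`. -/
theorem lineOf_left {r N : ℝ} {u : ℍ[ℝ]} {t : Fin 5 → SignType} (hr : 0 < r)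
    (h0 : r ^ 2 = N + 2 * r * t 0)
    (hN : (t 1 : ℝ) ^ 2 + (t 2 : ℝ) ^ 2 + (t 3 : ℝ) ^ 2 + (t 4 : ℝ) ^ 2 = N)
    (h1 : u.re = t 1) (h2 : u.imI = -t 2) (h3 : u.imJ = -t 3) (h4 : u.imK = -t 4) :
    lineOf ![ofR r, u] = ray (toReal t) := by
  have e : hopf ![ofR r, u] = (2 * r) • toReal t := by
    funext i
    fin_cases i <;> simp [hopf, ofR, normSq_def', toReal, h1, h2, h3, h4]
    · linear_combination h0 - hN
    all_goals ring
  refine lineOf_eq_ray (fun h => ?_) (by positivity) e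
  rw [h, smul_zero] at e
  refine hopf_ne_zero (fun h' => ?_) e
  have := congrArg QuaternionAlgebra.re (congrFun h' 0)
  simp [ofR] at this
  exact hr.ne' this

theorem lineOf_right {r N : ℝ} {u : ℍ[ℝ]} {t : Fin 5 → SignType} (hr : 0 < r)
    (h0 : r ^ 2 = N - 2 * r * t 0)
    (hN : (t 1 : ℝ) ^ 2 + (t 2 : ℝ) ^ 2 + (t 3 : ℝ) ^ 2 + (t 4 : ℝ) ^ 2 = N)
    (h1 : u.re = t 1) (h2 : u.imI = t 2) (h3 : u.imJ = t 3) (h4 : u.imK = t 4) :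
    lineOf ![u, ofR r] = ray (toReal t) := by
  have e : hopf ![u, ofR r] = (2 * r) • toReal t := by
    funext i
    fin_cases i <;> simp [hopf, ofR, normSq_def', toReal, h1, h2, h3, h4]
    · linear_combination -h0 + hN
    all_goals ring
  refine lineOf_eq_ray (fun h => ?_) (by positivity) e
  rw [h, smul_zero] at e
  refine hopf_ne_zero (fun h' => ?_) e
  have := congrArg QuaternionAlgebra.re (congrFun h' 1)
  simp [ofR] at this
  exact hr.ne' this

/-- The elements of the quaternion group. -/
def unitsQ : Fin 8 → ℍ[ℝ] := ![1, -1, qi, -qi, qj, -qj, qk, -qk]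

theorem mem_Q8 {q : ℍ[ℝ]} : q ∈ Q8 ↔ ∃ n, unitsQ n = q := by
  simp [Q8, unitsQ, Fin.exists_fin_succ, eq_comm]

/-- The vectors that correspond to the lines of the mutually unbiased bases. -/
def tabM : Fin 5 → Fin 2 → Fin 5 → SignType :=
  ![![![1, 0, 0, 0, 0], ![-1, 0, 0, 0, 0]], ![![0, 1, 0, 0, 0], ![0, -1, 0, 0, 0]],
    ![![0, 0, -1, 0, 0], ![0, 0, 1, 0, 0]], ![![0, 0, 0, -1, 0], ![0, 0, 0, 1, 0]],
    ![![0, 0, 0, 0, -1], ![0, 0, 0, 0, 1]]]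

theorem hopf_mub (r : Fin 5) (a : Fin 2) : hopf (mub r a) = toReal (tabM r a) := by
  have h2 := sqrt_two_inv_mul_self
  funext i
  fin_cases r <;> fin_cases a <;> fin_cases i <;>
    simp [mub, hopf, normSq_def', toReal, tabM] <;> linarith

theorem lineOf_mub (r : Fin 5) (a : Fin 2) : lineOf (mub r a) = ray (toReal (tabM r a)) := by
  refine lineOf_eq_ray (toReal_ne_zero ?_) one_pos (by rw [hopf_mub, one_smul])
  revert r a; decide +kernel

theorem mubLines_eq : mubLines = rays (ofWt 1) := by
  have h : ∀ u, u ∈ ofWt 1 ↔ ∃ r a, tabM r a = u := by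
    simp only [mem_ofWt]
    decide +kernel
  ext L
  simp only [mubLines, Set.mem_ofPred_eq, rays, Set.mem_image, Finset.mem_coe, h, lineOf_mub]
  constructor
  · rintro ⟨r, a, rfl⟩; exact ⟨_, ⟨r, a, rfl⟩, rfl⟩
  · rintro ⟨_, ⟨r, a, rfl⟩, rfl⟩; exact ⟨r, a, rfl⟩

/-- The vectors that correspond to the lines in `linesW`, in the order of `unitsQ`. -/
def tabW : Bool → Fin 8 → Fin 5 → SignType
  | true => ![![1, 1, -1, -1, -1], ![1, -1, 1, 1, 1], ![1, -1, -1, 1, -1], ![1, 1, 1, -1, 1],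
    ![1, -1, -1, -1, 1], ![1, 1, 1, 1, -1], ![1, -1, 1, -1, -1], ![1, 1, -1, 1, 1]]
  | false => ![![-1, 1, 1, 1, 1], ![-1, -1, -1, -1, -1], ![-1, -1, 1, -1, 1], ![-1, 1, -1, 1, -1],
    ![-1, -1, 1, 1, -1], ![-1, 1, -1, -1, 1], ![-1, -1, -1, 1, 1], ![-1, 1, 1, -1, -1]]

theorem lineOf_leftW (n : Fin 8) : lineOf ![ofR (1 + √5), unitsQ n * (1 + qi + qj + qk)] =
    ray (toReal (tabW true n)) := by
  have h5 : √5 ^ 2 = 5 := Real.sq_sqrt (by norm_num)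
  refine lineOf_left (N := 4) (by positivity) ?_ ?_ ?_ ?_ ?_ ?_ <;>
    fin_cases n <;> simp [unitsQ, tabW] <;> first | norm_num; done | linear_combination h5

theorem lineOf_rightW (n : Fin 8) : lineOf ![unitsQ n * (1 + qi + qj + qk), ofR (1 + √5)] =
    ray (toReal (tabW false n)) := by
  have h5 : √5 ^ 2 = 5 := Real.sq_sqrt (by norm_num)
  refine lineOf_right (N := 4) (by positivity) ?_ ?_ ?_ ?_ ?_ ?_ <;>
    fin_cases n <;> simp [unitsQ, tabW] <;> first | norm_num; done | linear_combination h5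

theorem linesW_eq : linesW = rays orbW := by
  have h : ∀ u, u ∈ orbW ↔ ∃ n, tabW true n = u ∨ tabW false n = u := by
    simp only [mem_orbW]
    decide +kernel
  ext L
  simp only [linesW, mem_Q8, Set.mem_ofPred_eq, rays, Set.mem_image, Finset.mem_coe, h]
  constructor
  · rintro ⟨_, ⟨n, rfl⟩, rfl | rfl⟩
    · exact ⟨_, ⟨n, Or.inl rfl⟩, (lineOf_leftW n).symm⟩
    · exact ⟨_, ⟨n, Or.inr rfl⟩, (lineOf_rightW n).symm⟩
  · rintro ⟨_, ⟨n, rfl | rfl⟩, rfl⟩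
    · exact ⟨_, ⟨n, rfl⟩, Or.inl (lineOf_leftW n).symm⟩
    · exact ⟨_, ⟨n, rfl⟩, Or.inr (lineOf_rightW n).symm⟩

/-- The vectors that correspond to the lines in `linesW'`, in the order of `unitsQ`. -/
def tabW' : Bool → Fin 8 → Fin 5 → SignType
  | true => ![![1, -1, -1, -1, -1], ![1, 1, 1, 1, 1], ![1, -1, 1, 1, -1], ![1, 1, -1, -1, 1],
    ![1, -1, -1, 1, 1], ![1, 1, 1, -1, -1], ![1, -1, 1, -1, 1], ![1, 1, -1, 1, -1]]
  | false => ![![-1, -1, 1, 1, 1], ![-1, 1, -1, -1, -1], ![-1, -1, -1, -1, 1], ![-1, 1, 1, 1, -1],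
    ![-1, -1, 1, -1, -1], ![-1, 1, -1, 1, 1], ![-1, -1, -1, 1, -1], ![-1, 1, 1, -1, 1]]

theorem lineOf_leftW' (n : Fin 8) : lineOf ![ofR (1 + √5), unitsQ n * (-1 + qi + qj + qk)] =
    ray (toReal (tabW' true n)) := by
  have h5 : √5 ^ 2 = 5 := Real.sq_sqrt (by norm_num)
  refine lineOf_left (N := 4) (by positivity) ?_ ?_ ?_ ?_ ?_ ?_ <;>
    fin_cases n <;> simp [unitsQ, tabW'] <;> first | norm_num; done | linear_combination h5

theorem lineOf_rightW' (n : Fin 8) : lineOf ![unitsQ n * (-1 + qi + qj + qk), ofR (1 + √5)] =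
    ray (toReal (tabW' false n)) := by
  have h5 : √5 ^ 2 = 5 := Real.sq_sqrt (by norm_num)
  refine lineOf_right (N := 4) (by positivity) ?_ ?_ ?_ ?_ ?_ ?_ <;>
    fin_cases n <;> simp [unitsQ, tabW'] <;> first | norm_num; done | linear_combination h5

theorem linesW'_eq : linesW' = rays orbW' := by
  have h : ∀ u, u ∈ orbW' ↔ ∃ n, tabW' true n = u ∨ tabW' false n = u := by
    simp only [mem_orbW']
    decide +kernel
  ext L
  simp only [linesW', mem_Q8, Set.mem_ofPred_eq, rays, Set.mem_image, Finset.mem_coe, h]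
  constructor
  · rintro ⟨_, ⟨n, rfl⟩, rfl | rfl⟩
    · exact ⟨_, ⟨n, Or.inl rfl⟩, (lineOf_leftW' n).symm⟩
    · exact ⟨_, ⟨n, Or.inr rfl⟩, (lineOf_rightW' n).symm⟩
  · rintro ⟨_, ⟨n, rfl | rfl⟩, rfl⟩
    · exact ⟨_, ⟨n, rfl⟩, Or.inl (lineOf_leftW' n).symm⟩
    · exact ⟨_, ⟨n, rfl⟩, Or.inr (lineOf_rightW' n).symm⟩

/-- The vectors that correspond to the lines in `linesA`, the last two rows for those with
first or second coordinate `1 + √2`. -/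
def tabA : Fin 5 → Fin 4 → Fin 5 → SignType :=
  ![![![0, 1, -1, 0, 0], ![0, -1, -1, 0, 0], ![0, -1, 1, 0, 0], ![0, 1, 1, 0, 0]],
    ![![0, 0, -1, -1, 0], ![0, -1, 0, 0, -1], ![0, 0, 1, 1, 0], ![0, 1, 0, 0, 1]],
    ![![0, 0, -1, 1, 0], ![0, -1, 0, 0, 1], ![0, 0, 1, -1, 0], ![0, 1, 0, 0, -1]],
    ![![1, 0, 0, -1, 0], ![1, 0, 0, 0, -1], ![1, 0, 0, 1, 0], ![1, 0, 0, 0, 1]],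
    ![![-1, 0, 0, 1, 0], ![-1, 0, 0, 0, 1], ![-1, 0, 0, -1, 0], ![-1, 0, 0, 0, -1]]]

/-- The multipliers `α` in the definition of `linesA`. -/
noncomputable def multA : Fin 3 → ℍ[ℝ] := ![1 + qi, qi + qj, qi - qj]

theorem lineOf_multA (x : Fin 3) (m : Fin 4) : lineOf ![ofR √2, qi ^ (m : ℕ) * multA x] =
    ray (toReal (tabA (Fin.castLE (by decide) x) m)) := by
  have h2 : √2 ^ 2 = 2 := Real.sq_sqrt (by norm_num)
  refine lineOf_left (N := 2) (by positivity) ?_ ?_ ?_ ?_ ?_ ?_ <;>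
    fin_cases x <;> fin_cases m <;> simp [multA, tabA, pow_succ] <;> norm_num

theorem lineOf_leftA (m : Fin 4) : lineOf ![ofR (1 + √2), qi ^ (m : ℕ) * qj] =
    ray (toReal (tabA 3 m)) := by
  have h2 : √2 ^ 2 = 2 := Real.sq_sqrt (by norm_num)
  refine lineOf_left (N := 1) (by positivity) ?_ ?_ ?_ ?_ ?_ ?_ <;>
    fin_cases m <;> simp [tabA, pow_succ] <;> linear_combination h2

theorem lineOf_rightA (m : Fin 4) : lineOf ![qi ^ (m : ℕ) * qj, ofR (1 + √2)] =
    ray (toReal (tabA 4 m)) := by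
  have h2 : √2 ^ 2 = 2 := Real.sq_sqrt (by norm_num)
  refine lineOf_right (N := 1) (by positivity) ?_ ?_ ?_ ?_ ?_ ?_ <;>
    fin_cases m <;> simp [tabA, pow_succ] <;> linear_combination h2

theorem linesA_eq : linesA = rays orbA := by
  have h : ∀ u, u ∈ orbA ↔ ∃ m, (∃ x : Fin 3, tabA (Fin.castLE (by decide) x) m = u) ∨
      tabA 3 m = u ∨ tabA 4 m = u := by
    simp only [mem_orbA]
    decide +kernel
  have hα : ∀ α : ℍ[ℝ], α ∈ ({1 + qi, qi + qj, qi - qj} : Set ℍ[ℝ]) ↔ ∃ x, multA x = α := by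
    intro α
    simp [multA, Fin.exists_fin_succ, eq_comm]
  ext L
  simp only [linesA, hα, Set.mem_ofPred_eq, rays, Set.mem_image, Finset.mem_coe, h]
  constructor
  · rintro ⟨m, ⟨_, ⟨x, rfl⟩, rfl⟩ | rfl | rfl⟩
    · exact ⟨_, ⟨m, Or.inl ⟨x, rfl⟩⟩, (lineOf_multA x m).symm⟩
    · exact ⟨_, ⟨m, Or.inr (Or.inl rfl)⟩, (lineOf_leftA m).symm⟩
    · exact ⟨_, ⟨m, Or.inr (Or.inr rfl)⟩, (lineOf_rightA m).symm⟩
  · rintro ⟨_, ⟨m, ⟨x, rfl⟩ | rfl | rfl⟩, rfl⟩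
    · exact ⟨m, Or.inl ⟨_, ⟨x, rfl⟩, (lineOf_multA x m).symm⟩⟩
    · exact ⟨m, Or.inr (Or.inl (lineOf_leftA m).symm)⟩
    · exact ⟨m, Or.inr (Or.inr (lineOf_rightA m).symm)⟩

/-- The vectors that correspond to the lines in `linesB`, the last two rows for those with
first or second coordinate `1 + √2`. -/
def tabB : Fin 5 → Fin 4 → Fin 5 → SignType :=
  ![![![0, 1, 0, -1, 0], ![0, 0, -1, 0, -1], ![0, -1, 0, 1, 0], ![0, 0, 1, 0, 1]],
    ![![0, 1, 0, 1, 0], ![0, 0, -1, 0, 1], ![0, -1, 0, -1, 0], ![0, 0, 1, 0, -1]],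
    ![![0, 0, 0, -1, 1], ![0, 0, 0, -1, -1], ![0, 0, 0, 1, -1], ![0, 0, 0, 1, 1]],
    ![![1, 1, 0, 0, 0], ![1, 0, -1, 0, 0], ![1, -1, 0, 0, 0], ![1, 0, 1, 0, 0]],
    ![![-1, 1, 0, 0, 0], ![-1, 0, 1, 0, 0], ![-1, -1, 0, 0, 0], ![-1, 0, -1, 0, 0]]]

/-- The multipliers `α` in the definition of `linesB`. -/
noncomputable def multB : Fin 3 → ℍ[ℝ] := ![1 + qj, 1 - qj, qj - qk]

theorem lineOf_multB (x : Fin 3) (m : Fin 4) : lineOf ![ofR √2, qi ^ (m : ℕ) * multB x] =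
    ray (toReal (tabB (Fin.castLE (by decide) x) m)) := by
  have h2 : √2 ^ 2 = 2 := Real.sq_sqrt (by norm_num)
  refine lineOf_left (N := 2) (by positivity) ?_ ?_ ?_ ?_ ?_ ?_ <;>
    fin_cases x <;> fin_cases m <;> simp [multB, tabB, pow_succ] <;> norm_num

theorem lineOf_leftB (m : Fin 4) : lineOf ![ofR (1 + √2), qi ^ (m : ℕ)] =
    ray (toReal (tabB 3 m)) := by
  have h2 : √2 ^ 2 = 2 := Real.sq_sqrt (by norm_num)
  refine lineOf_left (N := 1) (by positivity) ?_ ?_ ?_ ?_ ?_ ?_ <;>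
    fin_cases m <;> simp [tabB, pow_succ] <;> linear_combination h2

theorem lineOf_rightB (m : Fin 4) : lineOf ![qi ^ (m : ℕ), ofR (1 + √2)] =
    ray (toReal (tabB 4 m)) := by
  have h2 : √2 ^ 2 = 2 := Real.sq_sqrt (by norm_num)
  refine lineOf_right (N := 1) (by positivity) ?_ ?_ ?_ ?_ ?_ ?_ <;>
    fin_cases m <;> simp [tabB, pow_succ] <;> linear_combination h2

theorem linesB_eq : linesB = rays orbB := by
  have h : ∀ u, u ∈ orbB ↔ ∃ m, (∃ x : Fin 3, tabB (Fin.castLE (by decide) x) m = u) ∨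
      tabB 3 m = u ∨ tabB 4 m = u := by
    simp only [mem_orbB]
    decide +kernel
  have hα : ∀ α : ℍ[ℝ], α ∈ ({1 + qj, 1 - qj, qj - qk} : Set ℍ[ℝ]) ↔ ∃ x, multB x = α := by
    intro α
    simp [multB, Fin.exists_fin_succ, eq_comm]
  ext L
  simp only [linesB, hα, Set.mem_ofPred_eq, rays, Set.mem_image, Finset.mem_coe, h]
  constructor
  · rintro ⟨m, ⟨_, ⟨x, rfl⟩, rfl⟩ | rfl | rfl⟩
    · exact ⟨_, ⟨m, Or.inl ⟨x, rfl⟩⟩, (lineOf_multB x m).symm⟩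
    · exact ⟨_, ⟨m, Or.inr (Or.inl rfl)⟩, (lineOf_leftB m).symm⟩
    · exact ⟨_, ⟨m, Or.inr (Or.inr rfl)⟩, (lineOf_rightB m).symm⟩
  · rintro ⟨_, ⟨m, ⟨x, rfl⟩ | rfl | rfl⟩, rfl⟩
    · exact ⟨m, Or.inl ⟨_, ⟨x, rfl⟩, (lineOf_multB x m).symm⟩⟩
    · exact ⟨m, Or.inr (Or.inl (lineOf_leftB m).symm)⟩
    · exact ⟨m, Or.inr (Or.inr (lineOf_rightB m).symm)⟩

/-! ### The lines of the fiducial vectors -/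

theorem lineOf_vE : lineOf vE = ray (toReal tE) := by
  refine lineOf_eq_ray (toReal_ne_zero (by decide)) one_pos ?_
  funext i
  fin_cases i <;> simp [vE, hopf, toReal, tE]

theorem lineOf_e2 : lineOf ![0, 1] = ray (toReal (-tE)) := by
  refine lineOf_eq_ray (toReal_ne_zero (by decide)) one_pos ?_
  funext i
  fin_cases i <;> simp [hopf, toReal, tE]

theorem lineOf_vW : lineOf vW = ray (toReal tW) := by
  have h := lineOf_leftW 0
  simp [unitsQ] at h
  exact h

theorem lineOf_vW' : lineOf vW' = ray (toReal tW') := by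
  have h := lineOf_rightW' 0
  simp [unitsQ] at h
  exact h

theorem lineOf_vA : lineOf vA = ray (toReal tA) := by
  have h := lineOf_multA 0 0
  simp [multA] at h
  exact h

theorem lineOf_vA' : lineOf ![-1 + qi, ofR √2] = ray (toReal (-tA)) := by
  have h2 : √2 ^ 2 = 2 := Real.sq_sqrt (by norm_num)
  refine lineOf_right (N := 2) (by positivity) ?_ ?_ ?_ ?_ ?_ ?_ <;> simp [tA]
  norm_num

theorem lineOf_vB : lineOf vB = ray (toReal tB) := by
  have h := lineOf_multB 0 0
  simp [multB] at h
  exact h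

theorem lineOf_vB' : lineOf ![-1 + qj, ofR √2] = ray (toReal (-tB)) := by
  have h2 : √2 ^ 2 = 2 := Real.sq_sqrt (by norm_num)
  refine lineOf_right (N := 2) (by positivity) ?_ ?_ ?_ ?_ ?_ ?_ <;> simp [tB]
  norm_num

theorem lineOf_vC : lineOf vC = ray (toReal tC) := by
  have h3 : √3 ^ 2 = 3 := Real.sq_sqrt (by norm_num)
  refine lineOf_left (N := 3) (by positivity) ?_ ?_ ?_ ?_ ?_ ?_ <;> simp [tC]
  norm_num

theorem lineOf_vD : lineOf vD = ray (toReal tD) := by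
  rw [vD, show (3 : ℍ[ℝ]) = ofR 3 from rfl]
  refine lineOf_left (N := 3) (by positivity) ?_ ?_ ?_ ?_ ?_ ?_ <;> simp [tD] <;> norm_num

/-! ### Maximal reducible subgroups -/

theorem lineStab_le (G : Subgroup U2) (L : Subsp) : lineStab G L ≤ G := fun _ h => h.1

theorem isReducible_lineStab (G : Subgroup U2) {L : Subsp} (hL : IsLine L) :
    IsReducible (lineStab G L) := isReducible_iff.2 ⟨L, hL, fun _ h => h.2⟩

theorem signVec_neg_ne_zero {t : Fin 5 → SignType} (ht : t ≠ 0) : -t ≠ 0 := fun h =>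
  ht (funext fun i => by simpa using congrFun h i)

theorem signVec_app_ne_zero {s : SignedPerm} {t : Fin 5 → SignType} (ht : t ≠ 0) :
    s.app t ≠ 0 := fun h =>
  ht (s.app_injective (h.trans (by funext i; simp [SignedPerm.app])))

theorem lineStab_act {G : Subgroup U2} {g : U2} (hg : g ∈ G) (L : Subsp) :
    lineStab G (act g L) = (lineStab G L).map (MulAut.conj g).toMonoidHom := by
  ext h
  rw [Subgroup.mem_map]
  constructor
  · rintro ⟨hh, e⟩
    refine ⟨g⁻¹ * h * g, ⟨mul_mem (mul_mem (inv_mem hg) hh) hg, ?_⟩, by simp [mul_assoc]⟩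
    rw [mul_assoc, act_mul, act_mul, e, ← act_mul, inv_mul_cancel, act_one]
  · rintro ⟨k, ⟨hk, e⟩, rfl⟩
    refine ⟨mul_mem (mul_mem hg hk) (inv_mem hg), ?_⟩
    change act (g * k * g⁻¹) (act g L) = _
    rw [← act_mul, inv_mul_cancel_right, act_mul, e]

/-- A signed permutation that fixes `x` fixes the signs of the entries of `x` of largest absolute
value. -/
theorem exists_signs {x : Fin 5 → ℝ} (hx : x ≠ 0) :
    ∃ t : Fin 5 → SignType, t ≠ 0 ∧ ∀ s : SignedPerm, s.app x = x → s.app t = t := by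
  obtain ⟨m, -, hm⟩ := Finset.exists_max_image Finset.univ (fun i => |x i|) ⟨0, Finset.mem_univ 0⟩
  refine ⟨fun i => if |x i| = |x m| then SignType.sign (x i) else 0, fun h => hx ?_, fun s hs => ?_⟩
  · have h0 := congrFun h m
    simp only [if_true, Pi.zero_apply, sign_eq_zero_iff] at h0
    funext i
    have := hm i (Finset.mem_univ i)
    rw [h0, abs_zero] at this
    exact abs_nonpos_iff.1 this
  -- An entry and its preimage under `s` have equal absolute values, so the set of positions of
  -- maximal absolute value is invariant; on it `s` respects signs as it does for `x`.
  · funext i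
    have hi := congrFun hs i
    simp only [app] at hi ⊢
    by_cases h : s.sgn i = 1
    · rw [if_pos h] at hi ⊢
      rw [hi]
    · rw [if_neg h] at hi ⊢
      rw [← hi, abs_neg, Left.sign_neg]
      split_ifs <;> simp

section

variable {G : Subgroup U2} {E : Subgroup SignedPerm}

theorem Covers.mem_lineStab_ray (h : Covers G E) {x : Fin 5 → ℝ} (hx : x ≠ 0) {g : U2} :
    g ∈ lineStab G (ray x) ↔ ∃ s ∈ E, Induces (g : Mat2) s ∧ s.app x = x := by
  constructor
  · rintro ⟨hg, e⟩
    obtain ⟨s, hs, hgs⟩ := h.induces g hg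
    exact ⟨s, hs, hgs, (hgs.act_ray_eq_iff hx).1 e⟩
  · rintro ⟨s, hs, hgs, e⟩
    exact ⟨h.mem_iff.2 ⟨s, hs, hgs⟩, (hgs.act_ray_eq_iff hx).2 e⟩

theorem app_toReal_eq_iff (s : SignedPerm) (t : Fin 5 → SignType) :
    s.app (toReal t) = toReal t ↔ s.app t = t := by
  rw [app_toReal]
  refine ⟨fun h => funext fun i => ?_, fun h => by rw [h]⟩
  rw [← sign_toReal (s.app t), h, sign_toReal]

theorem Covers.mem_lineStab_toReal (h : Covers G E) {t : Fin 5 → SignType} (ht : t ≠ 0) {g : U2} :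
    g ∈ lineStab G (ray (toReal t)) ↔ ∃ s ∈ E, Induces (g : Mat2) s ∧ s.app t = t := by
  simp only [h.mem_lineStab_ray (toReal_ne_zero ht), app_toReal_eq_iff]

theorem Covers.exists_le_lineStab (h : Covers G E) {K : Subgroup U2} (hK : K ≤ G)
    (hr : IsReducible K) : ∃ t : Fin 5 → SignType, t ≠ 0 ∧ K ≤ lineStab G (ray (toReal t)) := by
  obtain ⟨L, hL, hfix⟩ := isReducible_iff.1 hr
  obtain ⟨x, hx, rfl⟩ := isLine_iff.1 hL
  obtain ⟨t, ht, hst⟩ := exists_signs hx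
  refine ⟨t, ht, fun g hg => ?_⟩
  obtain ⟨s, hs, hgs, e⟩ := (h.mem_lineStab_ray hx).1 (show g ∈ lineStab G (ray x) from
    ⟨hK hg, hfix g hg⟩)
  exact (h.mem_lineStab_toReal ht).2 ⟨s, hs, hgs, hst s e⟩

/-- The stabiliser of `t` in `E` fixes `u`. -/
def Dominates (E : Subgroup SignedPerm) (t u : Fin 5 → SignType) : Prop :=
  ∀ s ∈ E, s.app t = t → s.app u = u

theorem Dominates.app {t u : Fin 5 → SignType} (h : Dominates E t u) {s : SignedPerm}
    (hs : s ∈ E) : Dominates E (s.app t) (s.app u) := fun r hr e => by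
  have := h (s⁻¹ * r * s) (mul_mem (mul_mem (inv_mem hs) hr) hs)
    (by rw [mul_app, mul_app, e, inv_app_app])
  rw [mul_app, mul_app] at this
  rw [← app_inv_app s (r.app (s.app u)), this]

theorem Covers.lineStab_mono (h : Covers G E) {t u : Fin 5 → SignType} (ht : t ≠ 0) (hu : u ≠ 0)
    (hd : Dominates E t u) : lineStab G (ray (toReal t)) ≤ lineStab G (ray (toReal u)) :=
  fun g hg => by
    obtain ⟨s, hs, hgs, e⟩ := (h.mem_lineStab_toReal ht).1 hg
    exact (h.mem_lineStab_toReal hu).2 ⟨s, hs, hgs, hd s hs e⟩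

/-- The vectors fixed by the stabiliser of `t` in `E` are the multiples of `t`. -/
def Pins (E : Subgroup SignedPerm) (t : Fin 5 → SignType) : Prop :=
  ∀ x : Fin 5 → ℝ, (∀ s ∈ E, s.app t = t → s.app x = x) → ∃ c : ℝ, x = c • toReal t

theorem Pins.mono {E' : Subgroup SignedPerm} {t : Fin 5 → SignType} (h : Pins E t) (hE : E ≤ E') :
    Pins E' t := fun x hx => h x fun s hs => hx s (hE hs)

/-- A one-dimensional fixed space in `ℝ⁵` consists of two rays and the origin, hence of two lines of
`ℍ²`, which are orthogonal to each other. -/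
theorem Covers.fixedLines_eq (h : Covers G E) {t : Fin 5 → SignType} (ht : t ≠ 0)
    (hp : Pins E t) :
    fixedLines (lineStab G (ray (toReal t))) = {ray (toReal t), ray (toReal (-t))} := by
  have ht' : -t ≠ 0 := signVec_neg_ne_zero ht
  ext L
  constructor
  · rintro ⟨hL, hfix⟩
    obtain ⟨x, hx, rfl⟩ := isLine_iff.1 hL
    obtain ⟨c, rfl⟩ := hp x fun s hs e => by
      obtain ⟨g, hg, hgs⟩ := h.lift s hs
      exact (hgs.act_ray_eq_iff hx).1 (hfix g ((h.mem_lineStab_toReal ht).2 ⟨s, hs, hgs, e⟩))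
    rcases lt_trichotomy c 0 with hc | rfl | hc
    · right
      refine (ray_eq_iff hx (toReal_ne_zero ht')).2 ⟨-c, neg_pos.2 hc, ?_⟩
      rw [toReal_neg, smul_neg, neg_smul, neg_neg]
    · exact absurd (zero_smul _ _) hx
    · exact Or.inl ((ray_eq_iff hx (toReal_ne_zero ht)).2 ⟨c, hc, rfl⟩)
  · rintro (rfl | rfl)
    · exact ⟨isLine_ray (toReal_ne_zero ht), fun g hg => hg.2⟩
    · refine ⟨isLine_ray (toReal_ne_zero ht'), fun g hg => ?_⟩
      obtain ⟨s, hs, hgs, e⟩ := (h.mem_lineStab_toReal ht).1 hg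
      rw [hgs.act_ray_toReal ht', app_neg, e]

theorem Covers.lineStab_neg (h : Covers G E) {t : Fin 5 → SignType} (ht : t ≠ 0) :
    lineStab G (ray (toReal (-t))) = lineStab G (ray (toReal t)) := by
  ext g
  simp only [h.mem_lineStab_toReal ht, h.mem_lineStab_toReal (signVec_neg_ne_zero ht), app_neg, neg_inj]

/-- A larger reducible group fixes a line that the stabiliser also fixes, so the line of `t` or of
`-t`; these two have the same stabiliser. -/
theorem Covers.isMaxReducible (h : Covers G E) {t : Fin 5 → SignType} (ht : t ≠ 0)
    (hp : Pins E t) : IsMaxReducible G (lineStab G (ray (toReal t))) := by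
  refine ⟨⟨lineStab_le _ _, isReducible_lineStab _ (isLine_ray (toReal_ne_zero ht))⟩, ?_⟩
  rintro K ⟨hKG, hK⟩ hle g hg
  obtain ⟨L, hL, hfix⟩ := isReducible_iff.1 hK
  have hLm : L ∈ fixedLines (lineStab G (ray (toReal t))) := ⟨hL, fun k hk => hfix k (hle hk)⟩
  rw [h.fixedLines_eq ht hp] at hLm
  rcases hLm with rfl | rfl
  · exact ⟨hKG hg, hfix g hg⟩
  · rw [← h.lineStab_neg ht]
    exact ⟨hKG hg, hfix g hg⟩

theorem IsOrbit.of_mem {t u : Fin 5 → SignType} {O : Finset (Fin 5 → SignType)}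
    (h : IsOrbit E t O) (hu : u ∈ O) : IsOrbit E u O := fun r => by
  obtain ⟨s, hs, rfl⟩ := (h u).1 hu
  rw [h r]
  constructor
  · rintro ⟨k, hk, rfl⟩
    exact ⟨k * s⁻¹, mul_mem hk (inv_mem hs), by rw [mul_app, inv_app_app]⟩
  · rintro ⟨k, hk, rfl⟩
    exact ⟨k * s, mul_mem hk hs, mul_app _ _ _⟩

/-- Maximality would turn the inclusion of stabilisers into an equality and so give orbits of equal
length. -/
theorem Covers.not_isMaxReducible (h : Covers G E) {t u : Fin 5 → SignType} (ht : t ≠ 0)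
    (hu : u ≠ 0) (hd : Dominates E t u) {O O' : Finset (Fin 5 → SignType)} (hO : IsOrbit E t O)
    (hO' : IsOrbit E u O') (hc : O.card ≠ O'.card) :
    ¬ IsMaxReducible G (lineStab G (ray (toReal t))) := by
  intro hm
  have hle := h.lineStab_mono ht hu hd
  have heq := le_antisymm hle (hm.2 ⟨lineStab_le _ _,
    isReducible_lineStab _ (isLine_ray (toReal_ne_zero hu))⟩ hle)
  have h1 := card_lineStab G (ray (toReal t))
  have h2 := card_lineStab G (ray (toReal u))
  have h0 : ∀ r : Fin 5 → SignType, r ≠ 0 → ∀ Q, IsOrbit E r Q → ∀ q ∈ Q, q ≠ 0 := by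
    rintro r hr Q hQ q hq rfl
    obtain ⟨s, -, e⟩ := (hQ 0).1 hq
    exact signVec_app_ne_zero hr e
  rw [h.orbit_eq ht hO, ncard_rays (h0 t ht O hO)] at h1
  rw [h.orbit_eq hu hO', ncard_rays (h0 u hu O' hO'), ← heq, ← h1] at h2
  have := h.finite
  have : Finite (lineStab G (ray (toReal t))) :=
    Finite.of_injective (Subgroup.inclusion (lineStab_le G _)) (Subgroup.inclusion_injective _)
  exact hc (Nat.eq_of_mul_eq_mul_left Nat.card_pos h2.symm)

/-- The stabilisers of the vectors `T a` represent the maximal point stabilisers in `E`. -/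
structure IsRepresentative {n : ℕ} (E : Subgroup SignedPerm) (T : Fin n → Fin 5 → SignType) :
    Prop where
  ne_zero : ∀ a, T a ≠ 0
  pins : ∀ a, Pins E (T a)
  dominated : ∀ t, t ≠ 0 → ∃ a, ∃ s ∈ E, Dominates E t (s.app (T a))
  distinct : ∀ a b, ∀ s ∈ E, s.app (T a) = T b ∨ s.app (T a) = -T b → a = b

namespace IsRepresentative

variable {n : ℕ} {T : Fin n → Fin 5 → SignType}

theorem exists_eq (hT : IsRepresentative E T) (h : Covers G E) {K : Subgroup U2}
    (hK : IsMaxReducible G K) : ∃ a, ∃ g ∈ G, K = lineStab G (act g (ray (toReal (T a)))) := by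
  obtain ⟨t, ht, hle⟩ := h.exists_le_lineStab hK.1.1 hK.1.2
  obtain ⟨a, s, hs, hd⟩ := hT.dominated t ht
  obtain ⟨g, hg, hgs⟩ := h.lift s hs
  have h0 : s.app (T a) ≠ 0 := signVec_app_ne_zero (hT.ne_zero a)
  refine ⟨a, g, hg, ?_⟩
  rw [hgs.act_ray_toReal (hT.ne_zero a)]
  have hle' := hle.trans (h.lineStab_mono ht h0 hd)
  exact le_antisymm hle' (hK.2 ⟨lineStab_le _ _,
    isReducible_lineStab _ (isLine_ray (toReal_ne_zero h0))⟩ hle')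

theorem fixedLines_act (hT : IsRepresentative E T) (h : Covers G E) {g : U2} (hg : g ∈ G)
    (a : Fin n) : fixedLines (lineStab G (act g (ray (toReal (T a))))) =
      {act g (ray (toReal (T a))), act g (ray (toReal (-T a)))} := by
  have ht := hT.ne_zero a
  have ht' := signVec_neg_ne_zero ht
  obtain ⟨s, hs, hgs⟩ := h.induces g hg
  have h0 : s.app (T a) ≠ 0 := signVec_app_ne_zero ht
  rw [hgs.act_ray_toReal ht, hgs.act_ray_toReal ht', app_neg]
  refine h.fixedLines_eq h0 fun x hx => ?_
  obtain ⟨c, hc⟩ := hT.pins a (s⁻¹.app x) fun r hr e => by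
    have := hx (s * r * s⁻¹) (mul_mem (mul_mem hs hr) (inv_mem hs))
      (by rw [mul_app, mul_app, inv_app_app, e])
    rw [mul_app, mul_app] at this
    rw [← inv_app_app s (r.app _), this]
  exact ⟨c, by rw [← app_toReal, ← app_smul, ← hc, app_inv_app]⟩

theorem representsMaxReducible (hT : IsRepresentative E T) (h : Covers G E) :
    RepresentsMaxReducible G fun a => lineStab G (ray (toReal (T a))) where
  isMax a := h.isMaxReducible (hT.ne_zero a) (hT.pins a)
  complete K hK := by
    obtain ⟨a, g, hg, rfl⟩ := hT.exists_eq h hK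
    exact ⟨a, g, hg, lineStab_act hg _⟩
  distinct a b := by
    rintro ⟨g, hg, e⟩
    rw [← lineStab_act hg] at e
    obtain ⟨s, hs, hgs⟩ := h.induces g hg
    have hm : act g (ray (toReal (T a))) ∈ fixedLines (lineStab G (ray (toReal (T b)))) := by
      rw [e, hT.fixedLines_act h hg]; exact Or.inl rfl
    have h0 : s.app (T a) ≠ 0 := signVec_app_ne_zero (hT.ne_zero a)
    rw [h.fixedLines_eq (hT.ne_zero b) (hT.pins b), hgs.act_ray_toReal (hT.ne_zero a)] at hm
    exact hT.distinct a b s hs (hm.imp (ray_toReal_injective h0 (hT.ne_zero b))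
      (ray_toReal_injective h0 (signVec_neg_ne_zero (hT.ne_zero b))))

theorem orbit_act {g : U2} (hg : g ∈ G) (L : Subsp) : orbit G (act g L) = orbit G L := by
  ext M
  constructor
  · rintro ⟨k, hk, rfl⟩; exact ⟨k * g, mul_mem hk hg, (act_mul _ _ _).symm⟩
  · rintro ⟨k, hk, rfl⟩
    exact ⟨k * g⁻¹, mul_mem hk (inv_mem hg), by rw [← act_mul, inv_mul_cancel_right]⟩

/-- Each class contributes the orbits of `T a` and `-T a`, which may differ; this is why four
classes can yield five orbits. -/
theorem maxReducibleOrbits_eq (hT : IsRepresentative E T) (h : Covers G E) :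
    maxReducibleOrbits G = {S | ∃ a, S = orbit G (ray (toReal (T a))) ∨
      S = orbit G (ray (toReal (-T a)))} := by
  ext S
  constructor
  · rintro ⟨K, hK, L, hL, rfl⟩
    obtain ⟨a, g, hg, rfl⟩ := hT.exists_eq h hK
    rw [hT.fixedLines_act h hg] at hL
    refine ⟨a, hL.imp ?_ ?_⟩ <;> rintro rfl <;> exact orbit_act hg _
  · rintro ⟨a, h'⟩
    refine ⟨_, h.isMaxReducible (hT.ne_zero a) (hT.pins a), ?_⟩
    rw [h.fixedLines_eq (hT.ne_zero a) (hT.pins a)]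
    rcases h' with rfl | rfl
    · exact ⟨_, Or.inl rfl, rfl⟩
    · exact ⟨_, Or.inr rfl, rfl⟩

theorem finite_fixedLines (hT : IsRepresentative E T) (h : Covers G E) {K : Subgroup U2}
    (hK : IsMaxReducible G K) : (fixedLines K).Finite := by
  obtain ⟨a, g, hg, rfl⟩ := hT.exists_eq h hK
  rw [hT.fixedLines_act h hg]
  exact Set.toFinite _

end IsRepresentative

/-! ### The maximal reducible subgroups of the three groups -/

/-- As in the companion lemmas, a few elements of the stabiliser give enough linear equations to
leave a one-dimensional solution space. -/
theorem pins_tE : Pins (rotations pentagon) tE := fun x hx => by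
  have h1 := hx spI (by decide +kernel) (by decide +kernel)
  have h2 := hx spII (by decide +kernel) (by decide +kernel)
  have h3 := hx spJJ (by decide +kernel) (by decide +kernel)
  have e1 := congrFun h1 1
  have e2 := congrFun h2 3
  have e3 := congrFun h2 4
  have e4 := congrFun h3 2
  simp [app_real, spI, spII, spJJ] at e1 e2 e3 e4
  refine ⟨x 0, funext fun i => ?_⟩
  fin_cases i <;> simp [toReal, tE] <;> linarith

theorem pins_tW : Pins (rotations pentagon) tW := fun x hx => by
  have h1 := hx spJK (by decide +kernel) (by decide +kernel)
  have h2 := hx spF (by decide +kernel) (by decide +kernel)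
  have e1 := congrFun h1 1
  have e2 := congrFun h1 3
  have e3 := congrFun h2 0
  have e4 := congrFun h2 2
  simp [app_real, spJK, spF] at e1 e2 e3 e4
  refine ⟨x 0, funext fun i => ?_⟩
  fin_cases i <;> simp [toReal, tW] <;> linarith

theorem pins_tA : Pins (rotations pentagon) tA := fun x hx => by
  have h1 := hx spJK (by decide +kernel) (by decide +kernel)
  have h2 := hx spS (by decide +kernel) (by decide +kernel)
  have e1 := congrFun h1 1
  have e2 := congrFun h1 3
  have e3 := congrFun h2 0
  have e4 := congrFun h2 3
  simp [app_real, spJK, spS] at e1 e2 e3 e4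
  refine ⟨x 1, funext fun i => ?_⟩
  fin_cases i <;> simp [toReal, tA] <;> linarith

theorem pins_tB : Pins (rotations pentagon) tB := fun x hx => by
  have h1 := hx spJJ (by decide +kernel) (by decide +kernel)
  have h2 := hx spT (by decide +kernel) (by decide +kernel)
  have e1 := congrFun h1 2
  have e2 := congrFun h1 4
  have e3 := congrFun h2 0
  have e4 := congrFun h2 1
  simp [app_real, spJJ, spT] at e1 e2 e3 e4
  refine ⟨x 1, funext fun i => ?_⟩
  fin_cases i <;> simp [toReal, tB] <;> linarith

theorem pins_tC : Pins (rotations (alternatingGroup (Fin 5))) tC := fun x hx => by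
  have h1 := hx ⟨⟨![0, 2, 3, 1, 4], ![0, 3, 1, 2, 4], by decide, by decide⟩, ![1, -1, -1, 1, 1]⟩
    (by decide +kernel) (by decide +kernel)
  have h2 := hx ⟨⟨![0, 1, 2, 3, 4], ![0, 1, 2, 3, 4], by decide, by decide⟩, ![-1, 1, 1, 1, -1]⟩
    (by decide +kernel) (by decide +kernel)
  have e1 := congrFun h1 1
  have e2 := congrFun h1 2
  have e3 := congrFun h2 0
  have e4 := congrFun h2 4
  simp [app_real] at e1 e2 e3 e4
  refine ⟨x 1, funext fun i => ?_⟩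
  fin_cases i <;> simp [toReal, tC] <;> linarith

/-- Transpositions of the support, with signs adapted to `tD`, must negate coordinate `4` to have
determinant one, so that coordinate vanishes. Such odd permutations are absent from `P1` and `P2`.
-/
theorem pins_tD : Pins (rotations ⊤) tD := fun x hx => by
  have h1 := hx ⟨⟨![1, 0, 2, 3, 4], ![1, 0, 2, 3, 4], by decide, by decide⟩, ![1, 1, 1, 1, -1]⟩
    (by decide +kernel) (by decide +kernel)
  have h2 := hx ⟨⟨![0, 2, 1, 3, 4], ![0, 2, 1, 3, 4], by decide, by decide⟩, ![1, -1, -1, 1, -1]⟩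
    (by decide +kernel) (by decide +kernel)
  have h3 := hx ⟨⟨![0, 1, 3, 2, 4], ![0, 1, 3, 2, 4], by decide, by decide⟩, ![1, 1, 1, 1, -1]⟩
    (by decide +kernel) (by decide +kernel)
  have e1 := congrFun h1 0
  have e2 := congrFun h2 1
  have e3 := congrFun h3 2
  have e4 := congrFun h1 4
  simp [app_real] at e1 e2 e3 e4
  refine ⟨x 1, funext fun i => ?_⟩
  fin_cases i <;> simp [toReal, tD] <;> linarith

theorem dominates_pentagon {t u : Fin 5 → SignType}
    (h : ∀ k l a b c d, (word k l a b c d).app t = t → (word k l a b c d).app u = u) :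
    Dominates (rotations pentagon) t u := fun s hs e => by
  obtain ⟨k, l, a, b, c, d, rfl⟩ := exists_word hs
  exact h k l a b c d e

/-- The support is a path of three vertices of the pentagon, and its middle vertex is preserved with
its sign. -/
theorem dominates_tC : Dominates (rotations pentagon) tC ![0, 0, 1, 0, 0] :=
  dominates_pentagon (by decide +kernel)

/-- Here the support is an edge together with the opposite vertex, and that vertex is preserved. -/
theorem dominates_tC' : Dominates (rotations pentagon) tC' ![0, 0, 0, 0, 1] :=
  dominates_pentagon (by decide +kernel)

theorem dominates_tD : Dominates (rotations (alternatingGroup (Fin 5))) tD tW := fun s hs e => by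
  have h4 : ∀ i, tD i = 0 ↔ i = 4 := by decide
  have hne : ∀ i, i ≠ 4 → tW i = tD i := by decide
  have hs4 : ∀ i, s.perm.symm i = 4 ↔ i = 4 := by
    intro i
    rw [← h4 i, ← h4]
    conv_rhs => rw [← e]
    simp only [SignedPerm.app]
    split_ifs <;> simp
  have h : ∀ i, i ≠ 4 → s.app tW i = tW i := by
    intro i hi
    have h1 : s.app tW i = s.app tD i := by
      simp only [SignedPerm.app]
      rw [hne _ (mt (hs4 i).1 hi)]
    rw [h1, e, hne i hi]
  -- The first four entries are preserved and so is the product of all five; hence the last entry is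
  -- preserved as well.
  have hp := prod_app_of_alternating hs tW
  simp only [Fin.prod_univ_five] at hp
  rw [h 0 (by decide), h 1 (by decide), h 2 (by decide), h 3 (by decide)] at hp
  have h5 : s.app tW 4 = tW 4 := by
    revert hp
    generalize s.app tW 4 = y
    revert y
    decide
  funext i
  by_cases hi : i = 4
  · rw [hi, h5]
  · exact h i hi

theorem Dominates.mono {E' : Subgroup SignedPerm} {t u : Fin 5 → SignType} (h : Dominates E' t u)
    (hE : E ≤ E') : Dominates E t u := fun s hs => h s (hE hs)

/-- A vector in the orbit of `t` is dominated by the orbit of `u` if `t` is dominated by `u`. -/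
theorem IsOrbit.dominated {n : ℕ} {T : Fin n → Fin 5 → SignType} {t u : Fin 5 → SignType}
    {O : Finset (Fin 5 → SignType)} (hO : IsOrbit E t O) {r : Fin 5 → SignType} (hr : r ∈ O)
    (hd : Dominates E t u) {a : Fin n} (hu : ∃ s ∈ E, s.app (T a) = u) :
    ∃ a, ∃ s ∈ E, Dominates E r (s.app (T a)) := by
  obtain ⟨s, hs, rfl⟩ := (hO r).1 hr
  obtain ⟨k, hk, rfl⟩ := hu
  exact ⟨a, s * k, mul_mem hs hk, by rw [mul_app]; exact hd.app hs⟩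

theorem IsOrbit.dominated_self {n : ℕ} {T : Fin n → Fin 5 → SignType}
    {O : Finset (Fin 5 → SignType)} (a : Fin n) (hO : IsOrbit E (T a) O) {r : Fin 5 → SignType}
    (hr : r ∈ O) : ∃ a, ∃ s ∈ E, Dominates E r (s.app (T a)) :=
  hO.dominated hr (u := T a) (fun _ _ h => h) ⟨1, E.one_mem, one_app _⟩

end

theorem Pins.neg {E : Subgroup SignedPerm} {t : Fin 5 → SignType} (h : Pins E t) : Pins E (-t) :=
  fun x hx => by
    obtain ⟨c, rfl⟩ := h x fun s hs e => hx s hs (by rw [app_neg, e])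
    exact ⟨-c, by rw [toReal_neg, neg_smul, smul_neg, neg_neg]⟩

theorem dominates_neg (E : Subgroup SignedPerm) (t : Fin 5 → SignType) : Dominates E t (-t) :=
  fun s _ e => by rw [app_neg, e]

theorem IsOrbit.distinct {n : ℕ} {E : Subgroup SignedPerm} {T : Fin n → Fin 5 → SignType}
    {O : Fin n → Finset (Fin 5 → SignType)} (hO : ∀ a, IsOrbit E (T a) (O a))
    (h : ∀ a b, T b ∈ O a ∨ -T b ∈ O a → a = b) (a b : Fin n) (s : SignedPerm) (hs : s ∈ E)
    (e : s.app (T a) = T b ∨ s.app (T a) = -T b) : a = b :=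
  h a b (e.imp (fun e => (hO a _).2 ⟨s, hs, e⟩) fun e => (hO a _).2 ⟨s, hs, e⟩)

theorem isRepresentative_pentagon : IsRepresentative (rotations pentagon) ![tE, tW, tA, tB] where
  ne_zero := by decide +kernel
  pins a := by
    fin_cases a
    exacts [pins_tE, pins_tW, pins_tA, pins_tB]
  dominated t ht := by
    have h : ∀ t : Fin 5 → SignType, t ≠ 0 → t ∈ ofWt 1 ∨ t ∈ orbW ∨ t ∈ orbA ∨ t ∈ orbB ∨
        t ∈ orbW' ∨ t ∈ orbC ∨ t ∈ orbC' ∨ t ∈ ofWt 4 := by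
      simp only [mem_ofWt, mem_orbW, mem_orbW', mem_orbA, mem_orbB, mem_orbC, mem_orbC']
      decide +kernel
    rcases h t ht with h | h | h | h | h | h | h | h
    · exact orbit_E_pentagon.dominated_self (T := ![tE, tW, tA, tB]) 0 h
    · exact orbit_W_pentagon.dominated_self (T := ![tE, tW, tA, tB]) 1 h
    · exact orbit_A_pentagon.dominated_self (T := ![tE, tW, tA, tB]) 2 h
    · exact orbit_B_pentagon.dominated_self (T := ![tE, tW, tA, tB]) 3 h
    · exact orbit_W'_pentagon.dominated h (a := 1)
        (show Dominates _ tW' tW from (show -tW' = tW by decide) ▸ dominates_neg _ _)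
        ⟨1, one_mem _, rfl⟩
    · exact orbit_C_pentagon.dominated h (a := 0) dominates_tC
        ((orbit_E_pentagon _).1 (by decide +kernel))
    · exact orbit_C'_pentagon.dominated h (a := 0) dominates_tC'
        ((orbit_E_pentagon _).1 (by decide +kernel))
    · exact orbit_D_pentagon.dominated h (a := 1) (dominates_tD.mono pentagon_le_alternating)
        ⟨1, one_mem _, rfl⟩
  distinct := IsOrbit.distinct (O := ![ofWt 1, orbW, orbA, orbB])
    (by
      intro a
      fin_cases a
      exacts [orbit_E_pentagon, orbit_W_pentagon, orbit_A_pentagon, orbit_B_pentagon])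
    (by decide +kernel)

theorem isRepresentative_alternating :
    IsRepresentative (rotations (alternatingGroup (Fin 5))) ![tE, tW, tA, tC] where
  ne_zero := by decide +kernel
  pins a := by
    fin_cases a
    exacts [pins_tE.mono pentagon_le_alternating, pins_tW.mono pentagon_le_alternating,
      pins_tA.mono pentagon_le_alternating, pins_tC]
  dominated t ht := by
    have h : ∀ t : Fin 5 → SignType, t ≠ 0 → t ∈ ofWt 1 ∨ t ∈ orbW ∨ t ∈ ofWt 2 ∨ t ∈ ofWt 3 ∨
        t ∈ orbW' ∨ t ∈ ofWt 4 := by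
      simp only [mem_ofWt, mem_orbW, mem_orbW']
      decide +kernel
    rcases h t ht with h | h | h | h | h | h
    · exact orbit_E_alternating.dominated_self (T := ![tE, tW, tA, tC]) 0 h
    · exact orbit_W_alternating.dominated_self (T := ![tE, tW, tA, tC]) 1 h
    · exact orbit_A_alternating.dominated_self (T := ![tE, tW, tA, tC]) 2 h
    · exact orbit_C_alternating.dominated_self (T := ![tE, tW, tA, tC]) 3 h
    · exact orbit_W'_alternating.dominated h (a := 1)
        (show Dominates _ tW' tW from (show -tW' = tW by decide) ▸ dominates_neg _ _)
        ⟨1, one_mem _, rfl⟩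
    · exact orbit_D_alternating.dominated h (a := 1) dominates_tD ⟨1, one_mem _, rfl⟩
  distinct := IsOrbit.distinct (O := ![ofWt 1, orbW, ofWt 2, ofWt 3])
    (by
      intro a
      fin_cases a
      exacts [orbit_E_alternating, orbit_W_alternating, orbit_A_alternating, orbit_C_alternating])
    (by decide +kernel)

theorem isRepresentative_top : IsRepresentative (rotations ⊤) ![tE, tW, tA, tC, tD] where
  ne_zero := by decide +kernel
  pins a := by
    have h : rotations pentagon ≤ rotations ⊤ := rotations_mono le_top
    fin_cases a
    exacts [pins_tE.mono h, pins_tW.mono h, pins_tA.mono h,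
      pins_tC.mono (rotations_mono le_top), pins_tD]
  dominated t ht := by
    have h : ∀ t : Fin 5 → SignType, t ≠ 0 → t ∈ ofWt 1 ∨ t ∈ ofWt 5 ∨ t ∈ ofWt 2 ∨ t ∈ ofWt 3 ∨
        t ∈ ofWt 4 := by
      simp only [mem_ofWt]
      decide +kernel
    rcases h t ht with h | h | h | h | h
    · exact orbit_E_top.dominated_self (T := ![tE, tW, tA, tC, tD]) 0 h
    · exact orbit_W_top.dominated_self (T := ![tE, tW, tA, tC, tD]) 1 h
    · exact orbit_A_top.dominated_self (T := ![tE, tW, tA, tC, tD]) 2 h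
    · exact orbit_C_top.dominated_self (T := ![tE, tW, tA, tC, tD]) 3 h
    · exact orbit_D_top.dominated_self (T := ![tE, tW, tA, tC, tD]) 4 h
  distinct := IsOrbit.distinct (O := ![ofWt 1, ofWt 5, ofWt 2, ofWt 3, ofWt 4])
    (by
      intro a
      fin_cases a
      exacts [orbit_E_top, orbit_W_top, orbit_A_top, orbit_C_top, orbit_D_top])
    (by decide +kernel)

/-! ### The explicit generators of the stabilisers in the first group -/

/-- The stabiliser of a vector in the group of signed permutations. -/
def stabilizerOf (t : Fin 5 → SignType) : Subgroup SignedPerm where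
  carrier := {s | s.app t = t}
  one_mem' := one_app t
  mul_mem' := by
    intro s r hs hr
    change (s * r).app t = t
    rw [mul_app, show r.app t = t from hr, show s.app t = t from hs]
  inv_mem' := by
    intro s hs
    change s⁻¹.app t = t
    conv_lhs => rw [← show s.app t = t from hs]
    exact inv_app_app s t

theorem Covers.lineStab {G : Subgroup U2} {E : Subgroup SignedPerm} (h : Covers G E)
    {t : Fin 5 → SignType} (ht : t ≠ 0) :
    Covers (lineStab G (ray (toReal t))) (E ⊓ stabilizerOf t) where
  induces g hg := by
    obtain ⟨s, hs, hgs, e⟩ := (h.mem_lineStab_toReal ht).1 hg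
    exact ⟨s, ⟨hs, e⟩, hgs⟩
  lift s hs := by
    obtain ⟨g, -, hgs⟩ := h.lift s hs.1
    exact ⟨g, (h.mem_lineStab_toReal ht).2 ⟨s, hs.1, hgs, hs.2⟩, hgs⟩
  neg_one_mem := (h.mem_lineStab_toReal ht).2 ⟨1, one_mem _, induces_neg_one, one_app t⟩

/-- A group generated by matrices inducing elements of the stabiliser of `t` is the stabiliser of
the line of `t` if its image contains the stabiliser of `t`. -/
theorem genBy_eq_lineStab {S : Set Mat2} {t : Fin 5 → SignType} (ht : t ≠ 0)
    (h : ∀ M ∈ S, ∃ s ∈ rotations pentagon ⊓ stabilizerOf t, Induces M s)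
    (hw : ∀ k l a b c d, (word k l a b c d).app t = t → word k l a b c d ∈ image (genBy S))
    (h1 : -1 ∈ genBy S) : genBy S = lineStab P1 (ray (toReal t)) := by
  refine (Covers.of_genBy h (fun s hs => ?_) h1).eq (covers_P1.lineStab ht)
  obtain ⟨k, l, a, b, c, d, rfl⟩ := exists_word hs.1
  exact hw k l a b c d hs.2

instance {t : Fin 5 → SignType} : DecidablePred (· ∈ rotations pentagon ⊓ stabilizerOf t) :=
  fun s => inferInstanceAs (Decidable (s ∈ rotations pentagon ∧ s.app t = t))

theorem neg_one_eq_mul_self {G : Subgroup U2} {g : U2} (hg : g ∈ G)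
    (eg : (g : Mat2) * (g : Mat2) = -1) : -1 ∈ G := by
  have : (-1 : U2) = g * g := Subtype.ext eg.symm
  rw [this]
  exact mul_mem hg hg

theorem matJJ_sq : matJJ * matJJ = -1 := by
  ext1 i j
  fin_cases i <;> fin_cases j <;> simp [matJJ, Matrix.mul_apply, Fin.sum_univ_two] <;>
    ext <;> simp

theorem matJK_sq : matJK * matJK = -1 := by
  ext1 i j
  fin_cases i <;> fin_cases j <;> simp [matJK, Matrix.mul_apply, Fin.sum_univ_two] <;>
    ext <;> simp

theorem H32_eq : H32 = lineStab P1 (ray (toReal tE)) := by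
  change genBy {matI, matII, matJJ} = _
  have hI := mem_image_genBy (S := {matI, matII, matJJ}) (by simp) matI_mem induces_matI
  have hII := mem_image_genBy (S := {matI, matII, matJJ}) (by simp) matII_mem induces_matII
  have hJJ := mem_image_genBy (S := {matI, matII, matJJ}) (by simp) matJJ_mem induces_matJJ
  refine genBy_eq_lineStab (by decide) ?_ (fun k l a b c d e => ?_)
    (neg_one_eq_mul_self (mem_genBy (M := matJJ) (by simp) matJJ_mem) matJJ_sq)
  · rintro M (rfl | rfl | rfl)
    · exact ⟨_, by decide +kernel, induces_matI⟩
    · exact ⟨_, by decide +kernel, induces_matII⟩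
    · exact ⟨_, by decide +kernel, induces_matJJ⟩
  -- The stabiliser has 16 elements modulo sign, and these products list them.
  · obtain ⟨i, j, m, h⟩ : ∃ (i : Fin 4) (j m : Fin 2), word k l a b c d =
        spI ^ (i : ℕ) * spII ^ (j : ℕ) * spJJ ^ (m : ℕ) := by
      revert k l a b c d; decide +kernel
    rw [h]
    exact mul_mem (mul_mem (pow_mem hI _) (pow_mem hII _)) (pow_mem hJJ _)

theorem H20_eq : H20 = lineStab P1 (ray (toReal tW)) := by
  change genBy {matJK, matF} = _
  have hJK := mem_image_genBy (S := {matJK, matF}) (by simp) matJK_mem induces_matJK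
  have hF := mem_image_genBy (S := {matJK, matF}) (by simp) matF_mem induces_matF
  refine genBy_eq_lineStab (by decide) ?_ (fun k l a b c d e => ?_)
    (neg_one_eq_mul_self (mem_genBy (M := matJK) (by simp) matJK_mem) matJK_sq)
  · rintro M (rfl | rfl)
    · exact ⟨_, by decide +kernel, induces_matJK⟩
    · exact ⟨_, by decide +kernel, induces_matF⟩
  -- Modulo sign the stabiliser is dihedral of order 10, with `spJK * spF` as a rotation and `spF`
  -- as a reflection.
  · obtain ⟨i, j, h⟩ : ∃ (i : Fin 5) (j : Fin 2), word k l a b c d =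
        (spJK * spF) ^ (i : ℕ) * spF ^ (j : ℕ) := by
      revert k l a b c d; decide +kernel
    rw [h]
    exact mul_mem (pow_mem (mul_mem hJK hF) _) (pow_mem hF _)

theorem H16a_eq : H16a = lineStab P1 (ray (toReal tA)) := by
  change genBy {matJK, matS} = _
  have hJK := mem_image_genBy (S := {matJK, matS}) (by simp) matJK_mem induces_matJK
  have hS := mem_image_genBy (S := {matJK, matS}) (by simp) matS_mem induces_matS
  refine genBy_eq_lineStab (by decide) ?_ (fun k l a b c d e => ?_)
    (neg_one_eq_mul_self (mem_genBy (M := matJK) (by simp) matJK_mem) matJK_sq)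
  · rintro M (rfl | rfl)
    · exact ⟨_, by decide +kernel, induces_matJK⟩
    · exact ⟨_, by decide +kernel, induces_matS⟩
  · obtain ⟨i, j, h⟩ : ∃ (i : Fin 4) (j : Fin 2), word k l a b c d =
        (spJK * spS) ^ (i : ℕ) * spS ^ (j : ℕ) := by
      revert k l a b c d; decide +kernel
    rw [h]
    exact mul_mem (pow_mem (mul_mem hJK hS) _) (pow_mem hS _)

theorem H16b_eq : H16b = lineStab P1 (ray (toReal tB)) := by
  change genBy {matJJ, matT} = _
  have hJJ := mem_image_genBy (S := {matJJ, matT}) (by simp) matJJ_mem induces_matJJ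
  have hT := mem_image_genBy (S := {matJJ, matT}) (by simp) matT_mem induces_matT
  refine genBy_eq_lineStab (by decide) ?_ (fun k l a b c d e => ?_)
    (neg_one_eq_mul_self (mem_genBy (M := matJJ) (by simp) matJJ_mem) matJJ_sq)
  · rintro M (rfl | rfl)
    · exact ⟨_, by decide +kernel, induces_matJJ⟩
    · exact ⟨_, by decide +kernel, induces_matT⟩
  · obtain ⟨i, j, h⟩ : ∃ (i : Fin 4) (j : Fin 2), word k l a b c d =
        spT ^ (i : ℕ) * spJJ ^ (j : ℕ) := by
      revert k l a b c d; decide +kernel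
    rw [h]
    exact mul_mem (pow_mem hT _) (pow_mem hJJ _)

/-! ### The rows of the table -/

theorem row_E {G : Subgroup U2} {E : Subgroup SignedPerm} (hG : Covers G E)
    (hO : IsOrbit E tE (ofWt 1)) {h : ℕ} (hc : Nat.card G = h * 10) :
    Row G h vE {0, 1 / 2} 10 mubLines := by
  rw [mubLines_eq]
  refine row_of_orbit hG hO one_ne_zero (by decide) lineOf_vE (by decide +kernel) hc
    (by decide +kernel) (D := {-1, 0}) (by decide +kernel) ?_
  ext x
  simp

theorem row_W {G : Subgroup U2} {E : Subgroup SignedPerm} (hG : Covers G E)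
    (hO : IsOrbit E tW orbW) {h : ℕ} (hc : Nat.card G = h * 16) :
    Row G h vW {1 / 5, 3 / 5} 16 linesW := by
  rw [linesW_eq]
  refine row_of_orbit hG hO (m := 5) (by decide) (by decide) lineOf_vW (by decide +kernel) hc
    (by decide +kernel) (D := {-3, 1}) (by decide +kernel) ?_
  ext x
  simp
  norm_num

theorem row_W' {G : Subgroup U2} {E : Subgroup SignedPerm} (hG : Covers G E)
    (hO : IsOrbit E tW' orbW') {h : ℕ} (hc : Nat.card G = h * 16) :
    Row G h vW' {1 / 5, 3 / 5} 16 linesW' := by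
  rw [linesW'_eq]
  refine row_of_orbit hG hO (m := 5) (by decide) (by decide) lineOf_vW' (by decide +kernel) hc
    (by decide +kernel) (D := {-3, 1}) (by decide +kernel) ?_
  ext x
  simp
  norm_num

theorem linesW_union : linesW ∪ linesW' = rays (ofWt 5) := by
  rw [linesW_eq, linesW'_eq, ← rays_union]
  congr 1
  decide +kernel

theorem linesA_union : linesA ∪ linesB = rays (ofWt 2) := by
  rw [linesA_eq, linesB_eq, ← rays_union]
  congr 1
  decide +kernel

theorem row_WW' {G : Subgroup U2} {E : Subgroup SignedPerm} (hG : Covers G E)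
    (hO : IsOrbit E tW (ofWt 5)) {h : ℕ} (hc : Nat.card G = h * 32) :
    Row G h vW {0, 1 / 5, 2 / 5, 3 / 5, 4 / 5} 32 (linesW ∪ linesW') := by
  rw [linesW_union]
  refine row_of_orbit hG hO (m := 5) (by decide) (by decide) lineOf_vW (by decide +kernel) hc
    (by decide +kernel) (D := {-5, -3, -1, 1, 3}) (by decide +kernel) ?_
  ext x
  simp
  norm_num

theorem row_A {G : Subgroup U2} {E : Subgroup SignedPerm} (hG : Covers G E)
    (hO : IsOrbit E tA orbA) {h : ℕ} (hc : Nat.card G = h * 20) :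
    Row G h vA {0, 1 / 4, 1 / 2, 3 / 4} 20 linesA := by
  rw [linesA_eq]
  refine row_of_orbit hG hO (m := 2) (by decide) (by decide) lineOf_vA (by decide +kernel) hc
    (by decide +kernel) (D := {-2, -1, 0, 1}) (by decide +kernel) ?_
  ext x
  simp
  norm_num

theorem row_B {G : Subgroup U2} {E : Subgroup SignedPerm} (hG : Covers G E)
    (hO : IsOrbit E tB orbB) {h : ℕ} (hc : Nat.card G = h * 20) :
    Row G h vB {0, 1 / 4, 1 / 2, 3 / 4} 20 linesB := by
  rw [linesB_eq]
  refine row_of_orbit hG hO (m := 2) (by decide) (by decide) lineOf_vB (by decide +kernel) hc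
    (by decide +kernel) (D := {-2, -1, 0, 1}) (by decide +kernel) ?_
  ext x
  simp
  norm_num

theorem row_AB {G : Subgroup U2} {E : Subgroup SignedPerm} (hG : Covers G E)
    (hO : IsOrbit E tA (ofWt 2)) {h : ℕ} (hc : Nat.card G = h * 40) :
    Row G h vA {0, 1 / 4, 1 / 2, 3 / 4} 40 (linesA ∪ linesB) := by
  rw [linesA_union]
  refine row_of_orbit hG hO (m := 2) (by decide) (by decide) lineOf_vA (by decide +kernel) hc
    (by decide +kernel) (D := {-2, -1, 0, 1}) (by decide +kernel) ?_
  ext x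
  simp
  norm_num

/-- The orbit is left open because the half orbit of `P1` and the full set of weight three give the
same dot products with `tC`, and both satisfy the design identity. -/
theorem row_C {G : Subgroup U2} {E : Subgroup SignedPerm} (hG : Covers G E)
    {O : Finset (Fin 5 → SignType)} (hO : IsOrbit E tC O) (hO' : O = orbC ∨ O = ofWt 3) {h : ℕ}
    (hc : Nat.card G = h * O.card) :
    Row G h vC {0, 1 / 6, 1 / 3, 1 / 2, 2 / 3, 5 / 6} O.card (rays O) := by
  refine row_of_orbit hG hO (m := 3) (by decide) (by decide) lineOf_vC rfl hc
    ?_ (D := {-3, -2, -1, 0, 1, 2}) ?_ ?_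
  · rcases hO' with rfl | rfl <;> decide +kernel
  · rcases hO' with rfl | rfl <;> decide +kernel
  · ext x
    simp
    norm_num

theorem row_D {G : Subgroup U2} {E : Subgroup SignedPerm} (hG : Covers G E)
    (hO : IsOrbit E tD (ofWt 4)) {h : ℕ} (hc : Nat.card G = h * 80) :
    Row G h vD {0, 1 / 8, 2 / 8, 3 / 8, 4 / 8, 5 / 8, 6 / 8, 7 / 8} 80 (rays (ofWt 4)) := by
  refine row_of_orbit hG hO (m := 4) (by decide) (by decide) lineOf_vD (by decide +kernel) hc
    (by decide +kernel) (D := {-4, -3, -2, -1, 0, 1, 2, 3}) (by decide +kernel) ?_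
  ext x
  simp
  norm_num

/-! ### Root lines -/

theorem sub_ip_orthogonal {a : Vec 2} (ha : a ≠ 0) (v : Vec 2) :
    ip a (v - MulOpposite.op ((sqNorm a)⁻¹ • ip a v) • a) = 0 := by
  have hs := (sqNorm_pos ha).ne'
  have h : ∀ z : ℍ[ℝ], ip a (MulOpposite.op z • a) = sqNorm a • z := by
    intro z
    have e : ∀ i, star (a i) * (a i * z) = normSq (a i) • z := fun i => by
      rw [← mul_assoc, star_mul_self, Quaternion.coe_mul_eq_smul]
    simp [ip, sqNorm_two, dotProduct, Fin.sum_univ_two, e, add_smul]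
  have hsub : ∀ x y : Vec 2, ip a (x - y) = ip a x - ip a y := fun x y => by
    simp [ip, dotProduct_sub]
  rw [hsub, h, smul_smul, mul_inv_cancel₀ hs, one_smul, sub_self]

/-- Split `v` into its component along `a` and the orthogonal one; only the former changes. -/
theorem reflection_mulVec {g : U2} {a : Vec 2} (ha : a ≠ 0)
    (h : ∀ x, ip a x = 0 → (g : Mat2) *ᵥ x = x) {ξ : ℍ[ℝ]}
    (hξ : (g : Mat2) *ᵥ a = fun r => a r * ξ) (v : Vec 2) :
    (g : Mat2) *ᵥ v = v + MulOpposite.op ((ξ - 1) * ((sqNorm a)⁻¹ • ip a v)) • a := by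
  set z := (sqNorm a)⁻¹ • ip a v with hz
  have h1 := h _ (sub_ip_orthogonal ha v)
  rw [← hz, Matrix.mulVec_sub, Matrix.mulVec_smul, hξ, sub_eq_iff_eq_add] at h1
  rw [h1]
  funext i
  simp [mul_assoc, sub_mul, mul_sub]
  abel

/-- The quadratic form of the signed permutation induced by a reflection. -/
theorem reflection_quadratic {g : U2} {s : SignedPerm} (hs : Induces (g : Mat2) s) {a : Vec 2}
    (ha : a ≠ 0) (h : ∀ x, ip a x = 0 → (g : Mat2) *ᵥ x = x) {ξ : ℍ[ℝ]} (hn : normSq ξ = 1)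
    (hξ : (g : Mat2) *ᵥ a = fun r => a r * ξ) (v : Vec 2) :
    hopf v ⬝ᵥ s.app (hopf v) = ξ.re * (hopf v ⬝ᵥ hopf v) +
      (1 - ξ.re) * (((sqNorm a)⁻¹ • hopf a) ⬝ᵥ hopf v) ^ 2 := by
  have hpos := (sqNorm_pos ha).ne'
  -- The value `|⟨v, g v⟩|²` is computed twice, by the Hopf map and by the explicit formula for the
  -- reflection, and the two are compared.
  have e1 := normSq_ip v ((g : Mat2) *ᵥ v)
  rw [sqNorm_mulVec, hs v] at e1
  have e2 : ip v ((g : Mat2) *ᵥ v) = (sqNorm v : ℍ[ℝ]) +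
      (sqNorm a)⁻¹ • (star (ip a v) * ((ξ - 1) * ip a v)) := by
    rw [reflection_mulVec ha h hξ v]
    have h3 : star (v 0) * v 0 + star (v 1) * v 1 = (sqNorm v : ℍ[ℝ]) := by
      rw [star_mul_self, star_mul_self, sqNorm_two]; simp
    have h4 : star (v 0) * a 0 + star (v 1) * a 1 = star (ip a v) := by
      simp [ip, dotProduct, Fin.sum_univ_two]
    have h5 : ∀ z : ℍ[ℝ], ip v (v + MulOpposite.op z • a) =
        (star (v 0) * v 0 + star (v 1) * v 1) + (star (v 0) * a 0 + star (v 1) * a 1) * z := by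
      intro z
      simp [ip, dotProduct, Fin.sum_univ_two, mul_add, add_mul, mul_assoc]
      abel
    rw [h5, h3, h4, mul_smul_comm, mul_smul_comm]
  have e3 : ∀ (r k : ℝ) (z : ℍ[ℝ]), normSq ((r : ℍ[ℝ]) + k • (star z * ((ξ - 1) * z))) =
      r ^ 2 - 2 * (1 - ξ.re) * (k * normSq z) * (r - k * normSq z) := by
    intro r k z
    rw [normSq_def'] at hn
    simp [normSq_def']
    linear_combination (k ^ 2 * (z.re ^ 2 + z.imI ^ 2 + z.imJ ^ 2 + z.imK ^ 2) ^ 2) * hn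
  rw [e2, e3, normSq_ip a v] at e1
  have e4 : hopf v ⬝ᵥ hopf v = sqNorm v ^ 2 := by
    rw [← sum_hopf_sq]; simp [dotProduct, pow_two]
  rw [e4, smul_dotProduct, smul_eq_mul]
  field_simp at e1 ⊢
  linear_combination -e1

theorem quadratic_of_hopf {s : SignedPerm} {x : Fin 5 → ℝ} {c : ℝ}
    (h : ∀ v : Vec 2, hopf v ⬝ᵥ s.app (hopf v) =
      c * (hopf v ⬝ᵥ hopf v) + (1 - c) * (x ⬝ᵥ hopf v) ^ 2) (y : Fin 5 → ℝ) :
    y ⬝ᵥ s.app y = c * (y ⬝ᵥ y) + (1 - c) * (x ⬝ᵥ y) ^ 2 := by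
  by_cases hy : y = 0
  · subst hy; simp
  · obtain ⟨v, -, d, hd, e⟩ := exists_hopf hy
    have := h v
    simp only [e, app_smul, smul_dotProduct, dotProduct_smul, smul_eq_mul] at this
    have hd2 : d ^ 2 ≠ 0 := by positivity
    refine mul_left_cancel₀ hd2 ?_
    linear_combination this

/-- A signed permutation with the quadratic form of a reflection has an axis of weight at most
two. -/
theorem exists_axis {s : SignedPerm} {x : Fin 5 → ℝ} {c : ℝ} (hx : x ⬝ᵥ x = 1) (hc : c < 1)
    (hc' : -1 ≤ c)
    (h : ∀ y : Fin 5 → ℝ, y ⬝ᵥ s.app y = c * (y ⬝ᵥ y) + (1 - c) * (x ⬝ᵥ y) ^ 2) :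
    ∃ t : Fin 5 → SignType, (wt t = 1 ∨ wt t = 2) ∧ ∃ d : ℝ, 0 < d ∧ x = d • toReal t := by
  -- Signed permutation matrices are integral, so the quadratic form is integral on sign vectors; on
  -- basis vectors it gives the diagonal entries, which are `-1`, `0` or `1`.
  have hint : ∀ u : Fin 5 → SignType, ∃ k : ℤ, (k : ℝ) =
      c * wt u + (1 - c) * (x ⬝ᵥ toReal u) ^ 2 := fun u => by
    refine ⟨idot u (s.app u), ?_⟩
    rw [← toReal_dotProduct, ← app_toReal, h, toReal_dotProduct, idot_self]
    simp
  have hsingle : ∀ i, ∃ k : ℤ, (k = -1 ∨ k = 0 ∨ k = 1) ∧ (k : ℝ) = c + (1 - c) * x i ^ 2 := by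
    intro i
    have he : toReal (Pi.single i 1) = Pi.single i 1 := by
      funext j
      by_cases hj : j = i
      · subst hj; simp [toReal]
      · simp [toReal, hj]
    have h1 := h (Pi.single i 1)
    rw [← he, app_toReal, he] at h1
    simp [toReal] at h1
    refine ⟨(s.app (Pi.single i 1) i : SignType), ?_, ?_⟩
    · rcases s.app (Pi.single i 1) i with _ | _ | _
      · exact Or.inr (Or.inl rfl)
      · exact Or.inl rfl
      · exact Or.inr (Or.inr rfl)
    · rw [← h1]
      rcases s.app (Pi.single i 1) i with _ | _ | _
      · exact Int.cast_zero
      · exact (Int.cast_neg 1).trans (congrArg _ Int.cast_one)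
      · exact Int.cast_one
  choose k hk hkx using hsingle
  have hsum : x 0 ^ 2 + x 1 ^ 2 + x 2 ^ 2 + x 3 ^ 2 + x 4 ^ 2 = 1 := by
    simpa [dotProduct, Fin.sum_univ_five, pow_two] using hx
  have hs : ∀ r : ℝ, 0 < r → (∀ i, x i = 0 ∨ x i = r ∨ x i = -r) →
      x = r • toReal fun i => SignType.sign (x i) := by
    intro r hr h
    funext i
    simp only [Pi.smul_apply, toReal, smul_eq_mul]
    rcases h i with h | h | h <;> rw [h] <;> simp [hr]
  have hwt : ∀ (r : ℝ) (t : Fin 5 → SignType), x = r • toReal t → r ^ 2 * wt t = 1 := by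
    rintro r t rfl
    rw [smul_dotProduct, dotProduct_smul, toReal_dotProduct, idot_self] at hx
    simp only [smul_eq_mul] at hx
    push_cast at hx
    linarith
  -- A diagonal entry `1` forces `x i ^ 2 = 1`, and the unit vector `x` has no other entry.
  by_cases h1 : ∃ i, k i = 1
  · obtain ⟨i, hi⟩ := h1
    have hxi := hkx i
    rw [hi] at hxi
    have hxi1 : x i ^ 2 = 1 := by
      have : (1 - c) * (x i ^ 2 - 1) = 0 := by push_cast at hxi; linarith
      rcases mul_eq_zero.1 this with h | h <;> linarith
    have hr : ∀ j, x j = 0 ∨ x j = 1 ∨ x j = -1 := by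
      intro j
      by_cases hj : j = i
      · subst hj; right; exact sq_eq_sq_iff_eq_or_eq_neg.1 (hxi1.trans (one_pow 2).symm)
      · left
        have h2 : x i ^ 2 + x j ^ 2 ≤ ∑ l, x l ^ 2 := by
          rw [← Finset.sum_pair (f := fun l => x l ^ 2) (Ne.symm hj)]
          exact Finset.sum_le_univ_sum_of_nonneg fun l => sq_nonneg _
        rw [Fin.sum_univ_five, hsum, hxi1] at h2
        nlinarith [sq_nonneg (x j)]
    refine ⟨_, Or.inl ?_, 1, one_pos, hs 1 one_pos hr⟩
    have := hwt 1 _ (hs 1 one_pos hr)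
    rw [one_pow, one_mul] at this
    exact_mod_cast this
  by_cases h2 : ∃ i, k i = -1
  · obtain ⟨i, hi⟩ := h2
    have hxi := hkx i
    rw [hi] at hxi
    push_cast at hxi
    -- A diagonal entry `-1` is the minimum that the form allows, so `c = -1`; the other diagonal
    -- entries then leave only `x j ^ 2 = 0` or `1 / 2`.
    have hcm : c = -1 := by nlinarith [sq_nonneg (x i)]
    subst hcm
    have h2 := sqrt_two_inv_mul_self
    have hp : 0 < (√2)⁻¹ := by positivity
    have hr : ∀ j, x j = 0 ∨ x j = (√2)⁻¹ ∨ x j = -(√2)⁻¹ := by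
      intro j
      have hj := hkx j
      rcases hk j with h | h | h
      · left
        rw [h] at hj
        push_cast at hj
        nlinarith [sq_nonneg (x j)]
      · right
        rw [h] at hj
        push_cast at hj
        refine sq_eq_sq_iff_eq_or_eq_neg.1 ?_
        rw [pow_two (√2)⁻¹, h2]; linarith
      · exact absurd ⟨j, h⟩ h1
    refine ⟨_, Or.inr ?_, _, hp, hs _ hp hr⟩
    have := hwt _ _ (hs _ hp hr)
    rw [pow_two, h2] at this
    have h3 : (wt fun i => SignType.sign (x i) : ℝ) = 2 := by linarith
    exact_mod_cast h3
  · exfalso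
    have h0 : ∀ i, c + (1 - c) * x i ^ 2 = 0 := by
      intro i
      rw [← hkx]
      rcases hk i with h | h | h
      · exact absurd ⟨i, h⟩ h2
      · rw [h]; simp
      · exact absurd ⟨i, h⟩ h1
    -- If the diagonal vanishes, its sum `5 c + (1 - c)` is zero and every `x i ^ 2` is `1 / 5`. The
    -- form at the sum of two basis vectors would then be `1 / 2` or `-1 / 2`, which is not an
    -- integer.
    have hc4 : c = -1 / 4 := by
      linear_combination (h0 0 + h0 1 + h0 2 + h0 3 + h0 4) / 4 - (1 - c) / 4 * hsum
    subst hc4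
    obtain ⟨m, hm⟩ := hint ![1, 1, 0, 0, 0]
    have hw : wt ![1, 1, 0, 0, 0] = 2 := by decide
    rw [hw] at hm
    have hd : x ⬝ᵥ toReal ![1, 1, 0, 0, 0] = x 0 + x 1 := by
      simp [dotProduct, Fin.sum_univ_five, toReal]
    rw [hd] at hm
    have e0 := h0 0
    have e1 := h0 1
    have hm2 : (m : ℝ) = 5 / 2 * (x 0 * x 1) := by push_cast at hm; linear_combination hm + e0 + e1
    have hm3 : 4 * (m : ℝ) ^ 2 = 1 := by
      rw [hm2]
      have e2 : x 0 ^ 2 = 1 / 5 := by linarith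
      have e3 : x 1 ^ 2 = 1 / 5 := by linarith
      linear_combination 25 * x 1 ^ 2 * e2 + 5 * e3
    have hm4 : 4 * m ^ 2 = 1 := by exact_mod_cast hm3
    omega

theorem rootLines_subset : rootLines P3 ⊆ rays (ofWt 1) ∪ rays (ofWt 2) := by
  rintro L ⟨g, hg, a, ⟨ha, -, hfix, ξ, hn, hne, hξ⟩, rfl⟩
  obtain ⟨s, -, hs⟩ := covers_P3.induces g hg
  have hp := sqNorm_pos ha
  have hre : ξ.re ^ 2 + (ξ.imI ^ 2 + ξ.imJ ^ 2 + ξ.imK ^ 2) = 1 := by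
    rw [normSq_def'] at hn; linarith
  have hc : ξ.re < 1 := by
    by_contra h
    have h1 : ξ.re = 1 := by nlinarith [sq_nonneg ξ.imI, sq_nonneg ξ.imJ, sq_nonneg ξ.imK]
    refine hne ?_
    rw [h1] at hre
    ext
    · simpa using h1
    · simp; nlinarith [sq_nonneg ξ.imI, sq_nonneg ξ.imJ, sq_nonneg ξ.imK]
    · simp; nlinarith [sq_nonneg ξ.imI, sq_nonneg ξ.imJ, sq_nonneg ξ.imK]
    · simp; nlinarith [sq_nonneg ξ.imI, sq_nonneg ξ.imJ, sq_nonneg ξ.imK]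
  have hc' : -1 ≤ ξ.re := by
    nlinarith [sq_nonneg ξ.imI, sq_nonneg ξ.imJ, sq_nonneg ξ.imK]
  have hx : ((sqNorm a)⁻¹ • hopf a) ⬝ᵥ ((sqNorm a)⁻¹ • hopf a) = 1 := by
    have : hopf a ⬝ᵥ hopf a = sqNorm a ^ 2 := by rw [← sum_hopf_sq]; simp [dotProduct, pow_two]
    rw [smul_dotProduct, dotProduct_smul, this, smul_eq_mul, smul_eq_mul]
    field_simp
  obtain ⟨t, ht, d, hd, e⟩ := exists_axis hx hc hc'
    (quadratic_of_hopf (reflection_quadratic hs ha hfix hn hξ))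
  have ht0 : t ≠ 0 := ne_zero_of_wt (by rcases ht with h | h <;> rw [h] <;> decide)
  have hL : lineOf a = ray (toReal t) := by
    refine lineOf_eq_ray (toReal_ne_zero ht0) (c := sqNorm a * d) (by positivity) ?_
    rw [mul_smul, ← e, smul_smul, mul_inv_cancel₀ hp.ne', one_smul]
  rcases ht with h | h
  · exact Or.inl ⟨t, mem_ofWt.2 h, hL.symm⟩
  · exact Or.inr ⟨t, mem_ofWt.2 h, hL.symm⟩

/-- Conjugating a reflection by `k` gives a reflection with the same scalar whose root is moved by
`k`. -/
theorem act_mem_rootLines {G : Subgroup U2} {k : U2} (hk : k ∈ G) {L : Subsp}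
    (hL : L ∈ rootLines G) : act k L ∈ rootLines G := by
  obtain ⟨g, hg, a, ⟨ha, hfin, hfix, ξ, hn, hne, hξ⟩, rfl⟩ := hL
  have hinv : ∀ x : Vec 2, (k : Mat2) *ᵥ ((k⁻¹ : U2) : Mat2) *ᵥ x = x := fun x => by
    rw [Matrix.mulVec_mulVec, ← Submonoid.coe_mul, mul_inv_cancel, OneMemClass.coe_one,
      Matrix.one_mulVec]
  have hinv' : ∀ x : Vec 2, ((k⁻¹ : U2) : Mat2) *ᵥ (k : Mat2) *ᵥ x = x := fun x => by
    rw [Matrix.mulVec_mulVec, ← Submonoid.coe_mul, inv_mul_cancel, OneMemClass.coe_one,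
      Matrix.one_mulVec]
  have hmul : ∀ x : Vec 2, ((k * g * k⁻¹ : U2) : Mat2) *ᵥ x =
      (k : Mat2) *ᵥ (g : Mat2) *ᵥ ((k⁻¹ : U2) : Mat2) *ᵥ x := fun x => by
    rw [Matrix.mulVec_mulVec, Matrix.mulVec_mulVec]; rfl
  refine ⟨k * g * k⁻¹, mul_mem (mul_mem hk hg) (inv_mem hk), (k : Mat2) *ᵥ a,
    ⟨mulVec_ne_zero k ha, ?_, fun x hx => ?_, ξ, hn, hne, ?_⟩, act_lineOf k a⟩
  · exact (MulAut.conj k).toMonoidHom.isOfFinOrder hfin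
  · rw [← hinv x, ip_mulVec] at hx
    rw [hmul, hfix _ hx, hinv]
  · rw [hmul, hinv', hξ]
    have : (fun r => a r * ξ) = MulOpposite.op ξ • a := rfl
    rw [this, Matrix.mulVec_smul]
    rfl

theorem isOfFinOrder_of_mem {Γ : Type*} [Group Γ] {G : Subgroup Γ} [Finite G] {g : Γ}
    (hg : g ∈ G) : IsOfFinOrder g :=
  G.subtype.isOfFinOrder (isOfFinOrder_of_finite (⟨g, hg⟩ : G))

theorem isOfFinOrder_of_mem_P3 {g : U2} (hg : g ∈ P3) : IsOfFinOrder g :=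
  have := covers_P3.finite
  isOfFinOrder_of_mem hg

theorem rays_subset_rootLines {t : Fin 5 → SignType} (ht : t ≠ 0)
    {O : Finset (Fin 5 → SignType)} (hO : IsOrbit (rotations ⊤) t O)
    (h : ray (toReal t) ∈ rootLines P3) : rays O ⊆ rootLines P3 := by
  rw [← covers_P3.orbit_eq ht hO]
  rintro L ⟨g, hg, rfl⟩
  exact act_mem_rootLines hg h

theorem ray_tE_mem_rootLines : ray (toReal tE) ∈ rootLines P3 := by
  have hg : (⟨matI, matI_mem⟩ : U2) ∈ P3 :=
    mem_genBy (M := matI) (Or.inl rfl) matI_mem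
  refine ⟨_, hg, vE, ⟨fun h => ?_, isOfFinOrder_of_mem_P3 hg, fun x hx => ?_, qi, ?_, ?_, ?_⟩,
    lineOf_vE.symm⟩
  · simpa [vE] using congrFun h 0
  · simp [vE, ip, dotProduct, Fin.sum_univ_two] at hx
    funext i
    fin_cases i <;> simp [matI, Matrix.mulVec, dotProduct, Fin.sum_univ_two, hx]
  · simp [normSq_def']
  · intro h
    simpa using congrArg QuaternionAlgebra.re h
  · funext i
    fin_cases i <;> simp [vE, matI, Matrix.mulVec, dotProduct, Fin.sum_univ_two]

/-- The generator `matR` is a real reflection with `-1`-eigenvector `(1 - √2, 1)`, whose Hopf image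
is `2 (√2 - 1)` times the given sign vector. -/
theorem ray_mem_rootLines : ray (toReal ![-1, -1, 0, 0, 0]) ∈ rootLines P3 := by
  have hg : (⟨matR, matR_mem⟩ : U2) ∈ P3 :=
    mem_genBy (M := matR) (Or.inr (Or.inr rfl)) matR_mem
  have h2 : √2 * √2 = 2 := Real.mul_self_sqrt zero_le_two
  have h1 : 1 < √2 := by nlinarith [Real.sqrt_nonneg 2]
  have hi : (√2)⁻¹ = √2 / 2 := by
    rw [inv_eq_one_div, div_eq_div_iff (by positivity) two_ne_zero]; linarith
  refine ⟨_, hg, ![ofR (1 - √2), 1], ⟨fun h => ?_, isOfFinOrder_of_mem_P3 hg, fun x hx => ?_, -1,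
    ?_, ?_, ?_⟩, Eq.symm (lineOf_eq_ray (c := 2 * (√2 - 1)) (toReal_ne_zero (by decide))
      (by linarith) ?_)⟩
  · simpa using congrFun h 1
  · simp [ip, dotProduct, Fin.sum_univ_two] at hx
    have hx1 : x 1 = (√2 - 1) • x 0 := by
      have h := congrArg (fun q : ℍ[ℝ] => (q.re, q.imI, q.imJ, q.imK)) hx
      simp [ofR] at h
      ext <;> simp <;> linarith [h.1, h.2.1, h.2.2.1, h.2.2.2]
    funext i
    fin_cases i <;> simp [matR, Matrix.mulVec, dotProduct, Fin.sum_univ_two, hx1, hi] <;>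
      ext <;> simp <;> ring_nf <;> simp [Real.sq_sqrt] <;> ring_nf
  · simp
  · intro h
    have := congrArg QuaternionAlgebra.re h
    norm_num at this
  · funext i
    fin_cases i <;> simp [matR, Matrix.mulVec, dotProduct, Fin.sum_univ_two, ofR, hi] <;>
      ext <;> simp <;> linarith
  · funext i
    fin_cases i <;> simp [hopf, ofR, toReal, normSq_def'] <;> linarith

theorem rootLines_P3 : rootLines P3 = rays (ofWt 1) ∪ rays (ofWt 2) := by
  refine Set.Subset.antisymm rootLines_subset (Set.union_subset
    (rays_subset_rootLines (by decide) orbit_E_top ray_tE_mem_rootLines)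
    (rays_subset_rootLines (by decide) (orbit_A_top.of_mem (by decide +kernel))
      ray_mem_rootLines))

theorem disjoint_rays {O O' : Finset (Fin 5 → SignType)} (h : Disjoint O O')
    (hO : ∀ u ∈ O, u ≠ 0) (hO' : ∀ u ∈ O', u ≠ 0) : Disjoint (rays O) (rays O') := by
  rw [Set.disjoint_left]
  rintro _ ⟨u, hu, rfl⟩ ⟨r, hr, e⟩
  have := ray_toReal_injective (hO' r hr) (hO u hu) e
  subst this
  exact Finset.disjoint_left.1 h hu hr

/-! ### The theorem -/

/-- The Hopf map sends the five bases to the five pairs of opposite coordinate vectors of `ℝ⁵`;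
orthogonality between different pairs is unbiasedness. -/
theorem isMUB_mub : IsMUB mub := by
  have h2 := sqrt_two_inv_mul_self
  have h1 : ∀ r a b, ip (mub r a) (mub r b) = if a = b then 1 else 0 := by
    intro r a b
    fin_cases r <;> fin_cases a <;> fin_cases b <;> ext <;>
      simp [mub, ip, dotProduct, Fin.sum_univ_two] <;> linarith
  refine ⟨h1, fun r s hrs a b => ?_⟩
  have hn : ∀ r a, sqNorm (mub r a) = 1 := fun r a => by
    have h := normSq_ip_self (mub r a)
    rw [h1, if_pos rfl, map_one] at h
    exact (pow_eq_one_iff_of_nonneg (Finset.sum_nonneg fun _ _ => normSq_nonneg) two_ne_zero).1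
      h.symm
  have h0 : ∀ r s, r ≠ s → ∀ a b, idot (tabM r a) (tabM s b) = 0 := by decide +kernel
  rw [normSq_ip, hn, hn, hopf_mub, hopf_mub, toReal_dotProduct, h0 r s hrs]
  norm_num

theorem representatives_P1 : ![H32, H20, H16a, H16b] =
    fun a => lineStab P1 (ray (toReal (![tE, tW, tA, tB] a))) := by
  funext a
  fin_cases a
  exacts [H32_eq, H20_eq, H16a_eq, H16b_eq]

theorem maxRow {G : Subgroup U2} {E : Subgroup SignedPerm} (hG : Covers G E) {h n : ℕ} {f : Vec 2}
    {A : Set ℝ} {S : Set Subsp} (hr : Row G h f A n S) {t : Fin 5 → SignType}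
    (hf : lineOf f = ray (toReal t)) (ht : t ≠ 0) (hp : Pins E t) : MaxRow G h f A n S :=
  ⟨hr, hf ▸ hG.isMaxReducible ht hp⟩

theorem maxReducibleOrbits_P1 :
    maxReducibleOrbits P1 = {mubLines, linesW, linesW', linesA, linesB} := by
  rw [isRepresentative_pentagon.maxReducibleOrbits_eq covers_P1, mubLines_eq, linesW_eq,
    linesW'_eq, linesA_eq, linesB_eq]
  ext S
  simp only [Fin.exists_fin_succ, Fin.exists_fin_zero, Matrix.cons_val_zero, Matrix.cons_val_succ,
    Set.mem_ofPred_eq, Set.mem_insert_iff, Set.mem_singleton_iff]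
  rw [covers_P1.orbit_eq (by decide) orbit_E_pentagon,
    covers_P1.orbit_eq (by decide) (orbit_E_pentagon.of_mem (u := -tE) (by decide +kernel)),
    covers_P1.orbit_eq (by decide) orbit_W_pentagon,
    covers_P1.orbit_eq (by decide) (orbit_W'_pentagon.of_mem (u := -tW) (by decide +kernel)),
    covers_P1.orbit_eq (by decide) orbit_A_pentagon,
    covers_P1.orbit_eq (by decide) (orbit_A_pentagon.of_mem (u := -tA) (by decide +kernel)),
    covers_P1.orbit_eq (by decide) orbit_B_pentagon,
    covers_P1.orbit_eq (by decide) (orbit_B_pentagon.of_mem (u := -tB) (by decide +kernel))]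
  tauto

theorem orbit_vC_P2 : orbit P2 (lineOf vC) = rays (ofWt 3) := by
  rw [lineOf_vC, covers_P2.orbit_eq (by decide) orbit_C_alternating]

theorem orbit_vC_P3 : orbit P3 (lineOf vC) = rays (ofWt 3) := by
  rw [lineOf_vC, covers_P3.orbit_eq (by decide) orbit_C_top]

theorem orbit_vD_P3 : orbit P3 (lineOf vD) = rays (ofWt 4) := by
  rw [lineOf_vD, covers_P3.orbit_eq (by decide) orbit_D_top]

theorem maxReducibleOrbits_P2 : maxReducibleOrbits P2 =
    {mubLines, linesW, linesW', linesA ∪ linesB, orbit P2 (lineOf vC)} := by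
  rw [isRepresentative_alternating.maxReducibleOrbits_eq covers_P2, mubLines_eq, linesW_eq,
    linesW'_eq, linesA_union, orbit_vC_P2]
  ext S
  simp only [Fin.exists_fin_succ, Fin.exists_fin_zero, Matrix.cons_val_zero, Matrix.cons_val_succ,
    Set.mem_ofPred_eq, Set.mem_insert_iff, Set.mem_singleton_iff]
  rw [covers_P2.orbit_eq (by decide) orbit_E_alternating,
    covers_P2.orbit_eq (by decide) (orbit_E_alternating.of_mem (u := -tE) (by decide +kernel)),
    covers_P2.orbit_eq (by decide) orbit_W_alternating,
    covers_P2.orbit_eq (by decide) (orbit_W'_alternating.of_mem (u := -tW) (by decide +kernel)),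
    covers_P2.orbit_eq (by decide) orbit_A_alternating,
    covers_P2.orbit_eq (by decide) (orbit_A_alternating.of_mem (u := -tA) (by decide +kernel)),
    covers_P2.orbit_eq (by decide) orbit_C_alternating,
    covers_P2.orbit_eq (by decide) (orbit_C_alternating.of_mem (u := -tC) (by decide +kernel))]
  tauto

theorem maxReducibleOrbits_P3 : maxReducibleOrbits P3 =
    {mubLines, linesW ∪ linesW', linesA ∪ linesB, orbit P3 (lineOf vC),
      orbit P3 (lineOf vD)} := by
  rw [isRepresentative_top.maxReducibleOrbits_eq covers_P3, mubLines_eq, linesW_union,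
    linesA_union, orbit_vC_P3, orbit_vD_P3]
  ext S
  simp only [Fin.exists_fin_succ, Fin.exists_fin_zero, Matrix.cons_val_zero, Matrix.cons_val_succ,
    Set.mem_ofPred_eq, Set.mem_insert_iff, Set.mem_singleton_iff]
  rw [covers_P3.orbit_eq (by decide) orbit_E_top,
    covers_P3.orbit_eq (by decide) (orbit_E_top.of_mem (u := -tE) (by decide +kernel)),
    covers_P3.orbit_eq (by decide) orbit_W_top,
    covers_P3.orbit_eq (by decide) (orbit_W_top.of_mem (u := -tW) (by decide +kernel)),
    covers_P3.orbit_eq (by decide) orbit_A_top,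
    covers_P3.orbit_eq (by decide) (orbit_A_top.of_mem (u := -tA) (by decide +kernel)),
    covers_P3.orbit_eq (by decide) orbit_C_top,
    covers_P3.orbit_eq (by decide) (orbit_C_top.of_mem (u := -tC) (by decide +kernel)),
    covers_P3.orbit_eq (by decide) orbit_D_top,
    covers_P3.orbit_eq (by decide) (orbit_D_top.of_mem (u := -tD) (by decide +kernel))]
  tauto

theorem representsMaxReducible_P2 :
    RepresentsMaxReducible P2 (fun a => lineStab P2 (lineOf (![vE, vW, vA, vC] a))) := by
  have h : (fun a => lineStab P2 (lineOf (![vE, vW, vA, vC] a))) =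
      fun a => lineStab P2 (ray (toReal (![tE, tW, tA, tC] a))) := by
    funext a
    congr 1
    fin_cases a
    exacts [lineOf_vE, lineOf_vW, lineOf_vA, lineOf_vC]
  rw [h]
  exact isRepresentative_alternating.representsMaxReducible covers_P2

theorem representsMaxReducible_P3 :
    RepresentsMaxReducible P3 (fun a => lineStab P3 (lineOf (![vE, vW, vA, vC, vD] a))) := by
  have h : (fun a => lineStab P3 (lineOf (![vE, vW, vA, vC, vD] a))) =
      fun a => lineStab P3 (ray (toReal (![tE, tW, tA, tC, tD] a))) := by
    funext a
    congr 1
    fin_cases a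
    exacts [lineOf_vE, lineOf_vW, lineOf_vA, lineOf_vC, lineOf_vD]
  rw [h]
  exact isRepresentative_top.representsMaxReducible covers_P3

theorem ne_zero_of_mem_ofWt {k : ℕ} (hk : k ≠ 0) {u : Fin 5 → SignType} (h : u ∈ ofWt k) :
    u ≠ 0 :=
  ne_zero_of_wt ((mem_ofWt.1 h).trans_ne hk)

theorem rootLines_diff : rootLines P3 \ mubLines = rays (ofWt 2) := by
  rw [rootLines_P3, mubLines_eq, Set.union_sdiff_left]
  refine (disjoint_rays (Finset.disjoint_left.2 fun u h h' => ?_)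
    (fun u => ne_zero_of_mem_ofWt two_ne_zero) fun u => ne_zero_of_mem_ofWt one_ne_zero).sdiff_eq_left
  rw [mem_ofWt] at h h'
  omega

end QuatP

open SignedPerm

theorem mainTheorem7 :
    -- the groups and the mutually unbiased bases
    (Nat.card P1 = 320 ∧ Nat.card P2 = 1920 ∧ Nat.card P3 = 3840 ∧ IsMUB mub) ∧
    -- the maximal reducible subgroups of the first group and their fixed lines
    (RepresentsMaxReducible P1 ![H32, H20, H16a, H16b] ∧
      Nat.card H32 = 32 ∧ Nat.card H20 = 20 ∧ Nat.card H16a = 16 ∧ Nat.card H16b = 16 ∧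
      fixedLines H32 = {lineOf vE, lineOf ![0, 1]} ∧
      fixedLines H20 = {lineOf vW, lineOf vW'} ∧
      fixedLines H16a = {lineOf vA, lineOf ![-1 + qi, ofR √2]} ∧
      fixedLines H16b = {lineOf vB, lineOf ![-1 + qj, ofR √2]} ∧
      maxReducibleOrbits P1 = {mubLines, linesW, linesW', linesA, linesB}) ∧
    -- the two sets of 20 lines partition the root lines of the third group off the MUB lines
    (mubLines ⊆ rootLines P3 ∧ (rootLines P3 \ mubLines).ncard = 40 ∧
      linesA ∪ linesB = rootLines P3 \ mubLines ∧ Disjoint linesA linesB) ∧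
    -- the maximal reducible subgroups of the second and third groups
    (RepresentsMaxReducible P2 (fun a => lineStab P2 (lineOf (![vE, vW, vA, vC] a))) ∧
      maxReducibleOrbits P2 =
        {mubLines, linesW, linesW', linesA ∪ linesB, orbit P2 (lineOf vC)}) ∧
    (RepresentsMaxReducible P3 (fun a => lineStab P3 (lineOf (![vE, vW, vA, vC, vD] a))) ∧
      maxReducibleOrbits P3 =
        {mubLines, linesW ∪ linesW', linesA ∪ linesB, orbit P3 (lineOf vC),
          orbit P3 (lineOf vD)}) ∧
    -- each maximal reducible subgroup fixes finitely many lines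
    (∀ G ∈ ({P1, P2, P3} : Set (Subgroup U2)), ∀ H, IsMaxReducible G H →
      (fixedLines H).Finite) ∧
    -- the rows of the table
    (MaxRow P1 32 vE {0, 1 / 2} 10 mubLines ∧
      MaxRow P2 192 vE {0, 1 / 2} 10 mubLines ∧
      MaxRow P3 384 vE {0, 1 / 2} 10 mubLines) ∧
    (MaxRow P1 20 vW {1 / 5, 3 / 5} 16 linesW ∧
      MaxRow P2 120 vW {1 / 5, 3 / 5} 16 linesW) ∧
    (MaxRow P1 20 vW' {1 / 5, 3 / 5} 16 linesW' ∧
      MaxRow P2 120 vW' {1 / 5, 3 / 5} 16 linesW') ∧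
    MaxRow P3 120 vW {0, 1 / 5, 2 / 5, 3 / 5, 4 / 5} 32 (linesW ∪ linesW') ∧
    MaxRow P1 16 vA {0, 1 / 4, 1 / 2, 3 / 4} 20 linesA ∧
    MaxRow P1 16 vB {0, 1 / 4, 1 / 2, 3 / 4} 20 linesB ∧
    (MaxRow P2 48 vA {0, 1 / 4, 1 / 2, 3 / 4} 40 (linesA ∪ linesB) ∧
      MaxRow P3 96 vA {0, 1 / 4, 1 / 2, 3 / 4} 40 (linesA ∪ linesB)) ∧
    NonMaxRow P1 8 vC {0, 1 / 6, 1 / 3, 1 / 2, 2 / 3, 5 / 6} 40 (orbit P1 (lineOf vC)) ∧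
    (MaxRow P2 24 vC {0, 1 / 6, 1 / 3, 1 / 2, 2 / 3, 5 / 6} 80 (orbit P3 (lineOf vC)) ∧
      MaxRow P3 48 vC {0, 1 / 6, 1 / 3, 1 / 2, 2 / 3, 5 / 6} 80 (orbit P3 (lineOf vC))) ∧
    (NonMaxRow P1 4 vD {0, 1 / 8, 2 / 8, 3 / 8, 4 / 8, 5 / 8, 6 / 8, 7 / 8} 80
        (orbit P3 (lineOf vD)) ∧
      NonMaxRow P2 24 vD {0, 1 / 8, 2 / 8, 3 / 8, 4 / 8, 5 / 8, 6 / 8, 7 / 8} 80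
        (orbit P3 (lineOf vD)) ∧
      MaxRow P3 48 vD {0, 1 / 8, 2 / 8, 3 / 8, 4 / 8, 5 / 8, 6 / 8, 7 / 8} 80
        (orbit P3 (lineOf vD))) := by
  have hp : rotations pentagon ≤ rotations ⊤ := rotations_mono le_top
  have ha : rotations pentagon ≤ rotations (alternatingGroup (Fin 5)) := pentagon_le_alternating
  have hat : rotations (alternatingGroup (Fin 5)) ≤ rotations ⊤ := rotations_mono le_top
  have pW : Pins (rotations pentagon) tW' := by
    have h : tW' = -tW := by decide
    rw [h]
    exact pins_tW.neg
  have nE : tE ≠ 0 := by decide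
  have nW : tW ≠ 0 := by decide
  have nW' : tW' ≠ 0 := by decide
  have nA : tA ≠ 0 := by decide
  have nB : tB ≠ 0 := by decide
  have nC : tC ≠ 0 := by decide
  have nD : tD ≠ 0 := by decide
  have cC : orbC.card = 40 := by decide +kernel
  have c3 : (ofWt 3).card = 80 := by decide +kernel
  have rE := row_E covers_P1 orbit_E_pentagon (h := 32) card_P1
  have rW := row_W covers_P1 orbit_W_pentagon (h := 20) card_P1
  have rA := row_A covers_P1 orbit_A_pentagon (h := 16) card_P1
  have rB := row_B covers_P1 orbit_B_pentagon (h := 16) card_P1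
  have rC1 := row_C covers_P1 orbit_C_pentagon (Or.inl rfl) (h := 8) (by rw [cC, card_P1])
  have rC2 := row_C covers_P2 orbit_C_alternating (Or.inr rfl) (h := 24) (by rw [c3, card_P2])
  have rC3 := row_C covers_P3 orbit_C_top (Or.inr rfl) (h := 48) (by rw [c3, card_P3])
  have oC1 : orbit P1 (lineOf vC) = rays orbC := by
    rw [lineOf_vC, covers_P1.orbit_eq nC orbit_C_pentagon]
  rw [cC, ← oC1] at rC1
  -- The orbits of this line under `P2` and `P3` coincide, both being all vectors of weight three,
  -- so one set serves for both rows.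
  rw [c3, ← orbit_vC_P3] at rC2 rC3
  have eW : -tW = tW' := by decide
  refine ⟨⟨card_P1, card_P2, card_P3, isMUB_mub⟩, ⟨?_, ?_, ?_, ?_, ?_, ?_, ?_, ?_, ?_,
      maxReducibleOrbits_P1⟩, ⟨?_, ?_, ?_, ?_⟩,
    ⟨representsMaxReducible_P2, maxReducibleOrbits_P2⟩,
    ⟨representsMaxReducible_P3, maxReducibleOrbits_P3⟩, ?_,
    ⟨maxRow covers_P1 rE lineOf_vE nE pins_tE,
      maxRow covers_P2 (row_E covers_P2 orbit_E_alternating card_P2) lineOf_vE nE (pins_tE.mono ha),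
      maxRow covers_P3 (row_E covers_P3 orbit_E_top card_P3) lineOf_vE nE (pins_tE.mono hp)⟩,
    ⟨maxRow covers_P1 rW lineOf_vW nW pins_tW,
      maxRow covers_P2 (row_W covers_P2 orbit_W_alternating card_P2) lineOf_vW nW
        (pins_tW.mono ha)⟩,
    ⟨maxRow covers_P1 (row_W' covers_P1 orbit_W'_pentagon card_P1) lineOf_vW' nW' pW,
      maxRow covers_P2 (row_W' covers_P2 orbit_W'_alternating card_P2) lineOf_vW' nW' (pW.mono ha)⟩,
    maxRow covers_P3 (row_WW' covers_P3 orbit_W_top card_P3) lineOf_vW nW (pins_tW.mono hp),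
    maxRow covers_P1 rA lineOf_vA nA pins_tA, maxRow covers_P1 rB lineOf_vB nB pins_tB,
    ⟨maxRow covers_P2 (row_AB covers_P2 orbit_A_alternating card_P2) lineOf_vA nA
        (pins_tA.mono ha),
      maxRow covers_P3 (row_AB covers_P3 orbit_A_top card_P3) lineOf_vA nA (pins_tA.mono hp)⟩,
    ⟨rC1, ?_⟩,
    ⟨maxRow covers_P2 rC2 lineOf_vC nC pins_tC,
      maxRow covers_P3 rC3 lineOf_vC nC (pins_tC.mono hat)⟩, ?_⟩
  · rw [representatives_P1]
    exact isRepresentative_pentagon.representsMaxReducible covers_P1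
  · rw [H32_eq, ← lineOf_vE]; exact rE.card_stab
  · rw [H20_eq, ← lineOf_vW]; exact rW.card_stab
  · rw [H16a_eq, ← lineOf_vA]; exact rA.card_stab
  · rw [H16b_eq, ← lineOf_vB]; exact rB.card_stab
  · rw [H32_eq, covers_P1.fixedLines_eq nE pins_tE, lineOf_vE, lineOf_e2]
  · rw [H20_eq, covers_P1.fixedLines_eq nW pins_tW, lineOf_vW, lineOf_vW', eW]
  · rw [H16a_eq, covers_P1.fixedLines_eq nA pins_tA, lineOf_vA, lineOf_vA']
  · rw [H16b_eq, covers_P1.fixedLines_eq nB pins_tB, lineOf_vB, lineOf_vB']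
  · rw [rootLines_P3, mubLines_eq]; exact Set.subset_union_left
  · rw [rootLines_diff, ncard_rays fun u => ne_zero_of_mem_ofWt two_ne_zero]; decide +kernel
  · rw [rootLines_diff, linesA_union]
  · rw [linesA_eq, linesB_eq]
    refine disjoint_rays (Finset.disjoint_left.2 ?_)
      (fun u h => ne_zero_of_wt ((mem_orbA.1 h).1.trans_ne two_ne_zero))
      fun u h => ne_zero_of_wt ((mem_orbB.1 h).1.trans_ne two_ne_zero)
    simp only [mem_orbA, mem_orbB]
    decide +kernel
  · rintro G (rfl | rfl | rfl) H hH
    · exact isRepresentative_pentagon.finite_fixedLines covers_P1 hH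
    · exact isRepresentative_alternating.finite_fixedLines covers_P2 hH
    · exact isRepresentative_top.finite_fixedLines covers_P3 hH
  -- In `P1` the stabiliser of this line also fixes a line of the mutually unbiased bases, whose
  -- orbit has 10 lines instead of 40.
  · rw [lineOf_vC]
    exact covers_P1.not_isMaxReducible nC (by decide) dominates_tC orbit_C_pentagon
      (orbit_E_pentagon.of_mem (by decide +kernel)) (by decide +kernel)
  · rw [orbit_vD_P3]
    refine ⟨⟨row_D covers_P1 orbit_D_pentagon card_P1, ?_⟩,
      ⟨row_D covers_P2 orbit_D_alternating card_P2, ?_⟩,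
      maxRow covers_P3 (row_D covers_P3 orbit_D_top card_P3) lineOf_vD nD pins_tD⟩
    · rw [lineOf_vD]
      exact covers_P1.not_isMaxReducible nD nW (dominates_tD.mono ha) orbit_D_pentagon
        orbit_W_pentagon (by decide +kernel)
    · rw [lineOf_vD]
      exact covers_P2.not_isMaxReducible nD nW dominates_tD orbit_D_alternating
        orbit_W_alternating (by decide +kernel)
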